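/- **Setting.** Let $T[1..n]$, $n\ge 2$, be a string with $T[1],\dots,T[n-1]\in[1..\sigma]$, $\sigma\le n$, and $T[n]=\$$, where the sentinel $\$$ has numerical value $0$. Let $\mathrm{SA}[1..n]$ be its suffix array, i.e. the permutation of $[1..n]$ with $T[\mathrm{SA}[1]..n]\prec\dots\prec T[\mathrm{SA}[n]..n]$ in lexicographic order. Let $\mathrm{LCP}[1]=0$ and, for $i\in[2..n]$, let $\mathrm{LCP}[i]$ be the length of the longest common prefix of the suffixes starting at $\mathrm{SA}[i]$ and $\mathrm{SA}[i-1]$; let $\mathrm{PLCP}[\mathrm{SA}[i]]=\mathrm{LCP}[i]$ for $i\in[1..n]$. The succinct PLCP bitvector $\mathrm{PLCP_{succ}}[1..2n]$ has $\mathrm{PLCP_{succ}}[j']=1$ if $j'=2j+\mathrm{PLCP}[j]$ for some $j\in[1..n]$, and $\mathrm{PLCP_{succ}}[j']=0$ otherwise. Let $\mathrm{BWT}[i]=T[\mathrm{SA}[i]-1]$ if $\mathrm{SA}[i]>1$ and $\mathrm{BWT}[i]=T[n]$ otherwise, let $r$ be the number of maximal runs of equal symbols in $\mathrm{BWT}[1..n]$,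 and let RLBWT be the list of pairs $\langle\lambda_i,c_i\rangle_{i=1,\dots,r}$ of the starting position and the symbol of the $i$-th run. The value $\mathrm{PLCP}[\mathrm{SA}[i]]=\mathrm{LCP}[i]$ is irreducible if $i$ is the starting position of a run, i.e. $i=1$ or $\mathrm{BWT}[i]\ne\mathrm{BWT}[i-1]$. The model of computation is the deterministic word-RAM with words of $w=\Theta(\log n)$ bits, long enough to hold the number $n$ (i.e. $n<2^w$), in which the usual arithmetic and logic operations take constant time; space is counted in words. **Theorem.** Given $n$, $r$ and the RLBWT of $T[1..n]$, the bitvector $\mathrm{PLCP_{succ}}$, packed $w$ bits to a word, can be computed in $$O\!\left(\frac{n}{\log n}+r\log^{11}n\right)\ \text{time and}\quad O\!\left(\frac{n}{\log n}+r\log^{10}n\right)\ \text{words of working space.}$$ Within the same bounds one can compute, instead, the list of the irreducible LCP values in text order, i.e. the list of the pairs $(j,\mathrm{PLCP}[j])$ with $\mathrm{PLCP}[j]$ irreducible, by increasing $j$. -/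

import Mathlib

/-! # Texts, suffix arrays, the Burrows–Wheeler transform and LCP arrays

Strings are lists of natural numbers. Positions are counted from `1`, as usual for suffix arrays:
position `j` of the string `T` holds `T[j - 1]`. -/

namespace RunLengthBWT

/-- `T` is a text over the alphabet `[1..σ]`: all its symbols are in `[1..σ]`, except for the last
one, which is the sentinel with numerical value `0`. -/
def IsText (σ : ℕ) (T : List ℕ) : Prop :=
  ∃ S : List ℕ, T = S ++ [0] ∧ ∀ c ∈ S, 1 ≤ c ∧ c ≤ σ

/-- The symbol at position `j` (counted from `1`). -/
def symbol (T : List ℕ) (j : ℕ) : ℕ := T.getD (j - 1) 0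

/-- The suffix `T[j..n]` (`j` counted from `1`). -/
def suffix (T : List ℕ) (j : ℕ) : List ℕ := T.drop (j - 1)

/-- The positions `1, …, n` sorted by the lexicographic order of the suffixes starting there. -/
def saList (T : List ℕ) : List ℕ :=
  (List.range' 1 T.length).mergeSort (fun i j => decide (suffix T i ≤ suffix T j))

/-- The suffix array, `SA[i]` for `i ∈ [1..n]`. -/
def SA (T : List ℕ) (i : ℕ) : ℕ := (saList T).getD (i - 1) 0

/-- The inverse suffix array: for `j ∈ [1..n]`, the index `i ∈ [1..n]` with `SA[i] = j`. -/
def ISA (T : List ℕ) (j : ℕ) : ℕ := (saList T).idxOf j + 1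

/-- The length of the longest common prefix of two strings. -/
def lcp : List ℕ → List ℕ → ℕ
  | a :: x, b :: y => if a = b then lcp x y + 1 else 0
  | _, _ => 0

/-- The LCP array: `LCP[1] = 0`, and for `i ∈ [2..n]` the entry `LCP[i]` is the length of the longest
common prefix of the suffixes `SA[i]` and `SA[i-1]`. -/
def LCP (T : List ℕ) (i : ℕ) : ℕ :=
  if i ≤ 1 then 0 else lcp (suffix T (SA T i)) (suffix T (SA T (i - 1)))

/-- The permuted LCP array, `PLCP[SA[i]] = LCP[i]`. -/
def PLCP (T : List ℕ) (j : ℕ) : ℕ := LCP T (ISA T j)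

/-- The succinct PLCP bitvector: `PLCPsucc T j'` says that the bit at position `j' ∈ [1..2n]` is `1`,
i.e. that `j' = 2j + PLCP[j]` for some `j ∈ [1..n]`. -/
def PLCPsucc (T : List ℕ) (j' : ℕ) : Prop :=
  ∃ j, 1 ≤ j ∧ j ≤ T.length ∧ j' = 2 * j + PLCP T j

/-- The Burrows–Wheeler transform: `BWT[i] = T[SA[i]-1]` if `SA[i] > 1`, else `T[n]`. -/
def BWT (T : List ℕ) (i : ℕ) : ℕ :=
  if 1 < SA T i then symbol T (SA T i - 1) else symbol T T.length

/-- A run of equal symbols of the BWT starts at the index `i`. -/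
def IsRunStart (T : List ℕ) (i : ℕ) : Prop := i = 1 ∨ BWT T i ≠ BWT T (i - 1)

instance (T : List ℕ) : DecidablePred (IsRunStart T) :=
  fun i => inferInstanceAs (Decidable (i = 1 ∨ BWT T i ≠ BWT T (i - 1)))

/-- The run-length compressed BWT: the list of the pairs `(λ, c)`, one for each run, of its starting
position and its symbol, from left to right. -/
def RLBWT (T : List ℕ) : List (ℕ × ℕ) :=
  ((List.range' 1 T.length).filter (fun i => decide (IsRunStart T i))).map (fun i => (i, BWT T i))

/-- The number `r` of runs of the BWT. -/
def numRuns (T : List ℕ) : ℕ := (RLBWT T).length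

/-- The list of the irreducible LCP values in text order: the pairs `(j, PLCP[j])`, by increasing
`j ∈ [1..n]`, for which `PLCP[j] = LCP[ISA[j]]` is irreducible, i.e. a run of the BWT starts at
`ISA[j]`. -/
def irreducibleList (T : List ℕ) : List (ℕ × ℕ) :=
  ((List.range' 1 T.length).filter (fun j => decide (IsRunStart T (ISA T j)))).map
    (fun j => (j, PLCP T j))

end RunLengthBWT

/-! # The word-RAM

A machine with words of `w` bits. It has registers, and arrays of words that are accessed by
indirect addressing, the index being a word too. Registers and arrays are named by natural numbers
occurring in the program text, so that a program uses only constantly many of each. A program is a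
finite text that depends on neither the input nor the word length. -/

namespace WordRAM

/-- The binary operations on words, all of unit cost. -/
inductive Op
  | add | sub | mul | div | mod | and | or | xor | shl | shr | lt | eq

/-- Arithmetic is unsigned and modulo `2 ^ w`; comparisons yield `1` for true and `0` for false. -/
def Op.eval {w : ℕ} : Op → BitVec w → BitVec w → BitVec w
  | .add, x, y => x + y
  | .sub, x, y => x - y
  | .mul, x, y => x * y
  | .div, x, y => x / y
  | .mod, x, y => x % y
  | .and, x, y => x &&& y
  | .or, x, y => x ||| y
  | .xor, x, y => x ^^^ y
  | .shl, x, y => x <<< y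
  | .shr, x, y => x >>> y
  | .lt, x, y => if x < y then 1 else 0
  | .eq, x, y => if x = y then 1 else 0

/-- Expressions over registers and constants. -/
inductive Expr
  | const (k : ℕ)
  | reg (x : ℕ)
  | op (o : Op) (e e' : Expr)

/-- The contents of the registers and of the arrays. -/
structure State (w : ℕ) where
  reg : ℕ → BitVec w
  arr : ℕ → ℕ → BitVec w

def Expr.eval {w : ℕ} (s : State w) : Expr → BitVec w
  | .const k => BitVec.ofNat w k
  | .reg x => s.reg x
  | .op o e e' => o.eval (e.eval s) (e'.eval s)

/-- The time to evaluate an expression: one step for each of its nodes. -/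
def Expr.cost : Expr → ℕ
  | .const _ => 1
  | .reg _ => 1
  | .op _ e e' => e.cost + e'.cost + 1

def State.setReg {w : ℕ} (s : State w) (x : ℕ) (v : BitVec w) : State w :=
  { s with reg := Function.update s.reg x v }

def State.setArr {w : ℕ} (s : State w) (a i : ℕ) (v : BitVec w) : State w :=
  { s with arr := Function.update s.arr a (Function.update (s.arr a) i v) }

/-- Programs. A condition holds if its value is not `0`. -/
inductive Cmd
  | skip
  | assign (x : ℕ) (e : Expr)
  | load (x a : ℕ) (i : Expr)
  | store (a : ℕ) (i e : Expr)
  | seq (p q : Cmd)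
  | cond (e : Expr) (p q : Cmd)
  | loop (e : Expr) (p : Cmd)

/-- `Exec cap p s t s'`: started in the state `s`, the program `p` halts after exactly `t` steps in
the state `s'`, and in every array `a` it accesses (reads or writes) only the first `cap a` cells. -/
inductive Exec {w : ℕ} (cap : ℕ → ℕ) : Cmd → State w → ℕ → State w → Prop
  | skip (s : State w) : Exec cap .skip s 1 s
  | assign (s : State w) (x : ℕ) (e : Expr) :
      Exec cap (.assign x e) s (e.cost + 1) (s.setReg x (e.eval s))
  | load (s : State w) (x a : ℕ) (i : Expr) (h : (i.eval s).toNat < cap a) :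
      Exec cap (.load x a i) s (i.cost + 1) (s.setReg x (s.arr a (i.eval s).toNat))
  | store (s : State w) (a : ℕ) (i e : Expr) (h : (i.eval s).toNat < cap a) :
      Exec cap (.store a i e) s (i.cost + e.cost + 1) (s.setArr a (i.eval s).toNat (e.eval s))
  | seq {s s₁ s₂ : State w} {p q : Cmd} {t₁ t₂ : ℕ} (h₁ : Exec cap p s t₁ s₁)
      (h₂ : Exec cap q s₁ t₂ s₂) : Exec cap (.seq p q) s (t₁ + t₂) s₂
  | condTrue {s s₁ : State w} {e : Expr} {p q : Cmd} {t : ℕ} (he : e.eval s ≠ 0)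
      (h : Exec cap p s t s₁) : Exec cap (.cond e p q) s (e.cost + 1 + t) s₁
  | condFalse {s s₁ : State w} {e : Expr} {p q : Cmd} {t : ℕ} (he : e.eval s = 0)
      (h : Exec cap q s t s₁) : Exec cap (.cond e p q) s (e.cost + 1 + t) s₁
  | loopTrue {s s₁ s₂ : State w} {e : Expr} {p : Cmd} {t₁ t₂ : ℕ} (he : e.eval s ≠ 0)
      (h₁ : Exec cap p s t₁ s₁) (h₂ : Exec cap (.loop e p) s₁ t₂ s₂) :
      Exec cap (.loop e p) s (e.cost + 1 + t₁ + t₂) s₂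
  | loopFalse {s : State w} {e : Expr} {p : Cmd} (he : e.eval s = 0) :
      Exec cap (.loop e p) s (e.cost + 1) s

/-- Started in `s`, the program `p` halts within `time` steps in a state that satisfies `Q`, and the
prefixes of the arrays it accesses (those with the input and the output included) have at most
`space` words in total. (The registers add only a number of words that depends on `p` alone.) -/
def HaltsWithin {w : ℕ} (p : Cmd) (s : State w) (time space : ℝ) (Q : State w → Prop) : Prop :=
  ∃ (cap : ℕ →₀ ℕ) (t : ℕ) (s' : State w), Exec cap p s t s' ∧ (t : ℝ) ≤ time ∧
    ((cap.sum (fun _ m => m) : ℕ) : ℝ) ≤ space ∧ Q s'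

end WordRAM

/-! # Input and output formats -/

namespace RunLengthBWT

open WordRAM

/-- The initial state for a text `T[1..n]` given by its run-length compressed BWT
`(λ₁, c₁), …, (λᵣ, cᵣ)`: register `0` holds `n`, register `1` holds `r`, array `0` holds
`λ₁, …, λᵣ`, array `1` holds `c₁, …, cᵣ`, and all the rest is `0`. -/
def inputState (w : ℕ) (T : List ℕ) : State w where
  reg x := if x = 0 then BitVec.ofNat w T.length
    else if x = 1 then BitVec.ofNat w (numRuns T) else 0
  arr a i := if a = 0 then BitVec.ofNat w (((RLBWT T).map Prod.fst).getD i 0)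
    else if a = 1 then BitVec.ofNat w (((RLBWT T).map Prod.snd).getD i 0) else 0

/-- Array `2` holds the bits `1, …, 2n` of the succinct PLCP bitvector, packed `w` to a word: the
bit at position `q * w + b + 1`, where `b < w`, is bit number `b` of word number `q`. -/
def HoldsPLCPsucc {w : ℕ} (T : List ℕ) (s : State w) : Prop :=
  ∀ q b : ℕ, b < w → q * w + b < 2 * T.length →
    ((s.arr 2 q).getLsbD b = true ↔ PLCPsucc T (q * w + b + 1))

/-- The list of the irreducible LCP values in text order is stored in the arrays `2` (the text
positions `j`) and `3` (the values `PLCP[j]`). -/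
def HoldsIrreducibleList {w : ℕ} (T : List ℕ) (s : State w) : Prop :=
  ∀ (k : ℕ) (hk : k < (irreducibleList T).length),
    (s.arr 2 k).toNat = ((irreducibleList T)[k]).1 ∧
    (s.arr 3 k).toNat = ((irreducibleList T)[k]).2

/-- The program `p` computes the output described by `Q` from the run-length compressed BWT of a
text `T[1..n]`, `n ≥ 2`, over an alphabet `[1..σ]` with `σ ≤ n`, on word-RAMs with words of
`w = Θ(log n)` bits that are long enough to hold the number `n`, in `O(f n r)` time and `O(g n r)`
space, where `r` is the number of runs of the BWT. The constant `C` hidden in the `O` may depend on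
the constant `κ` hidden in the `Θ` only. -/
def ComputesFromRLBWT (p : Cmd) (f g : ℕ → ℕ → ℝ)
    (Q : ∀ {w : ℕ}, List ℕ → State w → Prop) : Prop :=
  ∀ κ : ℝ, ∃ C : ℝ, ∀ (T : List ℕ) (n σ w : ℕ), T.length = n → 2 ≤ n → σ ≤ n → IsText σ T →
    n < 2 ^ w → (w : ℝ) ≤ κ * Real.logb 2 n →
      HaltsWithin p (inputState w T) (C * f n (numRuns T)) (C * g n (numRuns T)) (Q T)

end RunLengthBWT

/-! Write row `x` for the `(x+1)`-st smallest suffix and let `psi` send the row of a text position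
to the row of the next position, cyclically. Row `0` is the suffix consisting of the sentinel, so
`psi^[j] 0` is the row of text position `j`. `RowSystem` collects the properties of rows that the
algorithm needs, and `IsText.rowSystem` derives them for a text.

If `psi x` does not start a run of the BWT, then `psi x = psi (x - 1) + 1` and the two rows have the
same first symbol (`RowSystem.not_start_succ`). Hence `psi^[a]` is a translation on pieces, a piece
beginning at each row that meets a run start within `a` steps. As `psi` is injective, there are at
most `a * r` pieces (`RowSystem.le_of_break`). A `Table` lists the pieces, their images and names
for the prefixes of length `a`. For `a = 1` it comes from a stable sort of the runs by symbol
(`RowSystem.psi_of_sorted`). A table is squared by cutting the image of each piece at the piece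
boundaries. Rows with a common prefix are contiguous, so new names are found by comparing each entry
with its predecessor (`PartialTable.step`). With `L` the bit length of `n`, squaring goes on until
the step `s` is at least `L ^ 2`, but stays below `2 * L ^ 2`, or until `s` is about half of `n`.

With this table the text is traversed in about `n / s` jumps of one binary search each, which takes
`O(n / L)` time, and the row of every `s`-th position is sampled. The positions of run starts (the
irreducible positions) and of run ends are recorded as well. They occur only in blocks whose first
row is the first or the last row of its piece; there are `O(s * r)` such blocks (`hits_card_le`),
and only these are followed step by step.

The irreducible values are then computed in text order. The row above the start of a run is the end
of the previous run, so its text position is on record (`Recorded.phi`). PLCP drops by at most one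
per position (`RowSystem.ell_psi_ge`), which gives a lower bound from the previous value. The bound
is extended `s` symbols at a time by comparing names, and finally by single symbols. Since `j +
PLCP[j]` never decreases and is at most `n`, only `n / s` long comparisons succeed altogether.

At reducible positions PLCP drops by exactly one (`RowSystem.ell_psi_eq`), so `2 * j + PLCP[j]`
grows by one. The ones of the bitvector therefore form at most `r` intervals, which are written word
by word (`Recorded.chainBits_iff`).

The resulting cost is `O(n / L + n / w + w + r * L ^ 5)` time and `O(n / L ^ 2 + n / w + r * L ^ 2)`
space, which is within the claimed bounds. Correctness and running time are proved together, by
verification conditions over natural numbers with a clock (`vc`, `wp_loop`) that also exclude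
overflow. -/

namespace WordRAM

/-! ## A program logic over natural numbers, with a clock -/

/-- A state read through `BitVec.toNat`, with the number `t` of steps made so far. -/
@[ext] structure Cfg where
  reg : ℕ → ℕ
  arr : ℕ → ℕ → ℕ
  t : ℕ

namespace Cfg

def set (c : Cfg) (x v : ℕ) : Cfg := { c with reg := Function.update c.reg x v }

def put (c : Cfg) (a i v : ℕ) : Cfg :=
  { c with arr := Function.update c.arr a (Function.update (c.arr a) i v) }

def tick (c : Cfg) (k : ℕ) : Cfg := { c with t := c.t + k }

@[simp] theorem set_reg (c : Cfg) (x v y : ℕ) :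
    (c.set x v).reg y = if y = x then v else c.reg y := by
  simp [set, Function.update_apply]

@[simp] theorem set_arr (c : Cfg) (x v : ℕ) : (c.set x v).arr = c.arr := rfl
@[simp] theorem set_t (c : Cfg) (x v : ℕ) : (c.set x v).t = c.t := rfl
@[simp] theorem put_reg (c : Cfg) (a i v : ℕ) : (c.put a i v).reg = c.reg := rfl
@[simp] theorem put_t (c : Cfg) (a i v : ℕ) : (c.put a i v).t = c.t := rfl

@[simp] theorem put_arr (c : Cfg) (a i v b : ℕ) :
    (c.put a i v).arr b = if b = a then Function.update (c.arr a) i v else c.arr b := by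
  simp only [put, Function.update_apply]

@[simp] theorem tick_reg (c : Cfg) (k : ℕ) : (c.tick k).reg = c.reg := rfl
@[simp] theorem tick_arr (c : Cfg) (k : ℕ) : (c.tick k).arr = c.arr := rfl
@[simp] theorem tick_t (c : Cfg) (k : ℕ) : (c.tick k).t = c.t + k := rfl

end Cfg

open Classical in
/-- The truth value of a proposition, as a number. -/
noncomputable def ind (p : Prop) : ℕ := if p then 1 else 0

@[simp] theorem ind_eq_zero (p : Prop) : ind p = 0 ↔ ¬ p := by
  unfold ind; split_ifs <;> simp [*]

@[simp] theorem ind_and_ind (p q : Prop) : ind p &&& ind q = ind (p ∧ q) := by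
  unfold ind; by_cases p <;> by_cases q <;> simp [*]

@[simp] theorem ind_or_ind (p q : Prop) : ind p ||| ind q = ind (p ∨ q) := by
  unfold ind; by_cases p <;> by_cases q <;> simp [*]

noncomputable def Op.val : Op → ℕ → ℕ → ℕ
  | .add, x, y => x + y
  | .sub, x, y => x - y
  | .mul, x, y => x * y
  | .div, x, y => x / y
  | .mod, x, y => x % y
  | .and, x, y => x &&& y
  | .or, x, y => x ||| y
  | .xor, x, y => x ^^^ y
  | .shl, x, y => x * 2 ^ y
  | .shr, x, y => x / 2 ^ y
  | .lt, x, y => ind (x < y)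
  | .eq, x, y => ind (x = y)

/-- The operation does not overflow. -/
def Op.ok (w : ℕ) : Op → ℕ → ℕ → Prop
  | .add, x, y => x + y < 2 ^ w
  | .sub, x, y => y ≤ x
  | .mul, x, y => x * y < 2 ^ w
  | .shl, x, y => x * 2 ^ y < 2 ^ w
  | _, _, _ => True

noncomputable def Expr.val (c : Cfg) : Expr → ℕ
  | .const k => k
  | .reg x => c.reg x
  | .op o e e' => o.val (e.val c) (e'.val c)

def Expr.ok (w : ℕ) (c : Cfg) : Expr → Prop
  | .const k => k < 2 ^ w
  | .reg _ => True
  | .op o e e' => e.ok w c ∧ e'.ok w c ∧ o.ok w (e.val c) (e'.val c)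

/-- The number of arrays that programs may use. -/
def arrays : ℕ := 19

def State.cfg {w : ℕ} (s : State w) (t : ℕ) : Cfg :=
  ⟨fun x => (s.reg x).toNat, fun a i => (s.arr a i).toNat, t⟩

theorem State.cfg_setReg {w : ℕ} (s : State w) (x : ℕ) (v : BitVec w) (t k : ℕ) :
    (s.setReg x v).cfg (t + k) = ((s.cfg t).set x v.toNat).tick k := by
  ext y
  · by_cases hy : y = x <;> simp [cfg, setReg, hy]
  · rfl
  · rfl

theorem State.cfg_setArr {w : ℕ} (s : State w) (a i : ℕ) (v : BitVec w) (t k : ℕ) :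
    (s.setArr a i v).cfg (t + k) = ((s.cfg t).put a i v.toNat).tick k := by
  ext b j
  · rfl
  · by_cases hb : b = a
    · subst hb; by_cases hj : j = i <;> simp [cfg, setArr, Function.update_apply, hj]
    · simp [cfg, setArr, Function.update_apply, hb]
  · rfl

/-- Division and remainder by zero follow the same conventions for words and for natural numbers, so
they need no side condition. Comparisons need `0 < w` so that the truth value `1` is not reduced to
`0`. -/
theorem Op.eval_toNat {w : ℕ} (hw : 0 < w) (o : Op) (x y : BitVec w)
    (h : o.ok w x.toNat y.toNat) : (o.eval x y).toNat = o.val x.toNat y.toNat := by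
  have h1 : 1 % 2 ^ w = 1 := Nat.mod_eq_of_lt (Nat.one_lt_two_pow hw.ne')
  cases o <;> simp only [ok, eval, val] at h ⊢
  · rw [BitVec.toNat_add, Nat.mod_eq_of_lt h]
  · exact BitVec.toNat_sub_of_le h
  · rw [BitVec.toNat_mul, Nat.mod_eq_of_lt h]
  · simp
  · simp
  · simp
  · simp
  · simp
  · rw [BitVec.shiftLeft_eq', BitVec.toNat_shiftLeft, Nat.shiftLeft_eq, Nat.mod_eq_of_lt h]
  · rw [BitVec.ushiftRight_eq', BitVec.toNat_ushiftRight, Nat.shiftRight_eq_div_pow]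
  · simp only [BitVec.lt_def, ind]; split_ifs <;> simp [h1]
  · simp only [BitVec.toNat_inj, ind]; split_ifs <;> simp [h1]

theorem Expr.eval_toNat {w : ℕ} (hw : 0 < w) (s : State w) (t : ℕ) (e : Expr)
    (h : e.ok w (s.cfg t)) : (e.eval s).toNat = e.val (s.cfg t) := by
  induction e with
  | const k => simpa [eval, val] using Nat.mod_eq_of_lt h
  | reg x => rfl
  | op o e e' ih ih' =>
    obtain ⟨h1, h2, h3⟩ := h
    have := Op.eval_toNat hw o (e.eval s) (e'.eval s) (by rw [ih h1, ih' h2]; exact h3)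
    rw [ih h1, ih' h2] at this
    exact this

theorem Expr.eval_eq_zero {w : ℕ} (hw : 0 < w) (s : State w) (t : ℕ) (e : Expr)
    (h : e.ok w (s.cfg t)) : e.eval s = 0 ↔ e.val (s.cfg t) = 0 := by
  rw [← Expr.eval_toNat hw s t e h]
  exact BitVec.toNat_inj.symm

/-- One common bound for all arrays suffices: their number is a constant, so the total space is a
constant multiple of `K`. -/
noncomputable def capOf (K : ℕ) : ℕ →₀ ℕ := Finsupp.indicator (Finset.range arrays) fun _ _ => K

theorem capOf_apply (K a : ℕ) (h : a < arrays) : capOf K a = K := by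
  simp [capOf, Finsupp.indicator_apply, h]

theorem capOf_sum (K : ℕ) : (capOf K).sum (fun _ m => m) = arrays * K := by
  rw [Finsupp.sum_of_support_subset (s := Finset.range arrays)]
  · rw [Finset.sum_congr rfl (g := fun _ => K)]
    · simp
    · intro x hx; exact capOf_apply K x (by simpa using hx)
  · exact Finsupp.support_indicator_subset _ _
  · simp

/-- Every state with configuration `c` leads to a configuration in `Q`. -/
def wp (w K : ℕ) (p : Cmd) (Q : Cfg → Prop) (c : Cfg) : Prop :=
  ∀ s : State w, s.cfg c.t = c → ∃ t s', Exec (capOf K) p s t s' ∧ Q (s'.cfg (c.t + t))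

/-- The verification condition of a program; at loops it falls back on `wp`. -/
def vc (w K : ℕ) : Cmd → (Cfg → Prop) → Cfg → Prop
  | .skip, Q, c => Q (c.tick 1)
  | .assign x e, Q, c => e.ok w c ∧ Q ((c.set x (e.val c)).tick (e.cost + 1))
  | .load x a i, Q, c =>
      (i.ok w c ∧ a < arrays ∧ i.val c < K) ∧ Q ((c.set x (c.arr a (i.val c))).tick (i.cost + 1))
  | .store a i e, Q, c =>
      (i.ok w c ∧ e.ok w c ∧ a < arrays ∧ i.val c < K) ∧
        Q ((c.put a (i.val c) (e.val c)).tick (i.cost + e.cost + 1))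
  | .seq p q, Q, c => vc w K p (vc w K q Q) c
  | .cond e p q, Q, c => e.ok w c ∧ (e.val c ≠ 0 → vc w K p Q (c.tick (e.cost + 1))) ∧
      (e.val c = 0 → vc w K q Q (c.tick (e.cost + 1)))
  | .loop e p, Q, c => wp w K (.loop e p) Q c

theorem State.cfg_tick {w : ℕ} (s : State w) (t k : ℕ) : s.cfg (t + k) = (s.cfg t).tick k := rfl

/-- Soundness of the verification conditions, by induction on the program. The side conditions `ok`
make word arithmetic coincide with arithmetic in `ℕ`. -/
theorem vc.wp {w K : ℕ} (hw : 0 < w) {p : Cmd} {Q : Cfg → Prop} {c : Cfg} (h : vc w K p Q c) :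
    wp w K p Q c := by
  induction p generalizing Q c with
  | skip => intro s hs; exact ⟨1, s, .skip s, by rw [State.cfg_tick, hs]; exact h⟩
  | assign x e =>
    intro s hs
    refine ⟨_, _, .assign s x e, ?_⟩
    rw [State.cfg_setReg, Expr.eval_toNat hw s c.t e (by rw [hs]; exact h.1), hs]
    exact h.2
  | load x a i =>
    obtain ⟨⟨h1, h2, h3⟩, h4⟩ := h
    intro s hs
    have hi := Expr.eval_toNat hw s c.t i (by rw [hs]; exact h1)
    rw [hs] at hi
    refine ⟨_, _, .load s x a i (by rw [hi, capOf_apply K a h2]; exact h3), ?_⟩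
    rw [State.cfg_setReg, hi, hs]
    have : (s.arr a (i.val c)).toNat = c.arr a (i.val c) := by rw [← hs]; rfl
    rw [this]; exact h4
  | store a i e =>
    obtain ⟨⟨h1, h1', h2, h3⟩, h4⟩ := h
    intro s hs
    have hi := Expr.eval_toNat hw s c.t i (by rw [hs]; exact h1)
    have he := Expr.eval_toNat hw s c.t e (by rw [hs]; exact h1')
    rw [hs] at hi he
    refine ⟨_, _, .store s a i e (by rw [hi, capOf_apply K a h2]; exact h3), ?_⟩
    rw [State.cfg_setArr, hi, he, hs]
    exact h4
  | seq p q ihp ihq =>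
    intro s hs
    obtain ⟨t, s', h1, h2⟩ := ihp h s hs
    obtain ⟨t', s'', h3, h4⟩ := ihq h2 s' rfl
    exact ⟨_, _, .seq h1 h3, by rw [← add_assoc]; exact h4⟩
  | cond e p q ihp ihq =>
    obtain ⟨h1, h2, h3⟩ := h
    intro s hs
    have he := Expr.eval_eq_zero hw s c.t e (by rw [hs]; exact h1)
    rw [hs] at he
    by_cases h0 : e.val c = 0
    · obtain ⟨t, s', h4, h5⟩ := ihq (h3 h0) s (by rw [Cfg.tick_t, State.cfg_tick, hs])
      exact ⟨_, _, .condFalse (he.2 h0) h4, by rw [← add_assoc]; exact h5⟩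
    · obtain ⟨t, s', h4, h5⟩ := ihp (h2 h0) s (by rw [Cfg.tick_t, State.cfg_tick, hs])
      exact ⟨_, _, .condTrue (fun h => h0 (he.1 h)) h4, by rw [← add_assoc]; exact h5⟩
  | loop e p ih => exact h

/-- The registers that a program writes. -/
def Cmd.regs : Cmd → List ℕ
  | .skip => []
  | .assign x _ => [x]
  | .load x _ _ => [x]
  | .store _ _ _ => []
  | .seq p q => p.regs ++ q.regs
  | .cond _ p q => p.regs ++ q.regs
  | .loop _ p => p.regs

/-- The arrays that a program writes. -/
def Cmd.arrs : Cmd → List ℕ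
  | .skip => []
  | .assign _ _ => []
  | .load _ _ _ => []
  | .store a _ _ => [a]
  | .seq p q => p.arrs ++ q.arrs
  | .cond _ p q => p.arrs ++ q.arrs
  | .loop _ p => p.arrs

/-- Thanks to this syntactic frame property, loop invariants need to mention only what the loop body
changes. -/
theorem Exec.frame {w : ℕ} {cap : ℕ → ℕ} {p : Cmd} {s s' : State w} {t : ℕ}
    (h : Exec cap p s t s') :
    (∀ x, x ∉ p.regs → s'.reg x = s.reg x) ∧ (∀ a, a ∉ p.arrs → s'.arr a = s.arr a) := by
  induction h with
  | skip s => simp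
  | assign s x e =>
    exact ⟨fun y hy => by simp_all [State.setReg, Cmd.regs], fun a _ => rfl⟩
  | load s x a i h =>
    exact ⟨fun y hy => by simp_all [State.setReg, Cmd.regs], fun a _ => rfl⟩
  | store s a i e h =>
    exact ⟨fun y _ => rfl, fun b hb => by simp_all [State.setArr, Cmd.arrs]⟩
  | seq h₁ h₂ ih₁ ih₂ =>
    simp only [Cmd.regs, Cmd.arrs, List.mem_append, not_or]
    exact ⟨fun x hx => (ih₂.1 x hx.2).trans (ih₁.1 x hx.1),
      fun x hx => (ih₂.2 x hx.2).trans (ih₁.2 x hx.1)⟩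
  | condTrue he h ih =>
    simp only [Cmd.regs, Cmd.arrs, List.mem_append, not_or]
    exact ⟨fun x hx => ih.1 x hx.1, fun x hx => ih.2 x hx.1⟩
  | condFalse he h ih =>
    simp only [Cmd.regs, Cmd.arrs, List.mem_append, not_or]
    exact ⟨fun x hx => ih.1 x hx.2, fun x hx => ih.2 x hx.2⟩
  | loopTrue he h₁ h₂ ih₁ ih₂ =>
    exact ⟨fun x hx => (ih₂.1 x hx).trans (ih₁.1 x hx),
      fun x hx => (ih₂.2 x hx).trans (ih₁.2 x hx)⟩
  | loopFalse he => simp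

/-- `c'` differs from `c` only in the registers and arrays that `p` writes (and in the clock). -/
def Frame (p : Cmd) (c c' : Cfg) : Prop :=
  (∀ x, x ∉ p.regs → c'.reg x = c.reg x) ∧ (∀ a, a ∉ p.arrs → c'.arr a = c.arr a)

theorem Frame.trans {p : Cmd} {c c' c'' : Cfg} (h : Frame p c c') (h' : Frame p c' c'') :
    Frame p c c'' :=
  ⟨fun x hx => (h'.1 x hx).trans (h.1 x hx), fun x hx => (h'.2 x hx).trans (h.2 x hx)⟩

theorem wp.frame {w K : ℕ} {p : Cmd} {Q : Cfg → Prop} {c : Cfg} (h : wp w K p Q c) :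
    wp w K p (fun c' => Q c' ∧ Frame p c c') c := by
  intro s hs
  obtain ⟨t, s', h1, h2⟩ := h s hs
  refine ⟨t, s', h1, h2, fun x hx => ?_, fun a ha => ?_⟩
  · rw [← hs]; simp [State.cfg, h1.frame.1 x hx]
  · rw [← hs]; simp [State.cfg, h1.frame.2 a ha]

/-- The rule for loops, with an invariant and a variant. -/
theorem wp_loop {w K : ℕ} (hw : 0 < w) {e : Expr} {p : Cmd} {Q : Cfg → Prop} {c : Cfg}
    (I : Cfg → Prop) (μ : Cfg → ℕ) (hI : I c)
    (h : ∀ c', I c' → Frame p c c' → e.ok w c' ∧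
      (e.val c' ≠ 0 → vc w K p (fun c'' => I c'' ∧ μ c'' < μ c') (c'.tick (e.cost + 1))) ∧
      (e.val c' = 0 → Q (c'.tick (e.cost + 1)))) : wp w K (.loop e p) Q c := by
  -- Induction on a bound for the variant, with the frame always taken relative to the configuration
  -- at loop entry.
  suffices H : ∀ k c', μ c' < k → I c' → Frame p c c' → wp w K (.loop e p) Q c' from
    H _ c (Nat.lt_succ_self _) hI ⟨fun _ _ => rfl, fun _ _ => rfl⟩
  intro k
  induction k with
  | zero => intro c' hc'; omega
  | succ k ih =>
    intro c' hk hI' hF s hs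
    obtain ⟨h1, h2, h3⟩ := h c' hI' hF
    have he := Expr.eval_eq_zero hw s c'.t e (by rw [hs]; exact h1)
    rw [hs] at he
    by_cases h0 : e.val c' = 0
    · exact ⟨_, _, .loopFalse (he.2 h0), by rw [State.cfg_tick, hs]; exact h3 h0⟩
    · obtain ⟨t, s', h4, ⟨h5, h5'⟩, h6⟩ := ((h2 h0).wp hw).frame s
        (by rw [Cfg.tick_t, State.cfg_tick, hs])
      obtain ⟨t', s'', h7, h8⟩ := ih _ (by omega) h5
        (hF.trans ⟨fun x hx => h6.1 x hx, fun x hx => h6.2 x hx⟩) s' rfl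
      refine ⟨_, _, .loopTrue (fun h => h0 (he.1 h)) h4 h7, ?_⟩
      simpa [State.cfg, add_assoc] using h8

infixr:30 " ;; " => Cmd.seq

end WordRAM

/-! ### Notation for programs; binary search. -/

namespace WordRAM

abbrev rg (x : ℕ) : Expr := .reg x
abbrev ct (k : ℕ) : Expr := .const k

infixl:65 " +ₑ " => Expr.op Op.add
infixl:65 " -ₑ " => Expr.op Op.sub
infixl:70 " *ₑ " => Expr.op Op.mul
infixl:70 " /ₑ " => Expr.op Op.div
infixl:70 " %ₑ " => Expr.op Op.mod
infix:50 " <ₑ " => Expr.op Op.lt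
infix:50 " =ₑ " => Expr.op Op.eq
infixl:40 " &ₑ " => Expr.op Op.and
infixl:35 " |ₑ " => Expr.op Op.or
infix:32 " ≔ " => Cmd.assign

attribute [simp] vc Op.val Op.ok Expr.val Expr.ok Expr.cost Cmd.regs Cmd.arrs arrays

/-- Register `2` gets the number of bits of register `0`. -/
def bitLength : Cmd :=
  10 ≔ rg 0 ;; 2 ≔ ct 0 ;;
  .loop (rg 10) (10 ≔ rg 10 /ₑ ct 2 ;; 2 ≔ rg 2 +ₑ ct 1)

/-- Binary search: register `20` gets the last index `k < m` at which the array `a` has an entry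
`≤ x`, where `m` is in register `z` and `x` in register `24`. -/
def search (a z : ℕ) : Cmd :=
  21 ≔ rg z ;; 20 ≔ ct 0 ;;
  .loop (ct 1 <ₑ (rg 21 -ₑ rg 20))
    (22 ≔ rg 20 +ₑ (rg 21 -ₑ rg 20) /ₑ ct 2 ;;
    .load 23 a (rg 22) ;;
    .cond (rg 24 <ₑ rg 23) (21 ≔ rg 22) (20 ≔ rg 22))

/-- The words are long enough for the numbers up to `n`, and the arrays for the indices up to `K`. -/
structure Fits (w K n L : ℕ) : Prop where
  two_le : 2 ≤ n
  lt : n < 2 ^ w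
  lt_two_pow : n < 2 ^ L
  two_pow_le : 2 ^ L ≤ 2 * n

namespace Fits
variable {w K n L : ℕ} (h : Fits w K n L)
include h
theorem two_le_w : 2 ≤ w := by
  by_contra hw
  have : 2 ^ w ≤ 2 ^ 1 := Nat.pow_le_pow_right (by omega) (by omega)
  have := h.lt; have := h.two_le; omega
theorem w_pos : 0 < w := by have := h.two_le_w; omega
end Fits

/-- The postcondition is required for arbitrary scratch values `v₁`, `v₂`, `v₃`, so callers depend
only on the index found. Sortedness is not assumed: bracketing alone yields an index where the
entries cross the searched value. -/
theorem search_spec {w K n L : ℕ} (hf : Fits w K n L) {a z m : ℕ} {c : Cfg} {Q : Cfg → Prop}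
    (ha : a < 19) (hz : c.reg z = m) (hm : 0 < m) (hmn : m ≤ n) (hmK : m ≤ K)
    (h0 : c.arr a 0 ≤ c.reg 24)
    (hQ : ∀ k v₁ v₂ v₃ t, k < m → c.arr a k ≤ c.reg 24 → (k + 1 < m → c.reg 24 < c.arr a (k + 1)) →
      c.t ≤ t → t ≤ c.t + 30 * L + 20 →
      Q ⟨fun x => if x = 20 then k else if x = 21 then v₁ else if x = 22 then v₂ else
        if x = 23 then v₃ else c.reg x, c.arr, t⟩) :
    vc w K (search a z) Q c := by
  have h2 := hf.lt
  have h3 := hf.two_le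
  simp only [search, vc]
  simp
  -- The number `g` bounds the halvings still to come; each is paid for with 30 steps.
  refine wp_loop hf.w_pos (fun c' => c'.reg 20 < c'.reg 21 ∧ c'.reg 21 ≤ m ∧
    c.arr a (c'.reg 20) ≤ c.reg 24 ∧ (c'.reg 21 < m → c.reg 24 < c.arr a (c'.reg 21)) ∧ c.t ≤ c'.t ∧
    ∃ g ≤ L, c'.reg 21 - c'.reg 20 ≤ 2 ^ g ∧ c'.t + 30 * g ≤ c.t + 30 * L + 8)
    (fun c' => c'.reg 21 - c'.reg 20) ?_ ?_
  · simp [hz, hm, h0]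
    exact ⟨by omega, L, le_rfl, by have := hf.lt_two_pow; omega, by omega⟩
  · rintro c' ⟨i1, i2, i3, i4, i5, g, hg, i6, i7⟩ hF
    obtain ⟨hr, har⟩ := hF
    simp at hr har
    simp
    have h4 := hf.two_le_w
    refine ⟨by omega, fun hlt => ?_, fun hle => ?_⟩
    · cases g with
      | zero => omega
      | succ g =>
      rw [pow_succ] at i6
      refine ⟨⟨by omega, by omega⟩, ⟨ha, by omega⟩, ?_, ?_⟩
      · intro hx
        simp [har, hr] at hx
        refine ⟨⟨by omega, by omega, i3, fun _ => hx, by omega, g, by omega, by omega, by omega⟩, by omega⟩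
      · intro hx
        simp [har, hr] at hx
        refine ⟨⟨by omega, by omega, hx, i4, by omega, g, by omega, by omega, by omega⟩, by omega⟩
    · have e : c'.tick 6 = ⟨fun x => if x = 20 then c'.reg 20 else if x = 21 then c'.reg 21 else
          if x = 22 then c'.reg 22 else if x = 23 then c'.reg 23 else c.reg x, c.arr, c'.t + 6⟩ := by
        ext x
        · simp only [Cfg.tick_reg]; split_ifs with a1 a2 a3 a4
          · rw [a1]
          · rw [a2]
          · rw [a3]
          · rw [a4]
          · simp [hr, a1, a2, a3, a4]
        · simp [har]
        · rfl
      rw [e]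
      refine hQ _ _ _ _ _ (by omega) i3 (fun h => ?_) (by omega) (by omega)
      have : c'.reg 20 + 1 = c'.reg 21 := by omega
      rw [this] at h ⊢; exact i4 h

end WordRAM

/-! ### Row systems: pieces of iterates of `psi`, and the behaviour of LCP values. -/

namespace RunLengthBWT

/-- The rows `0, …, n - 1` of the sorted rotations of a text, described by the first symbol `F x` of
the row `x` and the row `psi x` of the rotation by one more symbol; the `r` runs of the last column
start at the rows `lam k` and consist of the symbols `sym k`; `ell x` is the length of the longest
common prefix of the rows `x - 1` and `x`. -/
structure RowSystem (n r : ℕ) (F psi lam sym ell : ℕ → ℕ) : Prop where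
  n_pos : 0 < n
  psi_lt : ∀ x < n, psi x < n
  psi_inj : ∀ x < n, ∀ y < n, psi x = psi y → x = y
  orbit : ∀ x < n, ∃ t < n, psi^[t] 0 = x
  cycle : psi^[n] 0 = 0
  sorted : ∀ x y, x < y → y < n → F x < F y ∨ F x = F y ∧ psi x < psi y
  F_zero : F 0 = 0
  F_pos : ∀ x, 0 < x → x < n → 0 < F x
  F_le : ∀ x < n, F x ≤ n
  lam_zero : lam 0 = 0
  lam_last : lam r = n
  lam_lt : ∀ k < r, lam k < lam (k + 1)
  F_run : ∀ k < r, ∀ x < n, lam k ≤ psi x → psi x < lam (k + 1) → F x = sym k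
  ell_zero : ell 0 = 0
  ell_eq : ∀ x, 0 < x → x < n → ∀ u < ell x, F (psi^[u] (x - 1)) = F (psi^[u] x)
  ell_ne : ∀ x, 0 < x → x < n → F (psi^[ell x] (x - 1)) ≠ F (psi^[ell x] x)

/-- The rows `x` and `y` agree in the first `a` symbols. -/
def Agree (F psi : ℕ → ℕ) (a x y : ℕ) : Prop := ∀ u < a, F (psi^[u] x) = F (psi^[u] y)

/-- A run starts at the row `psi x`. -/
def Start (r : ℕ) (psi lam : ℕ → ℕ) (x : ℕ) : Prop := ∃ k < r, psi x = lam k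

/-- `x` is the first row of a maximal interval on which the first `a` iterates of `psi` are
translations within runs. -/
def Break (r : ℕ) (psi lam : ℕ → ℕ) (a x : ℕ) : Prop := ∃ u < a, Start r psi lam (psi^[u] x)

theorem Agree.symm {F psi : ℕ → ℕ} {a x y : ℕ} (h : Agree F psi a x y) : Agree F psi a y x :=
  fun u hu => (h u hu).symm

theorem Agree.trans {F psi : ℕ → ℕ} {a x y z : ℕ} (h : Agree F psi a x y)
    (h' : Agree F psi a y z) : Agree F psi a x z :=
  fun u hu => (h u hu).trans (h' u hu)

theorem agree_add {F psi : ℕ → ℕ} {a b x y : ℕ} :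
    Agree F psi (a + b) x y ↔ Agree F psi a x y ∧ Agree F psi b (psi^[a] x) (psi^[a] y) := by
  constructor
  · refine fun h => ⟨fun u hu => h u (by omega), fun u hu => ?_⟩
    rw [← Function.iterate_add_apply, ← Function.iterate_add_apply]
    exact h _ (by omega)
  · rintro ⟨h1, h2⟩ u hu
    rcases lt_or_ge u a with h | h
    · exact h1 u h
    · have := h2 (u - a) (by omega)
      rw [← Function.iterate_add_apply, ← Function.iterate_add_apply] at this
      rwa [show u - a + a = u by omega] at this

theorem break_add {r : ℕ} {psi lam : ℕ → ℕ} {a b x : ℕ} :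
    Break r psi lam (a + b) x ↔ Break r psi lam a x ∨ Break r psi lam b (psi^[a] x) := by
  constructor
  · rintro ⟨u, hu, h⟩
    rcases lt_or_ge u a with h' | h'
    · exact .inl ⟨u, h', h⟩
    · refine .inr ⟨u - a, by omega, ?_⟩
      rwa [← Function.iterate_add_apply, show u - a + a = u by omega]
  · rintro (⟨u, hu, h⟩ | ⟨u, hu, h⟩)
    · exact ⟨u, by omega, h⟩
    · rw [← Function.iterate_add_apply] at h
      exact ⟨u + a, by omega, h⟩

namespace RowSystem

variable {n r : ℕ} {F psi lam sym ell : ℕ → ℕ} (h : RowSystem n r F psi lam sym ell)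
include h

theorem iter_lt (a : ℕ) : ∀ x < n, psi^[a] x < n := by
  induction a with
  | zero => simp
  | succ a ih => intro x hx; rw [Function.iterate_succ_apply]; exact ih _ (h.psi_lt x hx)

theorem iter_inj (a : ℕ) : ∀ x < n, ∀ y < n, psi^[a] x = psi^[a] y → x = y := by
  induction a with
  | zero => simp
  | succ a ih =>
    intro x hx y hy hxy
    rw [Function.iterate_succ_apply, Function.iterate_succ_apply] at hxy
    exact h.psi_inj x hx y hy (ih _ (h.psi_lt x hx) _ (h.psi_lt y hy) hxy)

theorem psi_surj {y : ℕ} (hy : y < n) : ∃ x < n, psi x = y := by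
  obtain ⟨t, ht, rfl⟩ := h.orbit y hy
  cases t with
  | zero =>
    obtain ⟨m, rfl⟩ : ∃ m, n = m + 1 := ⟨n - 1, by omega⟩
    exact ⟨psi^[m] 0, h.iter_lt m 0 h.n_pos, by
      rw [← Function.iterate_succ_apply' psi]; simpa using h.cycle⟩
  | succ t => exact ⟨psi^[t] 0, h.iter_lt t 0 h.n_pos, (Function.iterate_succ_apply' ..).symm⟩

/-- By `orbit`, the map from times below `n` to rows is surjective between finite sets of equal
size, hence injective. -/
theorem row_inj {t u : ℕ} (ht : t < n) (hu : u < n) (he : psi^[t] 0 = psi^[u] 0) : t = u := by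
  have hs : Function.Surjective
      (fun t : Fin n => (⟨psi^[t] 0, h.iter_lt t 0 h.n_pos⟩ : Fin n)) := by
    rintro ⟨x, hx⟩
    obtain ⟨t, ht, rfl⟩ := h.orbit x hx
    exact ⟨⟨t, ht⟩, rfl⟩
  have := Finite.injective_iff_surjective.2 hs (a₁ := ⟨t, ht⟩) (a₂ := ⟨u, hu⟩) (by simpa using he)
  simpa using this

theorem lam_mono {k l : ℕ} (hkl : k ≤ l) (hl : l ≤ r) : lam k ≤ lam l := by
  induction l, hkl using Nat.le_induction with
  | base => rfl
  | succ l hkl ih => exact (ih (by omega)).trans (h.lam_lt l (by omega)).le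

theorem lam_strict {k l : ℕ} (hkl : k < l) (hl : l ≤ r) : lam k < lam l :=
  (h.lam_lt k (by omega)).trans_le (h.lam_mono hkl hl)

theorem r_pos : 0 < r := by
  rcases Nat.eq_zero_or_pos r with h0 | h0
  · have := h.lam_zero; have := h.lam_last; have := h.n_pos; subst h0; omega
  · exact h0

theorem le_lam {k : ℕ} (hk : k ≤ r) : k ≤ lam k := by
  induction k with
  | zero => omega
  | succ k ih => have := ih (by omega); have := h.lam_lt k (by omega); omega

theorem r_le : r ≤ n := h.lam_last ▸ h.le_lam le_rfl

theorem exists_run {y : ℕ} (hy : y < n) : ∃ k < r, lam k ≤ y ∧ y < lam (k + 1) := by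
  have : ∀ m ≤ r, y < lam m → ∃ k < m, lam k ≤ y ∧ y < lam (k + 1) := by
    intro m
    induction m with
    | zero => intro _ h0; have := h.lam_zero; omega
    | succ m ih =>
      intro hm h1
      rcases lt_or_ge y (lam m) with h2 | h2
      · obtain ⟨k, hk, h3⟩ := ih (by omega) h2
        exact ⟨k, by omega, h3⟩
      · exact ⟨m, by omega, h2, h1⟩
  exact this r le_rfl (by rw [h.lam_last]; exact hy)

theorem F_mono {x y : ℕ} (hxy : x ≤ y) (hy : y < n) : F x ≤ F y := by
  rcases hxy.lt_or_eq with h' | rfl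
  · rcases h.sorted x y h' hy with h1 | h1
    · exact h1.le
    · exact h1.1.le
  · rfl

theorem psi_mono {x y : ℕ} (hxy : x ≤ y) (hy : y < n) (e : F x = F y) : psi x ≤ psi y := by
  rcases hxy.lt_or_eq with h' | rfl
  · rcases h.sorted x y h' hy with h1 | h1
    · omega
    · exact h1.2.le
  · rfl

/-- The sentinel occurs only once in the last column, so the row `psi 0` cannot continue the run of
the row above it. -/
theorem start_zero : Start r psi lam 0 := by
  by_contra hs
  obtain ⟨k, hk, h1, h2⟩ := h.exists_run (h.psi_lt 0 h.n_pos)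
  have h3 : lam k < psi 0 := lt_of_le_of_ne h1 fun e => hs ⟨k, hk, e.symm⟩
  have h4 := h.psi_lt 0 h.n_pos
  obtain ⟨x, hx, h5⟩ := h.psi_surj (y := psi 0 - 1) (by omega)
  have h6 := h.F_run k hk 0 h.n_pos h1 h2
  have h7 := h.F_run k hk x hx (by omega) (by omega)
  rcases Nat.eq_zero_or_pos x with rfl | h0
  · omega
  · have := h.F_pos x h0 hx; have := h.F_zero; omega

/-- The row above `psi (x + 1)` lies in the same run, so its preimage `z` has the same first symbol.
Among rows with equal first symbols `psi` is strictly increasing, and no value fits between `psi z`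
and `psi (x + 1)`; hence `z = x`. -/
theorem not_start_succ {x : ℕ} (hx : x + 1 < n) (hs : ¬ Start r psi lam (x + 1)) :
    psi (x + 1) = psi x + 1 ∧ F (x + 1) = F x := by
  obtain ⟨k, hk, h1, h2⟩ := h.exists_run (h.psi_lt _ hx)
  have h3 : lam k < psi (x + 1) := lt_of_le_of_ne h1 fun e => hs ⟨k, hk, e.symm⟩
  have h4 := h.psi_lt _ hx
  obtain ⟨z, hz, h5⟩ := h.psi_surj (y := psi (x + 1) - 1) (by omega)
  have h6 := h.F_run k hk _ hx h1 h2
  have h7 := h.F_run k hk z hz (by omega) (by omega)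
  have h8 : z < x + 1 := by
    by_contra h8
    have := h.psi_mono (not_lt.1 h8) hz (by omega)
    omega
  rcases (Nat.lt_succ_iff.1 h8).lt_or_eq with h9 | rfl
  · have h10 := h.F_mono h9.le (by omega)
    have h11 := h.F_mono (Nat.le_succ x) hx
    simp only [Nat.succ_eq_add_one] at h11
    have h12 := (h.sorted z x h9 (by omega)).resolve_left (by omega)
    have h13 := (h.sorted x (x + 1) (by omega) hx).resolve_left (by omega)
    omega
  · exact ⟨by omega, by omega⟩

theorem not_break_succ {a x : ℕ} (hx : x + 1 < n) (hs : ¬ Break r psi lam a (x + 1)) :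
    psi^[a] (x + 1) = psi^[a] x + 1 ∧ Agree F psi a x (x + 1) := by
  induction a with
  | zero => exact ⟨rfl, fun u hu => absurd hu (Nat.not_lt_zero u)⟩
  | succ a ih =>
    rw [break_add, not_or] at hs
    obtain ⟨h1, h2⟩ := ih hs.1
    have h3 : ¬ Start r psi lam (psi^[a] x + 1) := fun h' =>
      hs.2 ⟨0, by omega, by rw [Function.iterate_zero_apply, h1]; exact h'⟩
    have h4 := h.not_start_succ (by rw [← h1]; exact h.iter_lt a _ hx) h3
    rw [Function.iterate_succ_apply', Function.iterate_succ_apply', h1]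
    refine ⟨h4.1, agree_add.2 ⟨h2, fun u hu => ?_⟩⟩
    obtain rfl : u = 0 := by omega
    simp only [Function.iterate_zero_apply, h1]
    exact h4.2.symm

/-- This is why a piece can be stored by its first row and the image of that row. -/
theorem translate {a b x : ℕ} (hbx : b ≤ x) (hx : x < n)
    (hs : ∀ y, b < y → y ≤ x → ¬ Break r psi lam a y) :
    psi^[a] x = psi^[a] b + (x - b) ∧ Agree F psi a b x := by
  induction x, hbx using Nat.le_induction with
  | base => exact ⟨by simp, fun u _ => rfl⟩
  | succ x hbx ih =>
    obtain ⟨h1, h2⟩ := ih (by omega) fun y hy hyx => hs y hy (by omega)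
    obtain ⟨h3, h4⟩ := h.not_break_succ hx (hs (x + 1) (by omega) le_rfl)
    exact ⟨by omega, h2.trans h4⟩

/-- In lexicographic order the rows with a given prefix form an interval. The induction peels off
one symbol, using that `F` is monotone and that `psi` is monotone where `F` is constant. -/
theorem agree_between {a x y z : ℕ} (hxy : x ≤ y) (hyz : y ≤ z) (hz : z < n)
    (ha : Agree F psi a x z) : Agree F psi a x y := by
  induction a generalizing x y z with
  | zero => exact fun u hu => absurd hu (Nat.not_lt_zero u)
  | succ a ih =>
    rw [add_comm a 1, agree_add] at ha ⊢
    have h1 : F x = F z := ha.1 0 (by omega)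
    have h2 := h.F_mono hxy (by omega)
    have h3 := h.F_mono hyz hz
    refine ⟨fun u hu => ?_, ih (h.psi_mono hxy (by omega) (by omega))
      (h.psi_mono hyz hz (by omega)) (h.psi_lt z hz) ha.2⟩
    obtain rfl : u = 0 := by omega
    simp only [Function.iterate_zero_apply]
    omega

/-- A break is determined by the number of steps after which it meets a run start and by that run,
because iterates of `psi` are injective. There are only `a * r` such pairs. -/
theorem le_of_break {a m : ℕ} {B : ℕ → ℕ} (hB : ∀ k < m, B k < n ∧ Break r psi lam a (B k))
    (hinj : ∀ k < m, ∀ l < m, B k = B l → k = l) : m ≤ a * r := by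
  classical
  have h1 : ∀ k : Fin m, ∃ p : Fin a × Fin r, psi (psi^[p.1] (B k)) = lam p.2 := by
    rintro ⟨k, hk⟩
    obtain ⟨-, u, hu, l, hl, h2⟩ := hB k hk
    exact ⟨(⟨u, hu⟩, ⟨l, hl⟩), h2⟩
  choose f hf using h1
  have h2 : Function.Injective f := by
    intro k l hkl
    have h3 := hf k
    rw [hkl, ← hf l, ← Function.iterate_succ_apply' psi, ← Function.iterate_succ_apply' psi] at h3
    exact Fin.ext (hinj k k.2 l l.2 (h.iter_inj _ _ (hB k k.2).1 _ (hB l l.2).1 h3))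
  simpa using Fintype.card_le_of_injective f h2

/-- A longer common prefix would include the sentinel at position `n`. Only row `0` begins with it,
so both rows would reach row `0` after the same number of steps and hence be equal. -/
theorem ell_le {j : ℕ} (hjn : j ≤ n) : j + ell (psi^[j] 0) ≤ n := by
  by_contra hc
  set x := psi^[j] 0 with hx
  have hxn : x < n := h.iter_lt j 0 h.n_pos
  have h0 : 0 < x := by
    by_contra h0
    rw [show x = 0 by omega, h.ell_zero] at hc
    omega
  have h1 := h.ell_eq x h0 hxn (n - j) (by omega)
  have h2 : psi^[n - j] x = 0 := by
    rw [hx, ← Function.iterate_add_apply, show n - j + j = n by omega, h.cycle]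
  rw [h2, h.F_zero] at h1
  have h3 : psi^[n - j] (x - 1) = 0 := by
    by_contra h3
    have := h.F_pos _ (by omega) (h.iter_lt (n - j) (x - 1) (by omega))
    omega
  have := h.iter_inj (n - j) _ (by omega) _ hxn (h3.trans h2.symm)
  omega

/-- The same bound for the row before. -/
theorem ell_le' {j i : ℕ} (hi : i ≤ n) (h0 : 0 < psi^[j] 0)
    (e : psi^[i] 0 = psi^[j] 0 - 1) : i + ell (psi^[j] 0) ≤ n := by
  by_contra hc
  set x := psi^[j] 0 with hx
  have hxn : x < n := h.iter_lt j 0 h.n_pos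
  have h1 := h.ell_eq x h0 hxn (n - i) (by omega)
  have h2 : psi^[n - i] (x - 1) = 0 := by
    rw [← e, ← Function.iterate_add_apply, show n - i + i = n by omega, h.cycle]
  rw [h2, h.F_zero] at h1
  have h3 : psi^[n - i] x = 0 := by
    by_contra h3
    have := h.F_pos _ (by omega) (h.iter_lt (n - i) x (by omega))
    omega
  have := h.iter_inj (n - i) _ (by omega) _ hxn (h2.trans h3.symm)
  omega

theorem le_ell {x l : ℕ} (h0 : 0 < x) (hx : x < n) (ha : Agree F psi l (x - 1) x) : l ≤ ell x := by
  by_contra hl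
  exact h.ell_ne x h0 hx (ha _ (by omega))

theorem ell_unique {x l : ℕ} (h0 : 0 < x) (hx : x < n) (ha : Agree F psi l (x - 1) x)
    (hn : F (psi^[l] (x - 1)) ≠ F (psi^[l] x)) : l = ell x := by
  refine le_antisymm (h.le_ell h0 hx ha) ?_
  by_contra hl
  exact hn (h.ell_eq x h0 hx l (by omega))

/-- Deleting the common first symbol of the rows `x - 1` and `x` leaves two rows in the same order
that agree in `ell x - 1` symbols. The row just above `psi x` lies between them, so it agrees at
least as far. -/
theorem ell_psi_ge {x : ℕ} (hx : x < n) : ell x ≤ ell (psi x) + 1 := by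
  rcases Nat.eq_zero_or_pos (ell x) with h1 | h1
  · omega
  have h0 : 0 < x := by
    by_contra h0
    rw [show x = 0 by omega, h.ell_zero] at h1
    omega
  have h2 := h.ell_eq x h0 hx
  have h3 : F (x - 1) = F x := h2 0 h1
  have h4 := (h.sorted (x - 1) x (by omega) hx).resolve_left (by omega)
  have h5 : Agree F psi (ell x - 1) (psi (x - 1)) (psi x) := by
    intro u hu
    rw [← Function.iterate_succ_apply, ← Function.iterate_succ_apply]
    exact h2 _ (by omega)
  have h6 := h.agree_between (y := psi x - 1) (by omega) (by omega) (h.psi_lt x hx) h5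
  have := h.le_ell (by omega) (h.psi_lt x hx) (h6.symm.trans h5)
  omega

/-- Away from run starts the rows `x - 1` and `x` are mapped to adjacent rows, so exactly one common
symbol is lost. This is reducibility of the value at `psi x`. -/
theorem ell_psi_eq {x : ℕ} (hx : x < n) (hs : ¬ Start r psi lam x) : ell x = ell (psi x) + 1 := by
  have h0 : 0 < x := by
    by_contra h0
    exact hs (by rw [show x = 0 by omega]; exact h.start_zero)
  obtain ⟨x, rfl⟩ : ∃ y, x = y + 1 := ⟨x - 1, by omega⟩
  obtain ⟨h1, h2⟩ := h.not_start_succ hx hs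
  symm
  have h3 := h.psi_lt _ hx
  have h4 := h.ell_eq (psi (x + 1)) (by omega) h3
  have h5 := h.ell_ne (psi (x + 1)) (by omega) h3
  rw [h1, Nat.add_sub_cancel] at h4 h5
  refine h.ell_unique h0 hx ?_ ?_
  · intro u hu
    cases u with
    | zero => exact h2.symm
    | succ u =>
      simp only [Nat.add_sub_cancel, Function.iterate_succ_apply, h1] at hu ⊢
      exact h4 u (by omega)
  · simp only [Nat.add_sub_cancel, Function.iterate_succ_apply, h1]
    exact h5

theorem ell_row_ge (j g : ℕ) : ell (psi^[j] 0) ≤ ell (psi^[j + g] 0) + g := by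
  induction g with
  | zero => rfl
  | succ g ih =>
    have := h.ell_psi_ge (h.iter_lt (j + g) 0 h.n_pos)
    rw [← Function.iterate_succ_apply' psi] at this
    simp only [Nat.succ_eq_add_one] at this
    rw [← add_assoc j g 1]
    omega

theorem ell_row_eq (j g : ℕ)
    (hg : ∀ i, j ≤ i → i < j + g → ¬ Start r psi lam (psi^[i] 0)) :
    ell (psi^[j] 0) = ell (psi^[j + g] 0) + g := by
  induction g with
  | zero => rfl
  | succ g ih =>
    have := h.ell_psi_eq (h.iter_lt (j + g) 0 h.n_pos) (hg _ (by omega) (by omega))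
    rw [← Function.iterate_succ_apply' psi] at this
    have h2 := ih fun i hi hi' => hg i hi (by omega)
    simp only [Nat.succ_eq_add_one] at this
    rw [← add_assoc j g 1]
    omega

/-- The runs sorted by their symbols list the values of `psi`. -/
theorem psi_of_sorted {P b : ℕ → ℕ} (hP : ∀ k < r, P k < r) (hPs : ∀ j < r, ∃ k < r, P k = j)
    (hPl : ∀ k l, k < l → l < r → sym (P k) < sym (P l) ∨ sym (P k) = sym (P l) ∧ P k < P l)
    (hb0 : b 0 = 0) (hb : ∀ k < r, b (k + 1) = b k + (lam (P k + 1) - lam (P k))) :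
    b r = n ∧ ∀ k < r, ∀ d, d < lam (P k + 1) - lam (P k) →
      b k + d < n ∧ psi (b k + d) = lam (P k) + d := by
  have hbm : ∀ l ≤ r, ∀ k ≤ l, b k ≤ b l := by
    intro l hl k hk
    induction l, hk using Nat.le_induction with
    | base => rfl
    | succ l hkl ih => have := ih (by omega); have := hb l (by omega); omega
  have hlt : ∀ k < r, ∀ d, d < lam (P k + 1) - lam (P k) → lam (P k) + d < n := by
    intro k hk d hd
    have := h.lam_mono (show P k + 1 ≤ r from hP k hk) le_rfl
    have := h.lam_last
    omega
  have hF : ∀ k < r, ∀ d, d < lam (P k + 1) - lam (P k) → ∀ x < n, psi x = lam (P k) + d →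
      F x = sym (P k) := fun k hk d hd x hx hx' =>
    h.F_run _ (hP k hk) x hx (by omega) (by omega)
  have hcover : ∀ y < n, ∃ k < r, ∃ d, d < lam (P k + 1) - lam (P k) ∧ y = lam (P k) + d := by
    intro y hy
    obtain ⟨j, hj, h1, h2⟩ := h.exists_run hy
    obtain ⟨k, hk, rfl⟩ := hPs j hj
    exact ⟨k, hk, y - lam (P k), by omega, by omega⟩
  -- Strong induction on the place `p` in the concatenation of the sorted runs; the preimage `x` of
  -- the row listed there turns out to be `p`.
  have key : ∀ p, ∀ k < r, ∀ d, d < lam (P k + 1) - lam (P k) → b k + d = p →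
      p < n ∧ psi p = lam (P k) + d := by
    intro p
    induction p using Nat.strong_induction_on with
    | _ p ih =>
    intro k hk d hd hp
    obtain ⟨x, hx, hxe⟩ := h.psi_surj (hlt k hk d hd)
    have hpos : ∀ k' < r, ∀ d', d' < lam (P k' + 1) - lam (P k') → b k' + d' < p →
        k' < k ∨ k' = k ∧ d' < d := by
      intro k' hk' d' hd' hlt'
      rcases lt_trichotomy k' k with h1 | rfl | h1
      · exact .inl h1
      · exact .inr ⟨rfl, by omega⟩
      · have := hbm k' (by omega) (k + 1) (by omega); have := hb k hk; omega
    have h1 : p ≤ x := by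
      by_contra h1
      -- every earlier position is one of the pieces listed so far
      have h2 : ∃ k' < r, ∃ d', d' < lam (P k' + 1) - lam (P k') ∧ b k' + d' = x := by
        have : ∀ m ≤ r, x < b m → ∃ k' < m, b k' ≤ x ∧ x < b (k' + 1) := by
          intro m
          induction m with
          | zero => omega
          | succ m ihm =>
            intro hm h3
            rcases lt_or_ge x (b m) with h4 | h4
            · obtain ⟨k', hk', h5⟩ := ihm (by omega) h4
              exact ⟨k', by omega, h5⟩
            · exact ⟨m, by omega, h4, h3⟩
        obtain ⟨k', hk', h3, h4⟩ := this (k + 1) hk (by have := hb k hk; omega)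
        have := hb k' (by omega)
        exact ⟨k', by omega, x - b k', by omega, by omega⟩
      obtain ⟨k', hk', d', hd', h3⟩ := h2
      have h4 := (ih x (by omega) k' hk' d' hd' h3).2
      have h5 := h.lam_mono (show P k + 1 ≤ r from hP k hk) le_rfl
      rcases hpos k' hk' d' hd' (by omega) with h6 | ⟨rfl, h6⟩
      · rcases lt_trichotomy (P k') (P k) with h7 | h7 | h7
        · have := h.lam_mono (show P k' + 1 ≤ P k from h7) (hP k hk).le; omega
        · have := hPl k' k h6 hk; rw [h7] at this; omega
        · have := h.lam_mono (show P k + 1 ≤ P k' from h7) (hP k' hk').le; omega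
      · omega
    rcases h1.lt_or_eq with h2 | rfl
    -- If `p < x`, then `psi p` is listed before `psi x`, because row `p` precedes row `x` in the
    -- sorted order. The induction hypothesis then gives `psi p` a second preimage, smaller than
    -- `p`.
    · exfalso
      have hpn : p < n := by omega
      obtain ⟨k', hk', d', hd', h3⟩ := hcover (psi p) (h.psi_lt p hpn)
      have h4 := hF k hk d hd x hx hxe
      have h5 := hF k' hk' d' hd' p hpn h3
      have h6 : b k' + d' < p := by
        rcases lt_trichotomy k' k with h1 | rfl | h1
        · have := hbm k (by omega) (k' + 1) (by omega); have := hb k' hk'; omega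
        · rcases h.sorted p x h2 hx with h6 | h6 <;> omega
        · have h7 := hPl k k' h1 hk'
          rcases h.sorted p x h2 hx with h6 | h6
          · omega
          · have h8 := h.lam_mono (show P k + 1 ≤ P k' by omega) (hP k' hk').le; omega
      have h7 := (ih _ h6 k' hk' d' hd' rfl).2
      have := h.psi_inj p hpn (b k' + d') (by omega) (by omega)
      omega
    · exact ⟨hx, hxe⟩
  refine ⟨?_, fun k hk d hd => key _ k hk d hd rfl⟩
  refine le_antisymm ?_ ?_
  · have hr := h.r_pos
    have h1 := hb (r - 1) (by omega)
    have h2 := h.lam_lt (P (r - 1)) (hP _ (by omega))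
    have h3 := (key _ (r - 1) (by omega) (lam (P (r - 1) + 1) - lam (P (r - 1)) - 1) (by omega) rfl).1
    rw [show r - 1 + 1 = r by omega] at h1
    omega
  · by_contra hlt'
    obtain ⟨k, hk, d, hd, h1⟩ := hcover (psi (b r)) (h.psi_lt _ (by omega))
    obtain ⟨h2, h3⟩ := key _ k hk d hd rfl
    have h4 := h.psi_inj _ (by omega) _ h2 (h1.trans h3.symm)
    have := hbm r le_rfl (k + 1) (by omega)
    have := hb k hk
    omega

end RowSystem
end RunLengthBWT

/-! ### Tables of iterates: application, prefix comparison, access to the row of a position. -/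

namespace RunLengthBWT
open WordRAM

/-- The table of a power of `psi`: the maximal intervals on which the first `a` iterates of `psi` are
translations within runs start at the rows `B 0 < ⋯ < B (m - 1)`; these rows are mapped to
`V 0, …, V (m - 1)` by the `a`-th iterate, and `N k` is a name for the first `a` symbols. -/
structure Table (n r : ℕ) (F psi lam : ℕ → ℕ) (a m : ℕ) (B V N : ℕ → ℕ) : Prop where
  m_pos : 0 < m
  B_zero : B 0 = 0
  B_last : B m = n
  B_lt : ∀ k < m, B k < B (k + 1)
  isBreak : ∀ k < m, Break r psi lam a (B k)
  exists_of_break : ∀ x < n, Break r psi lam a x → ∃ k < m, B k = x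
  V_eq : ∀ k < m, V k = psi^[a] (B k)
  N_eq : ∀ k < m, ∀ l < m, N k = N l ↔ Agree F psi a (B k) (B l)

namespace Table

variable {n r : ℕ} {F psi lam sym ell : ℕ → ℕ} {a m : ℕ} {B V N : ℕ → ℕ}
  (T : Table n r F psi lam a m B V N)
include T

theorem B_strict {k l : ℕ} (hkl : k < l) (hl : l ≤ m) : B k < B l := by
  induction l, hkl using Nat.le_induction with
  | base => exact T.B_lt k (by omega)
  | succ l hkl ih => exact (ih (by omega)).trans (T.B_lt l (by omega))

theorem B_mono {k l : ℕ} (hkl : k ≤ l) (hl : l ≤ m) : B k ≤ B l := by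
  rcases hkl.lt_or_eq with h' | rfl
  · exact (T.B_strict h' hl).le
  · rfl

theorem B_lt_n {k : ℕ} (hk : k < m) : B k < n := T.B_last ▸ T.B_strict hk le_rfl

theorem B_le_n {k : ℕ} (hk : k ≤ m) : B k ≤ n := T.B_last ▸ T.B_mono hk le_rfl

theorem not_break {k y : ℕ} (hk : k < m) (h1 : B k < y) (h2 : y < B (k + 1)) :
    ¬ Break r psi lam a y := by
  intro hy
  obtain ⟨l, hl, rfl⟩ := T.exists_of_break y (h2.trans_le (T.B_le_n hk)) hy
  rcases lt_trichotomy k l with h3 | rfl | h3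
  · have := T.B_mono (show k + 1 ≤ l from h3) hl.le; omega
  · omega
  · have := T.B_strict h3 hk.le; omega

theorem apply (h : RowSystem n r F psi lam sym ell) {k x : ℕ} (hk : k < m) (h1 : B k ≤ x)
    (h2 : x < B (k + 1)) : psi^[a] x = V k + (x - B k) ∧ Agree F psi a (B k) x := by
  rw [T.V_eq k hk]
  exact h.translate h1 (h2.trans_le (T.B_le_n hk))
    fun y hy hyx => T.not_break hk hy (by omega)

theorem N_eq_iff (h : RowSystem n r F psi lam sym ell) {k l x y : ℕ} (hk : k < m) (h1 : B k ≤ x)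
    (h2 : x < B (k + 1)) (hl : l < m) (h3 : B l ≤ y) (h4 : y < B (l + 1)) :
    N k = N l ↔ Agree F psi a x y := by
  rw [T.N_eq k hk l hl]
  have h5 := (T.apply h hk h1 h2).2
  have h6 := (T.apply h hl h3 h4).2
  exact ⟨fun h' => h5.symm.trans (h'.trans h6), fun h' => h5.trans (h'.trans h6.symm)⟩

theorem B_ne {k l : ℕ} (hk : k < m) (hl : l < m) (e : B k = B l) : k = l := by
  rcases lt_trichotomy k l with h' | h' | h'
  · have := T.B_strict h' hl.le; omega
  · exact h'
  · have := T.B_strict h' hk.le; omega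

theorem m_le (h : RowSystem n r F psi lam sym ell) : m ≤ a * r :=
  h.le_of_break (B := B) (fun k hk => ⟨T.B_lt_n hk, T.isBreak k hk⟩) fun _ hk _ hl => T.B_ne hk hl

theorem le_B {k : ℕ} (hk : k ≤ m) : k ≤ B k := by
  induction k with
  | zero => omega
  | succ k ih => have := ih (by omega); have := T.B_lt k (by omega); omega

theorem m_le_n : m ≤ n := T.B_last ▸ T.le_B le_rfl

end Table

/-- Replaces the row in register `24` by its image, by means of the table in the arrays `a`, `b`, `d`
with as many entries as register `z` says. -/
def advance (a b d z : ℕ) : Cmd :=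
  search a z ;;
  .load 25 a (rg 20) ;; .load 26 b (rg 20) ;; .load 27 d (rg 20) ;;
  24 ≔ rg 26 +ₑ (rg 24 -ₑ rg 25)

def stepTime (L : ℕ) : ℕ := 30 * L + 60

/-- Registers `20` to `27` are scratch. Callers learn only the image in `24`, the piece in `20` and
the name in `27`. -/
theorem advance_spec {w K n L : ℕ} (hf : Fits w K n L) {r : ℕ} {F psi lam sym ell : ℕ → ℕ}
    (h : RowSystem n r F psi lam sym ell) {a b d z s m : ℕ} {c : Cfg} {Q : Cfg → Prop}
    (ha : a < 19) (hb : b < 19) (hd : d < 19) (hz : c.reg z = m) (hmK : m ≤ K)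
    (T : Table n r F psi lam s m (c.arr a) (c.arr b) (c.arr d)) (hx : c.reg 24 < n)
    (hQ : ∀ (v : ℕ → ℕ) t, v 24 = psi^[s] (c.reg 24) → v 20 < m → v 27 = c.arr d (v 20) →
      c.arr a (v 20) ≤ c.reg 24 → c.reg 24 < c.arr a (v 20 + 1) → c.t ≤ t → t ≤ c.t + stepTime L →
      Q ⟨fun x => if 20 ≤ x ∧ x ≤ 27 then v x else c.reg x, c.arr, t⟩) :
    vc w K (advance a b d z) Q c := by
  rw [advance, vc]
  refine search_spec hf ha hz T.m_pos T.m_le_n hmK (by rw [T.B_zero]; omega) ?_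
  intro k v₁ v₂ v₃ t hk h1 h2 h3 h4
  -- For the last piece the upper end is the closing entry `B m = n`, which the search itself does
  -- not read.
  have h5 : c.reg 24 < c.arr a (k + 1) := by
    rcases (Nat.succ_le_of_lt hk).lt_or_eq with h' | h'
    · exact h2 h'
    · rw [show k + 1 = m from h', T.B_last]; exact hx
  have h6 := (T.apply h hk h1 h5).1
  have h7 := h.iter_lt s _ hx
  have h8 := hf.lt
  simp [ha, hb, hd]
  refine ⟨by omega, ⟨h1, by omega⟩, ?_⟩
  have := hQ (fun x => if x = 24 then psi^[s] (c.reg 24) else if x = 27 then c.arr d k else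
    if x = 26 then c.arr b k else if x = 25 then c.arr a k else if x = 20 then k else
    if x = 21 then v₁ else if x = 22 then v₂ else v₃) (t + 12) (by simp) (by simpa using hk)
    (by simp) (by simpa using h1) (by simpa using h5) (by omega) (by rw [stepTime]; omega)
  convert this using 1
  ext x
  · simp only [Cfg.tick_reg, Cfg.set_reg, ← h6]
    by_cases hx : 20 ≤ x ∧ x ≤ 27
    · obtain ⟨hx1, hx2⟩ := hx
      interval_cases x <;> simp
    · rw [if_neg hx]
      simp only [show x ≠ 24 by omega, show x ≠ 27 by omega, show x ≠ 26 by omega,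
        show x ≠ 25 by omega, show x ≠ 20 by omega, show x ≠ 21 by omega, show x ≠ 22 by omega,
        show x ≠ 23 by omega, if_false]
  · rfl
  · rfl

/-- As long as the rows in the registers `48` and `49` have the same name in a table, moves both on
and adds the value of register `e` to register `43`. -/
def extend (a b d z e : ℕ) : Cmd :=
  28 ≔ ct 1 ;;
  .loop (rg 28)
    (24 ≔ rg 48 ;; advance a b d z ;; 16 ≔ rg 27 ;; 17 ≔ rg 24 ;;
    24 ≔ rg 49 ;; advance a b d z ;;
    .cond (rg 16 =ₑ rg 27) (48 ≔ rg 17 ;; 49 ≔ rg 24 ;; 43 ≔ rg 43 +ₑ rg e) (28 ≔ ct 0))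

/-- The number `k` counts the successful comparisons. The hypothesis `hl` makes the loop end and
keeps register `43` from overflowing, since agreement cannot extend past the end of the text. -/
theorem extend_spec {w K n L : ℕ} (hf : Fits w K n L) {r : ℕ} {F psi lam sym ell : ℕ → ℕ}
    (h : RowSystem n r F psi lam sym ell) {a b d z e s m : ℕ} {c : Cfg} {Q : Cfg → Prop}
    (ha : a < 19) (hb : b < 19) (hd : d < 19) (hz : c.reg z = m) (hz' : z < 16) (hmK : m ≤ K)
    (he : c.reg e = s) (he' : e < 16) (hs : 0 < s)
    (T : Table n r F psi lam s m (c.arr a) (c.arr b) (c.arr d))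
    (hx : c.reg 48 < n) (hy : c.reg 49 < n)
    (hl : ∀ k, Agree F psi k (c.reg 48) (c.reg 49) → c.reg 43 + k ≤ n)
    (hQ : ∀ c' k, (∀ x, x < 16 ∨ 28 < x → x ≠ 43 → x ≠ 48 → x ≠ 49 → c'.reg x = c.reg x) →
      c'.arr = c.arr → c'.reg 43 = c.reg 43 + s * k → c'.reg 48 = psi^[s * k] (c.reg 48) →
      c'.reg 49 = psi^[s * k] (c.reg 49) → Agree F psi (s * k) (c.reg 48) (c.reg 49) →
      ¬ Agree F psi s (c'.reg 48) (c'.reg 49) → c.t ≤ c'.t →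
      c'.t ≤ c.t + (k + 1) * (2 * stepTime L + 30) → Q c') :
    vc w K (extend a b d z e) Q c := by
  have h3 := hf.two_le_w
  have h4 := hf.lt
  simp only [extend, vc]
  simp
  refine ⟨by omega, ?_⟩
  generalize hA : stepTime L = A at hQ
  -- Register `28` is the flag for continuing. It enters the variant because the failing round
  -- changes only the flag and leaves register `43` alone.
  refine wp_loop hf.w_pos (fun c' => c'.reg 28 ≤ 1 ∧ c.t ≤ c'.t ∧ ∃ k,
    c'.reg 43 = c.reg 43 + s * k ∧ c'.reg 48 = psi^[s * k] (c.reg 48) ∧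
    c'.reg 49 = psi^[s * k] (c.reg 49) ∧ Agree F psi (s * k) (c.reg 48) (c.reg 49) ∧
    (c'.reg 28 = 0 → ¬ Agree F psi s (c'.reg 48) (c'.reg 49)) ∧
    c'.t + c'.reg 28 * (2 * A + 26) ≤ c.t + (k + 1) * (2 * A + 30) - 2)
    (fun c' => n - c'.reg 43 + c'.reg 28) ?_ ?_
  · exact ⟨by simp, by simp, 0, by simp, by simp, by simp, by simp [Agree], by simp, by simp; omega⟩
  · rintro c' ⟨i1, i2, k, i3, i4, i5, i6, i7, i8⟩ hF
    obtain ⟨hr, har⟩ := hF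
    simp [advance, search] at hr har
    replace har : c'.arr = c.arr := funext har
    simp
    have hrz : c'.reg z = m := by simp (disch := omega) [hr, hz, show z ≠ 28 by omega]
    have hre : c'.reg e = s := by simp (disch := omega) [hr, he, show e ≠ 28 by omega]
    constructor
    · intro h28
      obtain h28 : c'.reg 28 = 1 := by omega
      refine advance_spec hf h ha hb hd (s := s) (m := m) ?_ hmK ?_ ?_ ?_
      · simpa [show z ≠ 24 by omega] using hrz
      · simpa [har] using T
      · simpa [i4] using h.iter_lt _ _ hx
      intro v t e1 e2 e3 e4 e5 e6 e7
      simp at e1 e3 e4 e5 e6 e7 ⊢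
      refine advance_spec hf h ha hb hd (s := s) (m := m) ?_ hmK ?_ ?_ ?_
      · simpa [show z ≠ 24 by omega, show z ≠ 16 by omega, show z ≠ 17 by omega,
          show ¬ (20 ≤ z ∧ z ≤ 27) by omega] using hrz
      · simpa [har] using T
      · simpa [i5] using h.iter_lt _ _ hy
      intro v' t' e1' e2' e3' e4' e5' e6' e7'
      simp at e1' e3' e4' e5' e6' e7' ⊢
      rw [har] at e3 e4 e5 e3' e4' e5'
      rw [hA] at e7 e7'
      have key := T.N_eq_iff h e2 e4 e5 e2' e4' e5'
      rw [← e3, ← e3'] at key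
      rw [key]
      constructor
      · intro hag
        have h5 : Agree F psi (s * (k + 1)) (c.reg 48) (c.reg 49) := by
          rw [mul_add, mul_one, agree_add, ← i4, ← i5]
          exact ⟨i6, hag⟩
        have h6 := hl _ h5
        have h7 : s * (k + 1) = s * k + s := by ring
        simp only [show e ≠ 49 by omega, show e ≠ 48 by omega, show e ≠ 24 by omega,
          show e ≠ 17 by omega, show e ≠ 16 by omega, show ¬ (20 ≤ e ∧ e ≤ 27) by omega, if_false, hre]
        refine ⟨by omega, ⟨by omega, by omega, k + 1, by omega, ?_, ?_, h5, by omega, ?_⟩, by omega⟩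
        · rw [e1, i4, h7, add_comm, Function.iterate_add_apply]
        · rw [e1', i5, h7, add_comm, Function.iterate_add_apply]
        · rw [h28] at i8 ⊢
          have : (k + 1 + 1) * (2 * A + 30) = (k + 1) * (2 * A + 30) + (2 * A + 30) := by ring
          omega
      · intro hag
        refine ⟨⟨by omega, k, i3, i4, i5, i6, hag, ?_⟩, by omega⟩
        rw [h28] at i8
        omega
    · intro h28
      refine hQ _ k ?_ har i3 i4 i5 i6 (i7 h28) (by simp; omega) ?_
      · intro x hx1 hx2 hx3 hx4
        have : x ≠ 28 := by omega
        simp (disch := omega) [hr, this]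
      · have : 2 ≤ (k + 1) * (2 * A + 30) := by nlinarith
        rw [h28] at i8
        simp
        omega

/-- Register `24` gets the row of the text position in register `19`, from the sampled rows in the
array `14`. -/
def rowAt : Cmd :=
  18 ≔ (rg 19 -ₑ ct 1) /ₑ rg 3 ;; .load 24 14 (rg 18) ;;
  18 ≔ (rg 19 -ₑ ct 1) %ₑ rg 3 +ₑ ct 1 ;;
  .loop (rg 18) (advance 6 7 18 1 ;; 18 ≔ rg 18 -ₑ ct 1)

/-- The position is split as `q * s + d` with `1 ≤ d ≤ s` instead of `0 ≤ d < s`. Then `q * s < n`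
even for position `n`, so the sample exists. -/
theorem rowAt_spec {w K n L : ℕ} (hf : Fits w K n L) {r : ℕ} {F psi lam sym ell : ℕ → ℕ}
    (h : RowSystem n r F psi lam sym ell) {s : ℕ} {c : Cfg} {Q : Cfg → Prop}
    (hr : c.reg 1 = r) (hrK : r ≤ K) (hs : c.reg 3 = s) (hs0 : 0 < s) (hsn : s ≤ n)
    (T : Table n r F psi lam 1 r (c.arr 6) (c.arr 7) (c.arr 18))
    (hS : ∀ q, q * s < n → c.arr 14 q = psi^[q * s] 0) (hSK : (n - 1) / s < K)
    (ht : 1 ≤ c.reg 19) (htn : c.reg 19 ≤ n)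
    (hQ : ∀ (v : ℕ → ℕ) t, v 24 = psi^[c.reg 19] 0 → c.t ≤ t →
      t ≤ c.t + s * (stepTime L + 10) + 30 →
      Q ⟨fun x => if 18 ≤ x ∧ x ≤ 27 ∧ x ≠ 19 then v x else c.reg x, c.arr, t⟩) :
    vc w K rowAt Q c := by
  have h3 := hf.two_le_w
  have h4 := hf.lt
  generalize hu : c.reg 19 = u at *
  have h5 : (u - 1) / s ≤ (n - 1) / s := Nat.div_le_div_right (by omega)
  have h6 : (u - 1) % s < s := Nat.mod_lt _ hs0
  have h7 := Nat.div_add_mod (u - 1) s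
  have h7' : s * ((u - 1) / s) = (u - 1) / s * s := Nat.mul_comm _ _
  simp only [rowAt, vc]
  simp [hu, hs]
  refine ⟨⟨by omega, by omega⟩, by omega, ⟨⟨by omega, by omega⟩, by omega⟩, ?_⟩
  generalize hA : stepTime L = A at hQ
  refine wp_loop hf.w_pos (fun c' => c'.reg 18 ≤ u ∧ c'.reg 24 = psi^[u - c'.reg 18] 0 ∧
    c.t ≤ c'.t ∧ c'.reg 18 ≤ s ∧
    c'.t + c'.reg 18 * (A + 10) ≤ c.t + s * (A + 10) + 20) (fun c' => c'.reg 18) ?_ ?_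
  · simp
    refine ⟨by omega, ?_, by omega, by omega, ?_⟩
    · rw [hS _ (by omega)]
      congr 1
      omega
    · have : ((u - 1) % s + 1) * (A + 10) ≤ s * (A + 10) := Nat.mul_le_mul_right _ (by omega)
      omega
  · rintro c' ⟨i1, i2, i3, i3', i4⟩ hF
    obtain ⟨hr', har⟩ := hF
    simp [advance, search] at hr' har
    replace har : c'.arr = c.arr := funext har
    simp
    constructor
    · intro h18
      refine advance_spec hf h (by simp) (by simp) (by simp) (s := 1) (m := r) ?_ hrK ?_ ?_ ?_
      · simpa [hr'] using hr
      · simpa [har] using T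
      · simpa [i2] using h.iter_lt _ _ h.n_pos
      intro v t e1 e2 e3 e4 e5 e6 e7
      simp at e1 e3 e4 e5 e6 e7 ⊢
      rw [hA] at e7
      refine ⟨⟨by omega, by omega⟩, ⟨by omega, ?_, by omega, by omega, ?_⟩, by omega⟩
      · rw [e1, i2, ← Function.iterate_succ_apply' psi]
        congr 1
        omega
      · have : c'.reg 18 * (A + 10) = (c'.reg 18 - 1) * (A + 10) + (A + 10) := by
          conv_lhs => rw [show c'.reg 18 = c'.reg 18 - 1 + 1 by omega]
          ring
        omega
    · intro h18
      have := hQ c'.reg (c'.t + 2) (by rw [i2, h18]; simp) (by omega) (by omega)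
      convert this using 1
      ext x
      · simp only [Cfg.tick_reg]
        by_cases hx : 18 ≤ x ∧ x ≤ 27 ∧ x ≠ 19
        · rw [if_pos hx]
        · rw [if_neg hx]
          have h24 : x ≠ 24 := by omega
          have h18 : x ≠ 18 := by omega
          simp (disch := omega) [hr', h18, h24]
      · rw [← har]; rfl
      · rfl

end RunLengthBWT

/-! ### Squaring a table: refinement of a single piece. -/

namespace RunLengthBWT
open WordRAM

/-- A table of the `a + a`-th iterate, built from a table of the `a`-th iterate, as far as the
rows below `e` are concerned; `p` and `q` are the names of the two halves of the last entry, and `cnt`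
is its name. -/
structure PartialTable (n r : ℕ) (F psi lam : ℕ → ℕ) (a m : ℕ) (B N : ℕ → ℕ) (e m' p q cnt : ℕ)
    (B' V' N' : ℕ → ℕ) : Prop where
  B_lt : ∀ k < m', B' k < e
  B_strict : ∀ k l, k < l → l < m' → B' k < B' l
  isBreak : ∀ k < m', Break r psi lam (a + a) (B' k)
  exists_of_break : ∀ x < e, Break r psi lam (a + a) x → ∃ k < m', B' k = x
  V_eq : ∀ k < m', V' k = psi^[a + a] (B' k)
  N_eq : ∀ k < m', ∀ l < m', N' k = N' l ↔ Agree F psi (a + a) (B' k) (B' l)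
  N_le : ∀ k < m', N' k ≤ cnt
  cnt_le : cnt ≤ m'
  last : 0 < m' → N' (m' - 1) = cnt ∧ ∃ k < m, ∃ l < m, p = N k ∧ q = N l ∧
    B k ≤ B' (m' - 1) ∧ B' (m' - 1) < B (k + 1) ∧
    B l ≤ psi^[a] (B' (m' - 1)) ∧ psi^[a] (B' (m' - 1)) < B (l + 1)

namespace PartialTable

variable {n r : ℕ} {F psi lam sym ell : ℕ → ℕ} {a m : ℕ} {B V N : ℕ → ℕ}
  {e m' p q cnt : ℕ} {B' V' N' : ℕ → ℕ}

theorem empty : PartialTable n r F psi lam a m B N 0 0 p q 0 B' V' N' := by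
  constructor <;> simp

theorem le_B (P : PartialTable n r F psi lam a m B N e m' p q cnt B' V' N') {k : ℕ} (hk : k < m') :
    k ≤ B' k := by
  induction k with
  | zero => omega
  | succ k ih => have := ih (by omega); have := P.B_strict k (k + 1) (by omega) hk; omega

theorem m_le (P : PartialTable n r F psi lam a m B N e m' p q cnt B' V' N') : m' ≤ e := by
  rcases Nat.eq_zero_or_pos m' with h0 | h0
  · omega
  · have := P.le_B (show m' - 1 < m' by omega); have := P.B_lt (m' - 1) (by omega); omega

theorem m_le_mul (h : RowSystem n r F psi lam sym ell)
    (P : PartialTable n r F psi lam a m B N e m' p q cnt B' V' N') (he : e ≤ n) :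
    m' ≤ (a + a) * r := by
  refine h.le_of_break (B := B') (fun k hk => ⟨(P.B_lt k hk).trans_le he, P.isBreak k hk⟩) ?_
  intro k hk l hl hkl
  rcases lt_trichotomy k l with h' | h' | h'
  · have := P.B_strict k l h' hl; omega
  · exact h'
  · have := P.B_strict l k h' hk; omega

/-- A prefix of length `2a` is named by the pair of names of its halves. Rows with equal prefixes
are contiguous, so the new row shares its prefix with some earlier entry only if it shares it with
the last one. Comparing with the last pair therefore decides whether the counter must grow. -/
theorem step (h : RowSystem n r F psi lam sym ell) (T : Table n r F psi lam a m B V N)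
    (P : PartialTable n r F psi lam a m B N e m' p q cnt B' V' N') {k l e' cnt' v : ℕ}
    (hk : k < m) (h1 : B k ≤ e) (h2 : e < B (k + 1)) (hl : l < m) (h3 : B l ≤ psi^[a] e)
    (h4 : psi^[a] e < B (l + 1)) (hb : Break r psi lam (a + a) e) (he : e < e')
    (he' : e' ≤ B (k + 1)) (hv : psi^[a] e + (e' - e) ≤ B (l + 1))
    (hve : v = V l + (psi^[a] e - B l))
    (hc : (p = N k ∧ q = N l) ∧ cnt' = cnt ∨ ¬ (p = N k ∧ q = N l) ∧ cnt' = cnt + 1) :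
    PartialTable n r F psi lam a m B N e' (m' + 1) (N k) (N l) cnt' (Function.update B' m' e)
      (Function.update V' m' v) (Function.update N' m' cnt') := by
  have hen : e < n := h2.trans_le (T.B_le_n hk)
  have hold : ∀ {X : ℕ → ℕ} {y k : ℕ}, k < m' → Function.update X m' y k = X k := fun hk =>
    Function.update_of_ne (by omega) _ _
  have hcl : cnt ≤ cnt' := by omega
  have hnew : ∀ i < m', N' i = cnt' ↔ Agree F psi (a + a) (B' i) e := by
    intro i hi
    obtain ⟨g1, k', hk', l', hl', g2, g3, g4, g5, g6, g7⟩ := P.last (by omega)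
    have g8 : (p = N k ∧ q = N l) ↔ Agree F psi (a + a) (B' (m' - 1)) e := by
      rw [agree_add, g2, g3, T.N_eq_iff h hk' g4 g5 hk h1 h2, T.N_eq_iff h hl' g6 g7 hl h3 h4]
    rw [g8] at hc
    rcases hc with ⟨hc, rfl⟩ | ⟨hc, rfl⟩
    · rw [← g1, P.N_eq i hi _ (by omega)]
      exact ⟨fun h' => h'.trans hc, fun h' => h'.trans hc.symm⟩
    · refine ⟨fun h' => ?_, fun h' => ?_⟩
      · have := P.N_le i hi; omega
      · have g9 : B' i ≤ B' (m' - 1) := by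
          rcases (Nat.le_sub_one_of_lt hi).lt_or_eq with g | g
          · exact (P.B_strict i _ g (by omega)).le
          · rw [g]
        have g10 := h.agree_between g9 (P.B_lt (m' - 1) (by omega)).le hen h'
        exact absurd (g10.symm.trans h') hc
  constructor
  · intro i hi
    rcases Nat.lt_succ_iff_lt_or_eq.1 hi with hi | rfl
    · rw [hold hi]; have := P.B_lt i hi; omega
    · simpa using he
  · intro i j hij hj
    rcases Nat.lt_succ_iff_lt_or_eq.1 hj with hj | rfl
    · rw [hold hj, hold (by omega)]; exact P.B_strict i j hij hj
    · rw [hold hij]; simpa using P.B_lt i hij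
  · intro i hi
    rcases Nat.lt_succ_iff_lt_or_eq.1 hi with hi | rfl
    · rw [hold hi]; exact P.isBreak i hi
    · simpa using hb
  · intro x hx hxb
    rcases lt_trichotomy x e with hxe | rfl | hxe
    · obtain ⟨i, hi, rfl⟩ := P.exists_of_break x hxe hxb
      exact ⟨i, by omega, hold hi⟩
    · exact ⟨m', by omega, by simp⟩
    -- Strictly between `e` and `e'`, rows stay inside piece `k` and their `a`-th iterates inside
    -- piece `l`, so neither half meets a break.
    · exfalso
      rcases break_add.1 hxb with hb' | hb'
      · exact T.not_break hk (by omega) (by omega) hb'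
      · have g1 := (T.apply h hk h1 h2).1
        have g2 := (T.apply h hk (x := x) (by omega) (by omega)).1
        exact T.not_break hl (by omega) (by omega) hb'
  · intro i hi
    rcases Nat.lt_succ_iff_lt_or_eq.1 hi with hi | rfl
    · rw [hold hi, hold hi]; exact P.V_eq i hi
    · simp only [Function.update_self]
      rw [hve, Function.iterate_add_apply, (T.apply h hl h3 h4).1]
  · intro i hi j hj
    rcases Nat.lt_succ_iff_lt_or_eq.1 hi with hi | rfl
    · rcases Nat.lt_succ_iff_lt_or_eq.1 hj with hj | rfl
      · rw [hold hi, hold hi, hold hj, hold hj]; exact P.N_eq i hi j hj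
      · rw [hold hi, hold hi]; simpa using hnew i hi
    · rcases Nat.lt_succ_iff_lt_or_eq.1 hj with hj | rfl
      · rw [hold hj, hold hj, eq_comm]
        simp only [Function.update_self]
        rw [hnew j hj]
        exact ⟨Agree.symm, Agree.symm⟩
      · simp [Agree]
  · intro i hi
    rcases Nat.lt_succ_iff_lt_or_eq.1 hi with hi | rfl
    · rw [hold hi]; exact (P.N_le i hi).trans hcl
    · simp
  · have := P.cnt_le; omega
  · intro _
    simp only [Nat.add_sub_cancel, Function.update_self]
    exact ⟨trivial, k, hk, l, hl, rfl, rfl, h1, h2, h3, h4⟩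

/-- Here `B''` stands for the list `B'` closed off by the entry `n` at index `m'`. -/
theorem table (h : RowSystem n r F psi lam sym ell)
    (P : PartialTable n r F psi lam a m B N n m' p q cnt B' V' N') (ha : 0 < a) {B'' : ℕ → ℕ}
    (hB : ∀ k < m', B'' k = B' k) (hn : B'' m' = n) :
    Table n r F psi lam (a + a) m' B'' V' N' := by
  obtain ⟨k₀, hk₀, h0⟩ := P.exists_of_break 0 h.n_pos ⟨0, by omega, h.start_zero⟩
  constructor
  · omega
  · rw [hB 0 (by omega)]
    rcases Nat.eq_zero_or_pos k₀ with rfl | h1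
    · exact h0
    · have := P.B_strict 0 k₀ h1 hk₀; omega
  · exact hn
  · intro k hk
    rw [hB k hk]
    rcases (Nat.succ_le_of_lt hk).lt_or_eq with h1 | h1
    · rw [hB _ h1]; exact P.B_strict k _ (by omega) h1
    · rw [show k + 1 = m' from h1, hn]; exact P.B_lt k hk
  · intro k hk; rw [hB k hk]; exact P.isBreak k hk
  · intro x hx hxb
    obtain ⟨k, hk, rfl⟩ := P.exists_of_break x hx hxb
    exact ⟨k, hk, hB k hk⟩
  · intro k hk; rw [hB k hk]; exact P.V_eq k hk
  · intro k hk l hl; rw [hB k hk, hB l hl]; exact P.N_eq k hk l hl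

end PartialTable

/-- Emits the entries of the squared table that come from one entry of the table. -/
def refinePiece : Cmd :=
  39 ≔ ct 0 ;;
  .loop (rg 39 <ₑ (rg 36 -ₑ rg 35))
    (.load 40 8 (rg 20) ;; .load 41 9 (rg 20) ;; .load 42 10 (rg 20) ;;
    .store 11 (rg 31) (rg 35 +ₑ rg 39) ;;
    .store 12 (rg 31) (rg 41 +ₑ (rg 37 +ₑ rg 39 -ₑ rg 40)) ;;
    .cond (rg 32 =ₑ rg 38 &ₑ rg 33 =ₑ rg 42) .skip (34 ≔ rg 34 +ₑ ct 1) ;;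
    .store 13 (rg 31) (rg 34) ;;
    32 ≔ rg 38 ;; 33 ≔ rg 42 ;; 31 ≔ rg 31 +ₑ ct 1 ;; 20 ≔ rg 20 +ₑ ct 1 ;;
    .load 40 8 (rg 20) ;; 39 ≔ rg 40 -ₑ rg 37)

def Cfg.IsPartial (n r : ℕ) (F psi lam : ℕ → ℕ) (a m : ℕ) (B N : ℕ → ℕ) (e : ℕ) (c : Cfg) : Prop :=
  PartialTable n r F psi lam a m B N e (c.reg 31) (c.reg 32) (c.reg 33) (c.reg 34) (c.arr 11)
    (c.arr 12) (c.arr 13)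

/-- The image of piece `k` is an interval of the same length, to be cut wherever a piece starts
inside it. Register `39` is the offset of the next cut and register `20` the piece its image lies
in. The time is charged to the entries emitted. -/
theorem refinePiece_spec {w K n L : ℕ} (hf : Fits w K n L) {r : ℕ} {F psi lam sym ell : ℕ → ℕ}
    (h : RowSystem n r F psi lam sym ell) {a m k : ℕ} {c : Cfg} {Q : Cfg → Prop}
    (T : Table n r F psi lam a m (c.arr 8) (c.arr 9) (c.arr 10)) (hmK : m < K)
    (hmK' : (a + a) * r < K) (hk : k < m)
    (h35 : c.reg 35 = c.arr 8 k) (h36 : c.reg 36 = c.arr 8 (k + 1)) (h37 : c.reg 37 = c.arr 9 k)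
    (h38 : c.reg 38 = c.arr 10 k) (hl : c.reg 20 < m) (hl1 : c.arr 8 (c.reg 20) ≤ c.arr 9 k)
    (hl2 : c.arr 9 k < c.arr 8 (c.reg 20 + 1))
    (hP : Cfg.IsPartial n r F psi lam a m (c.arr 8) (c.arr 10) (c.arr 8 k) c)
    (hQ : ∀ c', (∀ x, x ≠ 20 → x < 31 ∨ 42 < x → c'.reg x = c.reg x) → c'.reg 30 = c.reg 30 →
      (∀ x, x ≠ 11 → x ≠ 12 → x ≠ 13 → c'.arr x = c.arr x) →
      Cfg.IsPartial n r F psi lam a m (c.arr 8) (c.arr 10) (c.arr 8 (k + 1)) c' →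
      c.t ≤ c'.t → c'.t + 60 * c.reg 31 ≤ c.t + 60 * c'.reg 31 + 20 → Q c') :
    vc w K refinePiece Q c := by
  have g3 := hf.two_le_w
  have g4 := hf.lt
  have hBk := T.B_lt k hk
  have hBn := T.B_le_n (show k + 1 ≤ m from hk)
  simp only [refinePiece, vc]
  simp
  -- The minimum is needed because the last offset may overshoot the end of piece `k`.
  refine wp_loop hf.w_pos (fun c' => Cfg.IsPartial n r F psi lam a m (c.arr 8) (c.arr 10)
      (c.arr 8 k + min (c'.reg 39) (c.arr 8 (k + 1) - c.arr 8 k)) c' ∧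
    (c.arr 8 k + c'.reg 39 < c.arr 8 (k + 1) → c'.reg 20 < m ∧
      c.arr 8 (c'.reg 20) ≤ c.arr 9 k + c'.reg 39 ∧ c.arr 9 k + c'.reg 39 < c.arr 8 (c'.reg 20 + 1) ∧
      Break r psi lam (a + a) (c.arr 8 k + c'.reg 39)) ∧
    c.t ≤ c'.t ∧ c'.t + 60 * c.reg 31 ≤ c.t + 60 * c'.reg 31 + 10)
    (fun c' => c.arr 8 (k + 1) - (c.arr 8 k + c'.reg 39)) ?_ ?_
  · simp [Cfg.IsPartial] at hP ⊢
    refine ⟨hP, fun _ => ⟨hl, hl1, hl2, break_add.2 (.inl (T.isBreak k hk))⟩, by omega⟩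
  · rintro c' ⟨i1, i2, i3, i4⟩ hF
    obtain ⟨hr, har⟩ := hF
    simp at hr har
    simp [hr, har]
    rw [h35, h36, h37, h38]
    have hB := i1.m_le
    constructor
    · omega
    constructor
    · intro hlt
      obtain ⟨j1, j2, j3, j4⟩ := i2 (by omega)
      generalize hd : c'.reg 39 = d at *
      generalize hle : c'.reg 20 = l at *
      have hmin : min d (c.arr 8 (k + 1) - c.arr 8 k) = d := by omega
      rw [hmin] at i1 hB
      have hap := (T.apply h hk (x := c.arr 8 k + d) (by omega) (by omega)).1
      rw [Nat.add_sub_cancel_left] at hap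
      have hvn := h.iter_lt a (c.arr 8 k + d) (by omega)
      have hwn := h.iter_lt a _ hvn
      have hv := (T.apply h j1 (x := psi^[a] (c.arr 8 k + d)) (by omega) (by omega)).1
      rw [hap] at hv hvn hwn
      have hBl := T.B_lt_n j1
      have hBl1 := T.B_le_n (show l + 1 ≤ m from j1)
      set d' := c.arr 8 (l + 1) - c.arr 9 k with hd'
      have hmn := T.m_le_n
      have main : ∀ cnt', ((c'.reg 32 = c.arr 10 k ∧ c'.reg 33 = c.arr 10 l) ∧ cnt' = c'.reg 34 ∨
          ¬ (c'.reg 32 = c.arr 10 k ∧ c'.reg 33 = c.arr 10 l) ∧ cnt' = c'.reg 34 + 1) →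
          PartialTable n r F psi lam a m (c.arr 8) (c.arr 10)
            (c.arr 8 k + min d' (c.arr 8 (k + 1) - c.arr 8 k)) (c'.reg 31 + 1) (c.arr 10 k)
            (c.arr 10 l) cnt' (Function.update (c'.arr 11) (c'.reg 31) (c.arr 8 k + d))
            (Function.update (c'.arr 12) (c'.reg 31) (c.arr 9 l + (c.arr 9 k + d - c.arr 8 l)))
            (Function.update (c'.arr 13) (c'.reg 31) cnt') := by
        intro cnt' hc
        exact i1.step h T hk (by omega) (by omega) j1 (by omega) (by omega) j4 (by omega) (by omega)
          (by omega) (by omega) hc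
      -- The array index is in range because the extended partial table is itself subject to the
      -- counting bound for breaks.
      have hm1 : c'.reg 31 + 1 ≤ (a + a) * r := by
        by_cases hc : c'.reg 32 = c.arr 10 k ∧ c'.reg 33 = c.arr 10 l
        · exact (main _ (.inl ⟨hc, rfl⟩)).m_le_mul h (by omega)
        · exact (main _ (.inr ⟨hc, rfl⟩)).m_le_mul h (by omega)
      have hcnt := i1.cnt_le
      have hnext : c.arr 8 k + d' < c.arr 8 (k + 1) → l + 1 < m ∧
          c.arr 8 (l + 1) ≤ c.arr 9 k + d' ∧ c.arr 9 k + d' < c.arr 8 (l + 1 + 1) ∧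
          Break r psi lam (a + a) (c.arr 8 k + d') := by
        intro hlt'
        have hap' := (T.apply h hk (x := c.arr 8 k + d') (by omega) (by omega)).1
        rw [Nat.add_sub_cancel_left] at hap'
        have hvn' := h.iter_lt a (c.arr 8 k + d') (by omega)
        have hl1 : l + 1 < m := by
          rcases (Nat.succ_le_of_lt j1).lt_or_eq with h' | h'
          · exact h'
          · have := T.B_last; rw [← h'] at this; simp only [Nat.succ_eq_add_one] at this; omega
        refine ⟨hl1, by omega, by have := T.B_lt (l + 1) hl1; omega, break_add.2 (.inr ?_)⟩
        rw [hap', show c.arr 9 k + d' = c.arr 8 (l + 1) by omega]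
        exact T.isBreak _ hl1
      refine ⟨by omega, by omega, by omega, ?_, ?_⟩
      · intro hc1 hc2
        refine ⟨by omega, by omega, by omega, by omega, by omega, ⟨?_, hnext, by omega, by omega⟩, by omega⟩
        simp only [Cfg.IsPartial]
        simpa using main _ (.inl ⟨⟨hc1, hc2⟩, rfl⟩)
      · intro hc
        refine ⟨by omega, by omega, by omega, by omega, by omega, by omega, ⟨?_, hnext, by omega, by omega⟩, by omega⟩
        simp only [Cfg.IsPartial]
        simpa using main _ (.inr ⟨by tauto, rfl⟩)
    · intro hge
      refine hQ _ ?_ ?_ ?_ ?_ ?_ ?_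
      · intro x hx hx'
        have h20 : x ≠ 39 := by omega
        simp (disch := omega) [hr, h20]
      · simp [hr]
      · intro x hx1 hx2 hx3
        simp [har, hx1, hx2, hx3]
      · have hmin : c.arr 8 k + min (c'.reg 39) (c.arr 8 (k + 1) - c.arr 8 k) = c.arr 8 (k + 1) := by
          omega
        rw [hmin] at i1
        exact i1
      · simp; omega
      · simp; omega

end RunLengthBWT

/-! ### Squaring a whole table, repeatedly. -/

namespace RunLengthBWT
open WordRAM

/-- Copies the arrays `11`, `12`, `13` to `8`, `9`, `10`. -/
def copyTable : Cmd :=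
  30 ≔ ct 0 ;;
  .loop (rg 30 <ₑ rg 31)
    (.load 35 11 (rg 30) ;; .store 8 (rg 30) (rg 35) ;;
    .load 35 12 (rg 30) ;; .store 9 (rg 30) (rg 35) ;;
    .load 35 13 (rg 30) ;; .store 10 (rg 30) (rg 35) ;;
    30 ≔ rg 30 +ₑ ct 1)

theorem copyTable_spec {w K n L : ℕ} (hf : Fits w K n L) {m : ℕ} {c : Cfg} {Q : Cfg → Prop}
    (hm : c.reg 31 = m) (hmn : m ≤ n) (hmK : m < K)
    (hQ : ∀ c', (∀ x, x ≠ 30 → x ≠ 35 → c'.reg x = c.reg x) →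
      (∀ x, x ≠ 8 → x ≠ 9 → x ≠ 10 → c'.arr x = c.arr x) →
      (∀ i < m, c'.arr 8 i = c.arr 11 i) → (∀ i < m, c'.arr 9 i = c.arr 12 i) →
      (∀ i < m, c'.arr 10 i = c.arr 13 i) → c.t ≤ c'.t → c'.t ≤ c.t + m * 30 + 10 → Q c') :
    vc w K copyTable Q c := by
  have h3 := hf.two_le_w
  have h4 := hf.lt
  simp only [copyTable, vc]
  simp
  refine wp_loop hf.w_pos (fun c' => c'.reg 30 ≤ m ∧ c.t ≤ c'.t ∧
    c'.t ≤ c.t + c'.reg 30 * 30 + 5 ∧ ∀ i < c'.reg 30, c'.arr 8 i = c.arr 11 i ∧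
      c'.arr 9 i = c.arr 12 i ∧ c'.arr 10 i = c.arr 13 i) (fun c' => m - c'.reg 30) ?_ ?_
  · simp
  · rintro c' ⟨i1, i2, i3, i4⟩ hF
    obtain ⟨hr, har⟩ := hF
    simp at hr har
    simp [hr, har, hm]
    constructor
    · intro hlt
      refine ⟨by omega, by omega, ⟨by omega, by omega, by omega, ?_⟩, by omega⟩
      intro i hi
      rcases hi.lt_or_eq with hi | rfl
      · obtain ⟨j1, j2, j3⟩ := i4 i hi
        simp [Function.update_of_ne hi.ne, j1, j2, j3]
      · simp
    · intro hge
      obtain rfl : m = c'.reg 30 := by omega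
      refine hQ _ ?_ ?_ (fun i hi => (i4 i hi).1) (fun i hi => (i4 i hi).2.1)
        (fun i hi => (i4 i hi).2.2) (by simp; omega) (by simp; omega)
      · intro x h1 h2; simp [hr, h1, h2]
      · intro x h1 h2 h3; simp [har, h1, h2, h3]

/-- Replaces the table in the arrays `8`, `9`, `10` by the table of the squared map. -/
def square : Cmd :=
  30 ≔ ct 0 ;; 31 ≔ ct 0 ;; 34 ≔ ct 0 ;;
  .loop (rg 30 <ₑ rg 4)
    (.load 35 8 (rg 30) ;; .load 36 8 (rg 30 +ₑ ct 1) ;; .load 37 9 (rg 30) ;;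
    .load 38 10 (rg 30) ;; 24 ≔ rg 37 ;; search 8 4 ;; refinePiece ;; 30 ≔ rg 30 +ₑ ct 1) ;;
  copyTable ;; .store 8 (rg 31) (rg 0) ;; 4 ≔ rg 31 ;; 3 ≔ rg 3 +ₑ rg 3

/-- Each of the at most `a * r` old pieces costs one binary search, and each of the at most `2 * a *
r` new ones a constant number of steps. -/
theorem square_spec {w K n L : ℕ} (hf : Fits w K n L) {r : ℕ} {F psi lam sym ell : ℕ → ℕ}
    (h : RowSystem n r F psi lam sym ell) {a m : ℕ} {c : Cfg} {Q : Cfg → Prop}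
    (T : Table n r F psi lam a m (c.arr 8) (c.arr 9) (c.arr 10))
    (h0 : c.reg 0 = n) (h4 : c.reg 4 = m) (h3 : c.reg 3 = a) (ha : 0 < a) (han : a + a ≤ n)
    (hK : (a + a) * r < K)
    (hQ : ∀ c' m', (∀ x < 20, x ≠ 3 → x ≠ 4 → c'.reg x = c.reg x) →
      (∀ x, x < 8 ∨ 13 < x → c'.arr x = c.arr x) → c'.reg 4 = m' → c'.reg 3 = a + a →
      Table n r F psi lam (a + a) m' (c'.arr 8) (c'.arr 9) (c'.arr 10) →
      c.t ≤ c'.t → c'.t ≤ c.t + a * r * (30 * L + 400) + 100 → Q c') :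
    vc w K square Q c := by
  have g3 := hf.two_le_w
  have g4 := hf.lt
  have hm := T.m_le h
  have hmn := T.m_le_n
  have har2 : (a + a) * r = a * r + a * r := by ring
  simp only [square, vc]
  simp
  refine wp_loop hf.w_pos (fun c' => c'.reg 30 ≤ m ∧ c.t ≤ c'.t ∧
    c'.t ≤ c.t + c'.reg 30 * (30 * L + 100) + 60 * c'.reg 31 + 10 ∧
    Cfg.IsPartial n r F psi lam a m (c.arr 8) (c.arr 10) (c.arr 8 (c'.reg 30)) c')
    (fun c' => m - c'.reg 30) ?_ ?_
  · simp [Cfg.IsPartial, T.B_zero, PartialTable.empty]; omega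
  · rintro c' ⟨i1, i2, i3, i4⟩ hF
    obtain ⟨hr, har⟩ := hF
    simp [search, refinePiece] at hr har
    simp [hr, har, h4]
    constructor
    · intro hlt
      refine ⟨by omega, by omega, by omega, ?_⟩
      have hV := T.V_eq _ hlt
      have hVn := h.iter_lt a _ (T.B_lt_n hlt)
      rw [← hV] at hVn
      refine search_spec hf (m := m) (by simp) (by simp [hr, h4]) T.m_pos hmn (by omega)
        (by simp [har, T.B_zero]) ?_
      intro k v₁ v₂ v₃ t hk e1 e2 e3 e4
      simp [har] at e1 e2 e3 e4 ⊢
      have h5 : c.arr 9 (c'.reg 30) < c.arr 8 (k + 1) := by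
        rcases (Nat.succ_le_of_lt hk).lt_or_eq with h' | h'
        · exact e2 h'
        · rw [show k + 1 = m from h', T.B_last]; exact hVn
      refine refinePiece_spec hf h (a := a) (m := m) (k := c'.reg 30) (by simpa [har] using T)
        (by omega) hK hlt (by simp [har]) (by simp [har]) (by simp [har]) (by simp [har])
        (by simpa using hk) (by simpa [har] using e1) (by simpa [har] using h5)
        (by simpa [har, Cfg.IsPartial] using i4) ?_
      intro c'' j1 j2 j3 j4 j5 j6
      simp [har] at j1 j2 j3 j4 j5 j6 ⊢
      rw [j2]
      refine ⟨by omega, ⟨by omega, by omega, ?_, ?_⟩, by omega⟩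
      · have : (c'.reg 30 + 1) * (30 * L + 100) = c'.reg 30 * (30 * L + 100) + (30 * L + 100) := by
          ring
        omega
      · exact j4
    · intro hge
      have he : c'.reg 30 = m := by omega
      rw [he] at i4 i3
      rw [T.B_last] at i4
      have hm1 := i4.m_le
      have hm2 := i4.m_le_mul h le_rfl
      refine copyTable_spec hf (m := c'.reg 31) (by simp) hm1 (by omega) ?_
      intro c'' j1 j2 j3 j4 j5 j6 j7
      simp at j1 j2 j3 j4 j5 j6 j7 ⊢
      simp [j1, hr, h0, h3]
      refine ⟨by omega, by omega, ?_⟩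
      refine hQ _ (c'.reg 31) ?_ ?_ (by simp) (by simp) ?_ (by simp; omega) ?_
      · intro x hx hx3 hx4
        have g1 : x ≠ 30 := by omega
        simp (disch := omega) [hx3, hx4, j1, g1, hr]
        simp (disch := omega) [show x ≠ 34 by omega, show x ≠ 31 by omega]
      · intro x hx
        simp (disch := omega) [show x ≠ 8 by omega, j2, har]
      · simp
        refine PartialTable.table h (B' := c'.arr 11) (V' := c''.arr 9) (N' := c''.arr 10)
          (p := c'.reg 32) (q := c'.reg 33) (cnt := c'.reg 34) (m := m) (B := c.arr 8) (N := c.arr 10)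
          ?_ ha ?_ (by simp)
        · exact { i4 with
            V_eq := fun k hk => by rw [j4 k hk]; exact i4.V_eq k hk
            N_eq := fun k hk l hl => by rw [j5 k hk, j5 l hl]; exact i4.N_eq k hk l hl
            N_le := fun k hk => by rw [j5 k hk]; exact i4.N_le k hk
            last := fun hp => by rw [j5 _ (by omega)]; exact i4.last hp }
        · intro k hk
          rw [Function.update_of_ne hk.ne, j3 k hk]
      · simp
        have e1 : m * (30 * L + 100) ≤ a * r * (30 * L + 100) := Nat.mul_le_mul_right _ hm
        have e2 : a * r * (30 * L + 400) = a * r * (30 * L + 100) + 300 * (a * r) := by ring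
        omega

/-- Squares the table until the step length is at least `L ^ 2` or half of `n`. -/
def squareUp : Cmd :=
  .loop (rg 3 /ₑ rg 2 <ₑ rg 2 &ₑ rg 3 <ₑ rg 0 /ₑ ct 2) square

/-- The test `s / L < L` means `s < L ^ 2` but avoids forming `L ^ 2`, which need not fit in a word.
The other test ensures `2 * s ≤ n`. As `s` doubles, the costs form a geometric sum proportional to
the final `s`. -/
theorem squareUp_spec {w K n L : ℕ} (hf : Fits w K n L) {r : ℕ} {F psi lam sym ell : ℕ → ℕ}
    (h : RowSystem n r F psi lam sym ell) {c : Cfg} {Q : Cfg → Prop}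
    (T : Table n r F psi lam 1 r (c.arr 8) (c.arr 9) (c.arr 10))
    (h0 : c.reg 0 = n) (h4 : c.reg 4 = r) (h3 : c.reg 3 = 1) (h2 : c.reg 2 = L)
    (hK : 2 * L ^ 2 * r < K)
    (hQ : ∀ c' s m, (∀ x < 20, x ≠ 3 → x ≠ 4 → c'.reg x = c.reg x) →
      (∀ x, x < 8 ∨ 13 < x → c'.arr x = c.arr x) → c'.reg 4 = m → c'.reg 3 = s →
      Table n r F psi lam s m (c'.arr 8) (c'.arr 9) (c'.arr 10) → 0 < s → s ≤ n → s ≤ 2 * L ^ 2 →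
      (L ^ 2 ≤ s ∨ n ≤ 2 * s + 1) →
      c.t ≤ c'.t → c'.t ≤ c.t + s * (r * (30 * L + 400) + 120) + 20 → Q c') :
    vc w K squareUp Q c := by
  have g3 := hf.two_le_w
  have g4 := hf.lt
  have g5 := hf.two_le
  have hL : 0 < L := by
    rcases Nat.eq_zero_or_pos L with rfl | hL
    · have := hf.lt_two_pow; omega
    · exact hL
  have hL2 : 0 < L ^ 2 := by positivity
  simp only [squareUp, vc]
  refine wp_loop hf.w_pos (fun c' => ∃ s m, c'.reg 4 = m ∧ c'.reg 3 = s ∧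
    Table n r F psi lam s m (c'.arr 8) (c'.arr 9) (c'.arr 10) ∧ 0 < s ∧ s ≤ n ∧ s ≤ 2 * L ^ 2 ∧
    (∀ x < 20, x ≠ 3 → x ≠ 4 → c'.reg x = c.reg x) ∧
    (∀ x, x < 8 ∨ 13 < x → c'.arr x = c.arr x) ∧
    c.t ≤ c'.t ∧ c'.t ≤ c.t + s * (r * (30 * L + 400) + 120)) (fun c' => n - c'.reg 3) ?_ ?_
  · exact ⟨1, r, h4, h3, T, by omega, by omega, by omega, fun _ _ _ _ => rfl, fun _ _ => rfl, le_rfl,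
      by omega⟩
  · rintro c' ⟨s, m, i1, i2, i3, i4, i5, i6, i7, i8, i9, i10⟩ -
    simp [i2, i7, h0, h2]
    refine ⟨by omega, ?_, ?_⟩
    · intro c1 c2
      have c3 : s < L ^ 2 := by
        rw [pow_two]
        exact (Nat.div_lt_iff_lt_mul hL).1 c1
      refine square_spec hf h (a := s) (m := m) i3 (by simp [i7, h0]) (by simp [i1]) (by simp [i2]) i4
        (by omega) ?_ ?_
      · exact (Nat.mul_le_mul_right r (by omega)).trans_lt hK
      · intro c'' m' j1 j2 j3 j4 j5 j6 j7
        simp at j1 j2 j6 j7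
        rw [j4, j3]
        refine ⟨⟨j5, by omega, by omega, by omega, ?_, ?_, by omega, ?_⟩, by omega⟩
        · intro x hx1 hx2 hx3; rw [j1 x hx1 hx2 hx3, i7 x hx1 hx2 hx3]
        · intro x hx; rw [j2 x hx, i8 x hx]
        · have : (s + s) * (r * (30 * L + 400) + 120) =
            s * (r * (30 * L + 400) + 120) + s * r * (30 * L + 400) + s * 120 := by ring
          omega
    · intro hexit
      refine hQ _ s m (by simpa using i7) (by simpa using i8) (by simpa using i1) (by simpa using i2)
        (by simpa using i3) i4 i5 i6 ?_ (by simp; omega) (by simp; omega)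
      by_cases c1 : s / L < L
      · exact .inr (by have := hexit c1; omega)
      · left
        rw [pow_two]
        exact (Nat.le_div_iff_mul_le hL).1 (not_lt.1 c1)

end RunLengthBWT

/-! ### Bit length and stable radix sort. -/

namespace WordRAM

infixl:70 " ≫ₑ " => Expr.op Op.shr

theorem bitLength_spec {w K n L : ℕ} (hf : Fits w K n L) {c : Cfg} {Q : Cfg → Prop}
    (h0 : c.reg 0 = n)
    (hQ : ∀ c', (∀ x, x ≠ 2 → x ≠ 10 → c'.reg x = c.reg x) → c'.arr = c.arr → c'.reg 2 = L →
      c.t ≤ c'.t → c'.t ≤ c.t + 20 * L + 20 → Q c') :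
    vc w K bitLength Q c := by
  have g3 := hf.two_le_w
  have g4 := hf.lt
  have g5 := hf.two_le
  simp only [bitLength, vc]
  simp [h0]
  have huniq : ∀ k l, n < 2 ^ l → 2 ^ k ≤ 2 * n → k ≤ l := by
    intro k l h1 h2
    have : 2 ^ k < 2 ^ (l + 1) := by rw [pow_succ]; omega
    have := (Nat.pow_lt_pow_iff_right (by omega : 1 < 2)).1 this
    omega
  refine wp_loop hf.w_pos (fun c' => c'.reg 10 = n / 2 ^ c'.reg 2 ∧ 2 ^ c'.reg 2 ≤ 2 * n ∧
    c.t ≤ c'.t ∧ c'.t ≤ c.t + 20 * c'.reg 2 + 10) (fun c' => c'.reg 10) ?_ ?_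
  · simp; omega
  · rintro c' ⟨i1, i2, i3, i4⟩ hF
    obtain ⟨hr, har⟩ := hF
    simp at hr har
    have hk := huniq _ L hf.lt_two_pow i2
    have hL : L < 2 ^ L := Nat.lt_two_pow_self
    have := hf.two_pow_le
    simp
    constructor
    · intro hne
      rw [i1] at hne
      have h1 : 2 ^ c'.reg 2 ≤ n := by
        by_contra h1
        exact hne (Nat.div_eq_of_lt (by omega))
      have h2 : c'.reg 2 < 2 ^ c'.reg 2 := Nat.lt_two_pow_self
      refine ⟨by omega, by omega, ⟨?_, ?_, by omega, by omega⟩, by omega⟩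
      · rw [i1, Nat.div_div_eq_div_mul, pow_succ]
      · rw [pow_succ]; omega
    · intro h0
      have h1 : n < 2 ^ c'.reg 2 := by
        rw [i1] at h0
        by_contra h1
        exact absurd h0 (Nat.div_pos (not_lt.1 h1) (by positivity)).ne'
      have h2 := huniq L _ h1 hf.two_pow_le
      refine hQ _ ?_ (funext har) (by simp; omega) (by simp; omega) (by simp; omega)
      intro x h1 h2
      simp [hr, h1, h2]

/-- The first `k` entries of an array. -/
def entries (f : ℕ → ℕ) (k : ℕ) : List ℕ := (List.range k).map f

@[simp] theorem entries_length (f : ℕ → ℕ) (k : ℕ) : (entries f k).length = k := by simp [entries]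

@[simp] theorem entries_zero (f : ℕ → ℕ) : entries f 0 = [] := rfl

theorem entries_succ (f : ℕ → ℕ) (k : ℕ) : entries f (k + 1) = entries f k ++ [f k] := by
  simp [entries, List.range_succ]

theorem entries_update (f : ℕ → ℕ) (k v : ℕ) :
    entries (Function.update f k v) (k + 1) = entries f k ++ [v] := by
  rw [entries_succ, Function.update_self]
  congr 1
  refine List.map_congr_left fun i hi => ?_
  rw [Function.update_of_ne (by have := List.mem_range.1 hi; omega)]

theorem entries_sublist (f : ℕ → ℕ) {k l : ℕ} (h : k ≤ l) :
    (entries f k).Sublist (entries f l) :=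
  ((List.range_sublist).2 h).map f

theorem entries_mem (f : ℕ → ℕ) {i k : ℕ} (h : i < k) : f i ∈ entries f k :=
  List.mem_map_of_mem (List.mem_range.2 h)

/-- Appends to the array `5` those entries `x` of the array `4` for which bit number `reg 11` of
the key `x` in the array `1` is `v`. -/
def appendBit (v : ℕ) : Cmd :=
  10 ≔ ct 0 ;;
  .loop (rg 10 <ₑ rg 1)
    (.load 14 4 (rg 10) ;; .load 15 1 (rg 14) ;;
    .cond (rg 15 ≫ₑ rg 11 %ₑ ct 2 =ₑ ct v) (.store 5 (rg 12) (rg 14) ;; 12 ≔ rg 12 +ₑ ct 1) .skip ;;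
    10 ≔ rg 10 +ₑ ct 1)

theorem appendBit_spec {w K n L : ℕ} (hf : Fits w K n L) {r v : ℕ} {pre : List ℕ} {c : Cfg}
    {Q : Cfg → Prop} (h1 : c.reg 1 = r) (hrn : r ≤ n) (hrK : r < K) (hv : v < 2)
    (hlt : ∀ i < r, c.arr 4 i < r) (hpre : entries (c.arr 5) (c.reg 12) = pre)
    (hlen : pre.length + ((entries (c.arr 4) r).filter
      (fun x => c.arr 1 x / 2 ^ c.reg 11 % 2 = v)).length ≤ r)
    (hQ : ∀ c', (∀ x, x < 10 ∨ 15 < x ∨ x = 11 → c'.reg x = c.reg x) →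
      (∀ x, x ≠ 5 → c'.arr x = c.arr x) →
      entries (c'.arr 5) (c'.reg 12) = pre ++ (entries (c.arr 4) r).filter
        (fun x => c.arr 1 x / 2 ^ c.reg 11 % 2 = v) →
      c.t ≤ c'.t → c'.t ≤ c.t + 40 * r + 20 → Q c') :
    vc w K (appendBit v) Q c := by
  have g3 := hf.two_le_w
  have g4 := hf.lt
  have g5 := hf.two_le
  simp only [appendBit, vc]
  simp
  refine wp_loop hf.w_pos (fun c' => c'.reg 10 ≤ r ∧
    entries (c'.arr 5) (c'.reg 12) = pre ++ (entries (c.arr 4) (c'.reg 10)).filter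
        (fun x => c.arr 1 x / 2 ^ c.reg 11 % 2 = v) ∧
    c.t ≤ c'.t ∧ c'.t ≤ c.t + 40 * c'.reg 10 + 10) (fun c' => r - c'.reg 10) ?_ ?_
  · simp [hpre]
  · rintro c' ⟨i1, i2, i3, i4⟩ hF
    obtain ⟨hr, har⟩ := hF
    simp at hr har
    simp [hr, har, h1]
    constructor
    · intro hi
      have hx := hlt _ hi
      have hlen' := congrArg List.length i2
      simp only [entries_length, List.length_append] at hlen'
      have hsub := ((entries_sublist (c.arr 4) (Nat.succ_le_of_lt hi)).filter
        (fun x => decide (c.arr 1 x / 2 ^ c.reg 11 % 2 = v))).length_le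
      rw [Nat.succ_eq_add_one, entries_succ (c.arr 4)] at hsub
      rw [entries_succ (c.arr 4)]
      simp only [List.filter_append, List.filter_cons, List.filter_nil] at hsub ⊢
      refine ⟨by omega, by omega, by omega, ?_, ?_⟩
      · intro hb
        simp only [hb, if_true, decide_true] at hsub ⊢
        rw [List.length_append] at hsub
        simp only [List.length_cons, List.length_nil] at hsub
        refine ⟨by omega, by omega, by omega, ⟨by omega, ?_, by omega, by omega⟩, by omega⟩
        rw [entries_update, i2]
        simp
      · intro hb
        simp only [hb, decide_false]
        refine ⟨by omega, ⟨by omega, ?_, by omega, by omega⟩, by omega⟩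
        rw [i2]; simp
    · intro hge
      have he : c'.reg 10 = r := by omega
      rw [he] at i2 i4
      refine hQ _ ?_ ?_ i2 (by simp; omega) (by simp; omega)
      · intro x hx
        have h10 : x ≠ 10 := by omega
        simp (disch := omega) [hr, h10]
      · intro x hx; simp [har, hx]

/-- Copies the array `5` to the array `4`. -/
def copyBack : Cmd :=
  10 ≔ ct 0 ;;
  .loop (rg 10 <ₑ rg 1) (.load 14 5 (rg 10) ;; .store 4 (rg 10) (rg 14) ;; 10 ≔ rg 10 +ₑ ct 1)

theorem copyBack_spec {w K n L : ℕ} (hf : Fits w K n L) {r : ℕ} {c : Cfg}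
    {Q : Cfg → Prop} (h1 : c.reg 1 = r) (hrn : r ≤ n) (hrK : r < K)
    (hQ : ∀ c', (∀ x, x ≠ 10 → x ≠ 14 → c'.reg x = c.reg x) →
      (∀ x, x ≠ 4 → c'.arr x = c.arr x) → entries (c'.arr 4) r = entries (c.arr 5) r →
      c.t ≤ c'.t → c'.t ≤ c.t + 40 * r + 20 → Q c') :
    vc w K copyBack Q c := by
  have g3 := hf.two_le_w
  have g4 := hf.lt
  simp only [copyBack, vc]
  simp
  refine wp_loop hf.w_pos (fun c' => c'.reg 10 ≤ r ∧
    entries (c'.arr 4) (c'.reg 10) = entries (c.arr 5) (c'.reg 10) ∧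
    c.t ≤ c'.t ∧ c'.t ≤ c.t + 40 * c'.reg 10 + 10) (fun c' => r - c'.reg 10) ?_ ?_
  · simp
  · rintro c' ⟨i1, i2, i3, i4⟩ hF
    obtain ⟨hr, har⟩ := hF
    simp at hr har
    simp [hr, har, h1]
    constructor
    · intro hi
      refine ⟨by omega, by omega, ⟨by omega, ?_, by omega, by omega⟩, by omega⟩
      rw [entries_update, entries_succ, i2]
    · intro hge
      have he : c'.reg 10 = r := by omega
      rw [he] at i2 i4
      refine hQ _ ?_ ?_ i2 (by simp; omega) (by simp; omega)
      · intro x hx hx'; simp [hr, hx, hx']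
      · intro x hx; simp [har, hx]

/-- Register `10` counts up to `r` and the array `4` gets the numbers below `r`. -/
def initOrder : Cmd :=
  10 ≔ ct 0 ;; .loop (rg 10 <ₑ rg 1) (.store 4 (rg 10) (rg 10) ;; 10 ≔ rg 10 +ₑ ct 1)

theorem initOrder_spec {w K n L : ℕ} (hf : Fits w K n L) {r : ℕ} {c : Cfg}
    {Q : Cfg → Prop} (h1 : c.reg 1 = r) (hrn : r ≤ n) (hrK : r < K)
    (hQ : ∀ c', (∀ x, x ≠ 10 → c'.reg x = c.reg x) →
      (∀ x, x ≠ 4 → c'.arr x = c.arr x) → entries (c'.arr 4) r = List.range r →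
      c.t ≤ c'.t → c'.t ≤ c.t + 40 * r + 20 → Q c') :
    vc w K initOrder Q c := by
  have g3 := hf.two_le_w
  have g4 := hf.lt
  simp only [initOrder, vc]
  simp
  refine wp_loop hf.w_pos (fun c' => c'.reg 10 ≤ r ∧
    entries (c'.arr 4) (c'.reg 10) = List.range (c'.reg 10) ∧
    c.t ≤ c'.t ∧ c'.t ≤ c.t + 40 * c'.reg 10 + 10) (fun c' => r - c'.reg 10) ?_ ?_
  · simp
  · rintro c' ⟨i1, i2, i3, i4⟩ hF
    obtain ⟨hr, har⟩ := hF
    simp at hr har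
    simp [hr, h1]
    constructor
    · intro hi
      refine ⟨by omega, by omega, ⟨by omega, ?_, by omega, by omega⟩, by omega⟩
      rw [entries_update, i2, List.range_succ]
    · intro hge
      have he : c'.reg 10 = r := by omega
      rw [he] at i2 i4
      refine hQ _ ?_ ?_ i2 (by simp; omega) (by simp; omega)
      · intro x hx; simp [hr, hx]
      · intro x hx; simp [har, hx]

/-- Radix sort: the array `4` gets the numbers below `r`, sorted stably by the keys in the
array `1`. -/
def radixSort : Cmd :=
  initOrder ;; 11 ≔ ct 0 ;;
  .loop (rg 11 <ₑ rg 2)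
    (12 ≔ ct 0 ;; appendBit 0 ;; appendBit 1 ;; copyBack ;; 11 ≔ rg 11 +ₑ ct 1)

/-- The order a stable radix sort has established after `b` rounds: by the low `b` bits of the key,
ties being broken by index. -/
def KeyLT (key : ℕ → ℕ) (b x y : ℕ) : Prop :=
  key x % 2 ^ b < key y % 2 ^ b ∨ key x % 2 ^ b = key y % 2 ^ b ∧ x < y

theorem keyLT_succ {key : ℕ → ℕ} {b x y : ℕ} :
    KeyLT key (b + 1) x y ↔ key x / 2 ^ b % 2 < key y / 2 ^ b % 2 ∨
      key x / 2 ^ b % 2 = key y / 2 ^ b % 2 ∧ KeyLT key b x y := by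
  have h : ∀ z, key z % 2 ^ (b + 1) = key z % 2 ^ b + 2 ^ b * (key z / 2 ^ b % 2) :=
    fun z => Nat.mod_pow_succ
  have h0 : 0 < 2 ^ b := by positivity
  have hx := Nat.mod_lt (key x) h0
  have hy := Nat.mod_lt (key y) h0
  unfold KeyLT
  rw [h, h]
  generalize key x % 2 ^ b = u at *
  generalize key y % 2 ^ b = v at *
  generalize 2 ^ b = m at *
  rcases Nat.mod_two_eq_zero_or_one (key x / m) with h1 | h1 <;>
    rcases Nat.mod_two_eq_zero_or_one (key y / m) with h2 | h2 <;>
    simp [h1, h2] <;> omega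

/-- The new bit is the most significant one so far, and filtering keeps the previous order among
elements with the same bit. -/
theorem pairwise_bit {key : ℕ → ℕ} {b : ℕ} {l : List ℕ} (hl : l.Pairwise (KeyLT key b)) :
    (l.filter (fun x => key x / 2 ^ b % 2 = 0) ++
      l.filter (fun x => key x / 2 ^ b % 2 = 1)).Pairwise (KeyLT key (b + 1)) := by
  have h : ∀ v, (l.filter (fun x => decide (key x / 2 ^ b % 2 = v))).Pairwise
      (KeyLT key (b + 1)) := by
    intro v
    refine (hl.filter _).imp_of_mem ?_
    intro x y hx hy hxy
    have hx := (List.mem_filter.1 hx).2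
    have hy := (List.mem_filter.1 hy).2
    simp only [decide_eq_true_eq] at hx hy
    exact keyLT_succ.2 (.inr ⟨by omega, hxy⟩)
  refine List.pairwise_append.2 ⟨h 0, h 1, fun x hx y hy => ?_⟩
  have hx := (List.mem_filter.1 hx).2
  have hy := (List.mem_filter.1 hy).2
  simp only [decide_eq_true_eq] at hx hy
  exact keyLT_succ.2 (.inl (by omega))

theorem perm_bit (key : ℕ → ℕ) (b : ℕ) (l : List ℕ) :
    (l.filter (fun x => key x / 2 ^ b % 2 = 0) ++
      l.filter (fun x => key x / 2 ^ b % 2 = 1)).Perm l := by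
  have h : (fun x => decide (key x / 2 ^ b % 2 = 1)) =
      fun x => !decide (key x / 2 ^ b % 2 = 0) := by
    funext x
    rcases Nat.mod_two_eq_zero_or_one (key x / 2 ^ b) with h1 | h1 <;> simp [h1]
  rw [h]
  exact List.filter_append_perm _ l

theorem radixSort_spec {w K n L : ℕ} (hf : Fits w K n L) {r : ℕ} {c : Cfg}
    {Q : Cfg → Prop} (h1 : c.reg 1 = r) (h2 : c.reg 2 = L) (hrn : r ≤ n) (hrK : r < K)
    (hkey : ∀ k < r, c.arr 1 k ≤ n)
    (hQ : ∀ c', (∀ x, x < 10 → c'.reg x = c.reg x) →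
      (∀ x, x ≠ 4 → x ≠ 5 → c'.arr x = c.arr x) →
      (∀ k < r, c'.arr 4 k < r) → (∀ j < r, ∃ k < r, c'.arr 4 k = j) →
      (∀ k l, k < l → l < r → c.arr 1 (c'.arr 4 k) < c.arr 1 (c'.arr 4 l) ∨
        c.arr 1 (c'.arr 4 k) = c.arr 1 (c'.arr 4 l) ∧ c'.arr 4 k < c'.arr 4 l) →
      c.t ≤ c'.t → c'.t ≤ c.t + (L + 1) * (120 * r + 100) → Q c') :
    vc w K radixSort Q c := by
  have g3 := hf.two_le_w
  have g4 := hf.lt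
  -- The round counter must reach `L` without overflow; for `L ≥ 2` this follows from `2 * L ≤ 2 ^ L
  -- ≤ 2 * n`.
  have hLn : L < 2 ^ w := by
    have h1 : L < 2 ^ L := Nat.lt_two_pow_self
    have h2 := hf.two_pow_le
    rcases Nat.lt_or_ge L 2 with h3 | h3
    · have := hf.two_le; omega
    · have h4 : ∀ m, 2 ≤ m → 2 * m ≤ 2 ^ m := by
        intro m hm
        induction m, hm using Nat.le_induction with
        | base => norm_num
        | succ m hm ih => rw [pow_succ]; omega
      have := h4 L h3
      omega
  simp only [radixSort, vc]
  refine initOrder_spec hf h1 hrn hrK ?_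
  intro c₁ a1 a2 a3 a4 a5
  simp
  refine wp_loop hf.w_pos (fun c' => c'.reg 11 ≤ L ∧ (entries (c'.arr 4) r).Perm (List.range r) ∧
    (entries (c'.arr 4) r).Pairwise (KeyLT (c.arr 1) (c'.reg 11)) ∧ c.t ≤ c'.t ∧
    c'.t ≤ c.t + 40 * r + 30 + c'.reg 11 * (120 * r + 100)) (fun c' => L - c'.reg 11) ?_ ?_
  · simp [a3]
    exact ⟨List.pairwise_lt_range.imp fun h => by simp [KeyLT, Nat.mod_one, h], by omega⟩
  · rintro c' ⟨i1, i2, i3, i4, i5⟩ hF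
    obtain ⟨hr, har⟩ := hF
    simp [appendBit, copyBack] at hr har
    simp [hr, a1, h2]
    have hlt : ∀ i < r, c'.arr 4 i < r := fun i hi =>
      List.mem_range.1 (i2.subset (entries_mem _ hi))
    constructor
    · intro hi
      have hp := perm_bit (c.arr 1) (c'.reg 11) (entries (c'.arr 4) r)
      have hlen := hp.length_eq
      rw [List.length_append, entries_length] at hlen
      refine appendBit_spec hf (r := r) (pre := []) (by simp [hr, a1, h1]) hrn hrK (by omega)
        (by simpa using hlt) (by simp) (by simp [har, a2]; omega) ?_
      intro c₂ b1 b2 b3 b4 b5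
      simp [har, a2] at b1 b2 b3 b4 b5 ⊢
      refine appendBit_spec hf (r := r) (by simp [b1, hr, a1, h1]) hrn hrK (by omega)
        (by simpa [b2] using hlt) b3 (by simp [b1, b2, har, a2]; omega) ?_
      intro c₃ d1 d2 d3 d4 d5
      simp [b1, b2, har, a2] at d1 d2 d3 d4 d5 ⊢
      refine copyBack_spec hf (r := r) (by simp [d1, b1, hr, a1, h1]) hrn hrK ?_
      intro c₄ e1 e2 e3 e4 e5
      have hl3 := congrArg List.length d3
      rw [List.length_append, entries_length, hlen] at hl3
      rw [hl3] at d3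
      rw [d3] at e3
      simp [e1, d1, b1]
      refine ⟨by omega, ⟨by omega, ?_, ?_, by omega, ?_⟩, by omega⟩
      · rw [e3]; exact hp.trans i2
      · rw [e3]; exact pairwise_bit i3
      · have : (c'.reg 11 + 1) * (120 * r + 100) = c'.reg 11 * (120 * r + 100) + (120 * r + 100) := by
          ring
        omega
    · intro hge
      have he : c'.reg 11 = L := by omega
      rw [he] at i3 i5
      refine hQ _ ?_ ?_ hlt ?_ ?_ (by simp; omega) ?_
      · intro x hx
        simp (disch := omega) [hr, show x ≠ 11 by omega, a1]
      · intro x h4 h5; simp [har, h4, h5, a2]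
      · intro j hj
        have := i2.symm.subset (List.mem_range.2 hj)
        simpa [entries] using this
      · intro k l hkl hl
        have h3 := List.pairwise_iff_getElem.1 i3 k l (by simp; omega) (by simpa using hl) hkl
        simp only [entries, List.getElem_map, List.getElem_range, KeyLT] at h3
        -- Keys are at most `n < 2 ^ L`, so after `L` rounds the entire key has been taken into
        -- account.
        have hm : ∀ k < r, c.arr 1 (c'.arr 4 k) % 2 ^ L = c.arr 1 (c'.arr 4 k) := fun k hk =>
          Nat.mod_eq_of_lt ((hkey _ (hlt k hk)).trans_lt hf.lt_two_pow)
        rw [hm k (by omega), hm l hl] at h3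
        exact h3
      · have : (L + 1) * (120 * r + 100) = L * (120 * r + 100) + (120 * r + 100) := by ring
        simp
        omega

end WordRAM

/-! ### The table of `psi` from the sorted runs. -/

namespace RunLengthBWT
open WordRAM

/-- The start of the `k`-th run after the runs have been sorted. -/
def sortedStart (lam P : ℕ → ℕ) (k : ℕ) : ℕ := ∑ i ∈ Finset.range k, (lam (P i + 1) - lam (P i))

theorem sortedStart_succ (lam P : ℕ → ℕ) (k : ℕ) :
    sortedStart lam P (k + 1) = sortedStart lam P k + (lam (P k + 1) - lam (P k)) :=
  Finset.sum_range_succ _ _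

/-- The numbers below `r` sorted by the symbols of the runs. -/
structure IsRunOrder (r : ℕ) (sym P : ℕ → ℕ) : Prop where
  lt : ∀ k < r, P k < r
  surj : ∀ j < r, ∃ k < r, P k = j
  sorted : ∀ k l, k < l → l < r → sym (P k) < sym (P l) ∨ sym (P k) = sym (P l) ∧ P k < P l

theorem IsRunOrder.psi_eq {n r : ℕ} {F psi lam sym ell : ℕ → ℕ}
    (h : RowSystem n r F psi lam sym ell) {P : ℕ → ℕ} (hP : IsRunOrder r sym P) :
    sortedStart lam P r = n ∧ ∀ k < r, ∀ d, d < lam (P k + 1) - lam (P k) →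
      sortedStart lam P k + d < n ∧ psi (sortedStart lam P k + d) = lam (P k) + d :=
  h.psi_of_sorted hP.lt hP.surj hP.sorted (by simp [sortedStart])
    fun k _ => sortedStart_succ lam P k

/-- The pieces of `psi` itself correspond to the runs in sorted order. Prefixes of length one are
single symbols, so the run symbols serve as names. -/
theorem IsRunOrder.table {n r : ℕ} {F psi lam sym ell : ℕ → ℕ}
    (h : RowSystem n r F psi lam sym ell) {P B V N : ℕ → ℕ} (hP : IsRunOrder r sym P)
    (hB : ∀ k < r, B k = sortedStart lam P k) (hn : B r = n) (hV : ∀ k < r, V k = lam (P k))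
    (hN : ∀ k < r, N k = sym (P k)) : Table n r F psi lam 1 r B V N := by
  obtain ⟨h1, h2⟩ := hP.psi_eq h
  have hB' : ∀ k ≤ r, B k = sortedStart lam P k := by
    intro k hk
    rcases hk.lt_or_eq with hk | rfl
    · exact hB k hk
    · rw [hn, h1]
  have h3 : ∀ k < r, lam (P k) < lam (P k + 1) := fun k hk => h.lam_lt _ (hP.lt k hk)
  have h4 : ∀ k < r, B k < n ∧ psi (B k) = lam (P k) := by
    intro k hk
    have := h2 k hk 0 (by have := h3 k hk; omega)
    rwa [add_zero, add_zero, ← hB k hk] at this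
  have hF : ∀ k < r, F (B k) = sym (P k) := by
    intro k hk
    have := h4 k hk
    exact h.F_run _ (hP.lt k hk) _ this.1 (by omega) (by have := h3 k hk; omega)
  constructor
  · exact h.r_pos
  · rw [hB 0 h.r_pos]; simp [sortedStart]
  · exact hn
  · intro k hk
    rw [hB' k hk.le, hB' (k + 1) hk, sortedStart_succ]
    have := h3 k hk
    omega
  · intro k hk
    exact ⟨0, by omega, P k, hP.lt k hk, (h4 k hk).2⟩
  · rintro x hx ⟨u, hu, j, hj, h5⟩
    obtain rfl : u = 0 := by omega
    obtain ⟨k, hk, rfl⟩ := hP.surj j hj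
    exact ⟨k, hk, h.psi_inj _ (h4 k hk).1 _ hx ((h4 k hk).2.trans h5.symm)⟩
  · intro k hk
    rw [hV k hk, Function.iterate_one, (h4 k hk).2]
  · intro k hk l hl
    rw [hN k hk, hN l hl, ← hF k hk, ← hF l hl]
    refine ⟨fun h' u hu => ?_, fun h' => h' 0 (by omega)⟩
    obtain rfl : u = 0 := by omega
    exact h'

/-- Stores the table of `psi`, once in the arrays `6`, `7`, `18` and once in `8`, `9`, `10`. -/
def buildTable : Cmd :=
  10 ≔ ct 0 ;; 11 ≔ ct 0 ;;
  .loop (rg 10 <ₑ rg 1)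
    (.load 12 4 (rg 10) ;; .load 13 0 (rg 12) ;; .load 14 1 (rg 12) ;; 13 ≔ rg 13 -ₑ ct 1 ;;
    .store 6 (rg 10) (rg 11) ;; .store 7 (rg 10) (rg 13) ;; .store 18 (rg 10) (rg 14) ;;
    .store 8 (rg 10) (rg 11) ;; .store 9 (rg 10) (rg 13) ;; .store 10 (rg 10) (rg 14) ;;
    .cond (rg 12 +ₑ ct 1 <ₑ rg 1) (.load 15 0 (rg 12 +ₑ ct 1) ;; 15 ≔ rg 15 -ₑ ct 1) (15 ≔ rg 0) ;;
    11 ≔ rg 11 +ₑ (rg 15 -ₑ rg 13) ;; 10 ≔ rg 10 +ₑ ct 1) ;;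
  .store 6 (rg 10) (rg 0) ;; .store 8 (rg 10) (rg 0) ;; 3 ≔ ct 1 ;; 4 ≔ rg 1

/-- Of the two copies, one will be squared and the other remains for single steps. Run starts are
given counted from `1`, hence the subtraction; the last run has no successor and ends at `n`. -/
theorem buildTable_spec {w K n L : ℕ} (hf : Fits w K n L) {r : ℕ} {F psi lam sym ell : ℕ → ℕ}
    (h : RowSystem n r F psi lam sym ell) {c : Cfg} {Q : Cfg → Prop}
    (h0 : c.reg 0 = n) (h1 : c.reg 1 = r) (hlam : ∀ k < r, c.arr 0 k = lam k + 1)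
    (hsym : ∀ k < r, c.arr 1 k = sym k) (hP : IsRunOrder r sym (c.arr 4)) (hrK : r < K)
    (hQ : ∀ c', (∀ x < 3, c'.reg x = c.reg x) →
      (∀ x < 6, c'.arr x = c.arr x) → (∀ x, 10 < x → x ≠ 18 → c'.arr x = c.arr x) →
      c'.reg 3 = 1 → c'.reg 4 = r →
      Table n r F psi lam 1 r (c'.arr 6) (c'.arr 7) (c'.arr 18) →
      Table n r F psi lam 1 r (c'.arr 8) (c'.arr 9) (c'.arr 10) →
      (∀ k < r, c'.arr 7 k = lam (c.arr 4 k)) →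
      (∀ k < r, c'.arr 6 (k + 1) = c'.arr 6 k + (lam (c.arr 4 k + 1) - lam (c.arr 4 k))) →
      c.t ≤ c'.t → c'.t ≤ c.t + 100 * r + 30 → Q c') :
    vc w K buildTable Q c := by
  have g3 := hf.two_le_w
  have g4 := hf.lt
  have hrn := h.r_le
  obtain ⟨e1, e2⟩ := hP.psi_eq h
  set P := c.arr 4 with hPdef
  simp only [buildTable, vc]
  simp
  refine wp_loop hf.w_pos (fun c' => c'.reg 10 ≤ r ∧ c'.reg 11 = sortedStart lam P (c'.reg 10) ∧
    (∀ k < c'.reg 10, c'.arr 6 k = sortedStart lam P k ∧ c'.arr 7 k = lam (P k) ∧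
      c'.arr 18 k = sym (P k) ∧ c'.arr 8 k = sortedStart lam P k ∧ c'.arr 9 k = lam (P k) ∧
      c'.arr 10 k = sym (P k)) ∧
    c.t ≤ c'.t ∧ c'.t ≤ c.t + 100 * c'.reg 10 + 10) (fun c' => r - c'.reg 10) ?_ ?_
  · simp [sortedStart]; omega
  · rintro c' ⟨i1, i2, i3, i4, i5⟩ hF
    obtain ⟨hr, har⟩ := hF
    simp at hr har
    simp [hr, har, h0, h1]
    rw [← hPdef]
    constructor
    · intro hlt
      have hk := hP.lt _ hlt
      have h5 := h.lam_lt _ hk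
      have h6 := e2 _ hlt (lam (P (c'.reg 10) + 1) - lam (P (c'.reg 10)) - 1) (by omega)
      have h7 := h.lam_mono (show P (c'.reg 10) + 1 ≤ r from hk) le_rfl
      rw [h.lam_last] at h7
      have h8 := sortedStart_succ lam P (c'.reg 10)
      rw [hlam _ hk, hsym _ hk]
      have hstep : ∀ k < c'.reg 10 + 1, ∀ X v : ℕ → ℕ, (∀ k < c'.reg 10, X k = v k) →
          Function.update X (c'.reg 10) (v (c'.reg 10)) k = v k := by
        intro k hk' X v hX
        rcases (Nat.lt_succ_iff.1 hk').lt_or_eq with hk' | rfl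
        · rw [Function.update_of_ne hk'.ne, hX k hk']
        · simp
      refine ⟨by omega, by omega, by omega, by omega, by omega, ?_, ?_⟩
      · intro hlt'
        rw [hlam _ hlt', i2]
        refine ⟨by omega, by omega, by omega, by omega, ⟨by omega, by omega, ?_, by omega, by omega⟩, by omega⟩
        intro k hk'
        refine ⟨?_, ?_, ?_, ?_, ?_, ?_⟩
        · exact hstep k (by omega) _ _ fun k hk => (i3 k hk).1
        · exact hstep k (by omega) _ (fun k => lam (P k)) fun k hk => (i3 k hk).2.1
        · exact hstep k (by omega) _ (fun k => sym (P k)) fun k hk => (i3 k hk).2.2.1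
        · exact hstep k (by omega) _ _ fun k hk => (i3 k hk).2.2.2.1
        · exact hstep k (by omega) _ (fun k => lam (P k)) fun k hk => (i3 k hk).2.2.2.2.1
        · exact hstep k (by omega) _ (fun k => sym (P k)) fun k hk => (i3 k hk).2.2.2.2.2
      · intro hge
        have h9 : lam (P (c'.reg 10) + 1) = n := by
          rw [show P (c'.reg 10) + 1 = r by omega, h.lam_last]
        rw [i2]
        refine ⟨by omega, by omega, ⟨by omega, by omega, ?_, by omega, by omega⟩, by omega⟩
        intro k hk'
        refine ⟨?_, ?_, ?_, ?_, ?_, ?_⟩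
        · exact hstep k (by omega) _ _ fun k hk => (i3 k hk).1
        · exact hstep k (by omega) _ (fun k => lam (P k)) fun k hk => (i3 k hk).2.1
        · exact hstep k (by omega) _ (fun k => sym (P k)) fun k hk => (i3 k hk).2.2.1
        · exact hstep k (by omega) _ _ fun k hk => (i3 k hk).2.2.2.1
        · exact hstep k (by omega) _ (fun k => lam (P k)) fun k hk => (i3 k hk).2.2.2.2.1
        · exact hstep k (by omega) _ (fun k => sym (P k)) fun k hk => (i3 k hk).2.2.2.2.2
    · intro hge
      have he : c'.reg 10 = r := by omega
      rw [he] at i3 i5 ⊢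
      refine ⟨hrK, by omega, ?_⟩
      refine hQ _ ?_ ?_ ?_ (by simp) (by simp) ?_ ?_ ?_ ?_ (by simp; omega) (by simp; omega)
      · intro x hx
        simp (disch := omega) [show x ≠ 4 by omega, show x ≠ 3 by omega, hr]
        simp (disch := omega) [show x ≠ 10 by omega, show x ≠ 11 by omega]
      · intro x hx
        simp (disch := omega) [show x ≠ 8 by omega, show x ≠ 6 by omega, har]
      · intro x hx hx'
        simp (disch := omega) [show x ≠ 8 by omega, show x ≠ 6 by omega, har]
      · refine hP.table h ?_ (by simp) ?_ ?_
        · intro k hk; simp [Function.update_of_ne hk.ne, i3 k hk]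
        · intro k hk; simp [i3 k hk]
        · intro k hk; simp [i3 k hk]
      · refine hP.table h ?_ (by simp) ?_ ?_
        · intro k hk; simp [Function.update_of_ne hk.ne, i3 k hk]
        · intro k hk; simp [i3 k hk]
        · intro k hk; simp [i3 k hk]
      · intro k hk; simp [i3 k hk]
      · intro k hk
        have e3 : ∀ k ≤ r, Function.update (c'.arr 6) r n k = sortedStart lam P k := by
          intro k hk
          rcases hk.lt_or_eq with hk | rfl
          · rw [Function.update_of_ne hk.ne, (i3 k hk).1]
          · rw [Function.update_self, e1]
        simp [e3 k hk.le, e3 (k + 1) hk, sortedStart_succ]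

end RunLengthBWT

/-! ### The walk through the text: sampled rows, starts and ends of runs. -/

namespace RunLengthBWT
open WordRAM

/-- The counting bound for breaks indexed by a finite set; it bounds both the recorded starts and
the blocks to be traversed. -/
theorem RowSystem.card_le {n r : ℕ} {F psi lam sym ell : ℕ → ℕ}
    (h : RowSystem n r F psi lam sym ell) {a : ℕ} {S : Finset ℕ} {f : ℕ → ℕ}
    (hS : ∀ x ∈ S, f x < n ∧ Break r psi lam a (f x)) (hinj : Set.InjOn f S) : S.card ≤ a * r := by
  have := h.le_of_break (a := a) (m := S.card)
    (B := fun k => if hk : k < S.card then f (S.equivFin.symm ⟨k, hk⟩) else 0) ?_ ?_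
  · exact this
  · intro k hk
    simp only [hk, dif_pos]
    exact hS _ (S.equivFin.symm ⟨k, hk⟩).2
  · intro k hk l hl hkl
    simp only [hk, hl, dif_pos] at hkl
    have h1 := hinj (S.equivFin.symm ⟨k, hk⟩).2 (S.equivFin.symm ⟨l, hl⟩).2 hkl
    have h2 := S.equivFin.symm.injective (Subtype.ext h1)
    simpa using h2

/-- The table of `psi` together with the order `P` of the runs. -/
structure BaseTable (n r : ℕ) (F psi lam : ℕ → ℕ) (B V N P : ℕ → ℕ) : Prop where
  table : Table n r F psi lam 1 r B V N
  lt : ∀ k < r, P k < r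
  V_eq : ∀ k < r, V k = lam (P k)
  len : ∀ k < r, B (k + 1) = B k + (lam (P k + 1) - lam (P k))

theorem BaseTable.psi_eq {n r : ℕ} {F psi lam sym ell : ℕ → ℕ} {B V N P : ℕ → ℕ}
    (T : BaseTable n r F psi lam B V N P) (h : RowSystem n r F psi lam sym ell) {k x : ℕ} (hk : k < r)
    (h1 : B k ≤ x) (h2 : x < B (k + 1)) :
    psi x = lam (P k) + (x - B k) ∧ psi x < lam (P k + 1) := by
  have h3 := (T.table.apply h hk h1 h2).1
  rw [Function.iterate_one, T.V_eq k hk] at h3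
  have h4 := T.len k hk
  have h5 := h.lam_lt _ (T.lt k hk)
  omega

theorem BaseTable.start_iff {n r : ℕ} {F psi lam sym ell : ℕ → ℕ} {B V N P : ℕ → ℕ}
    (T : BaseTable n r F psi lam B V N P) (h : RowSystem n r F psi lam sym ell) {k x : ℕ} (hk : k < r)
    (h1 : B k ≤ x) (h2 : x < B (k + 1)) : Start r psi lam x ↔ x = B k := by
  constructor
  · intro hs
    by_contra hne
    exact T.table.not_break hk (by omega) h2 ⟨0, by omega, hs⟩
  · rintro rfl
    have := (T.psi_eq h hk h1 h2).1
    exact ⟨P k, T.lt k hk, by omega⟩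

theorem BaseTable.end_iff {n r : ℕ} {F psi lam sym ell : ℕ → ℕ} {B V N P : ℕ → ℕ}
    (T : BaseTable n r F psi lam B V N P) (h : RowSystem n r F psi lam sym ell) {k x j : ℕ} (hk : k < r)
    (h1 : B k ≤ x) (h2 : x < B (k + 1)) (hj : j < r) :
    psi x + 1 = lam (j + 1) ↔ x + 1 = B (k + 1) ∧ P k = j := by
  obtain ⟨h3, h4⟩ := T.psi_eq h hk h1 h2
  have h5 := T.len k hk
  have h6 := T.lt k hk
  constructor
  · intro he
    have h7 : P k = j := by
      rcases lt_trichotomy (P k) j with h8 | h8 | h8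
      · have := h.lam_mono (show P k + 1 ≤ j from h8) hj.le
        have := h.lam_lt j hj
        omega
      · exact h8
      · have := h.lam_mono (show j + 1 ≤ P k from h8) h6.le; omega
    rw [h7] at h3 h5
    omega
  · rintro ⟨h7, rfl⟩
    omega

/-- If the end of a run is met within `a` steps from `x`, then `x` is the last row of its piece. -/
theorem RowSystem.break_of_end {n r : ℕ} {F psi lam sym ell : ℕ → ℕ}
    (h : RowSystem n r F psi lam sym ell) {a x u j : ℕ} (hx : x + 1 < n) (hu : u < a) (hj : j < r)
    (he : psi (psi^[u] x) + 1 = lam (j + 1)) : Break r psi lam a (x + 1) := by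
  by_contra hb
  have h1 : ¬ Break r psi lam u (x + 1) := fun ⟨v, hv, h'⟩ => hb ⟨v, by omega, h'⟩
  have h2 := (h.not_break_succ hx h1).1
  have h3 : ¬ Start r psi lam (psi^[u] x + 1) := fun h' => hb ⟨u, hu, by rw [h2]; exact h'⟩
  have h4 := h.iter_lt u _ hx
  rw [h2] at h4
  have h5 := (h.not_start_succ h4 h3).1
  have h6 := h.psi_lt _ h4
  rcases (Nat.succ_le_of_lt hj).lt_or_eq with h7 | h7
  · exact h3 ⟨j + 1, h7, by omega⟩
  · have := h.lam_last
    rw [← h7] at this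
    simp only [Nat.succ_eq_add_one] at this
    omega

open Classical in
/-- The text positions `j ≤ t` whose rows are starts of runs. -/
noncomputable def startPositions (r : ℕ) (psi lam : ℕ → ℕ) (t : ℕ) : List ℕ :=
  ((List.range t).filter (fun u => decide (Start r psi lam (psi^[u] 0)))).map (· + 1)

section startPositions
variable {r : ℕ} {psi lam : ℕ → ℕ}

theorem startPositions_succ_of {t : ℕ} (h : Start r psi lam (psi^[t] 0)) :
    startPositions r psi lam (t + 1) = startPositions r psi lam t ++ [t + 1] := by
  simp [startPositions, List.range_succ, h]

theorem startPositions_succ_of_not {t : ℕ} (h : ¬ Start r psi lam (psi^[t] 0)) :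
    startPositions r psi lam (t + 1) = startPositions r psi lam t := by
  simp [startPositions, List.range_succ, h]

theorem startPositions_eq_of_not {t t' : ℕ} (ht : t ≤ t')
    (h : ∀ u, t ≤ u → u < t' → ¬ Start r psi lam (psi^[u] 0)) :
    startPositions r psi lam t' = startPositions r psi lam t := by
  induction t', ht using Nat.le_induction with
  | base => rfl
  | succ t' ht ih =>
    rw [startPositions_succ_of_not (h t' ht (by omega)), ih fun u hu hu' => h u hu (by omega)]

theorem startPositions_length_le {n : ℕ} {F sym ell : ℕ → ℕ}
    (h : RowSystem n r F psi lam sym ell) {t : ℕ} (ht : t ≤ n) :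
    (startPositions r psi lam t).length ≤ r := by
  classical
  have h1 := h.card_le (a := 1) (S := (Finset.range t).filter fun u => Start r psi lam (psi^[u] 0))
    (f := fun u => psi^[u] 0) ?_ ?_
  · simp only [startPositions, List.length_map]
    rw [one_mul] at h1
    refine le_trans (le_of_eq ?_) h1
    rw [← List.toFinset_card_of_nodup (List.nodup_range.filter _)]
    congr 1
    ext x
    simp
  · intro u hu
    exact ⟨h.iter_lt u 0 h.n_pos, 0, by omega, (Finset.mem_filter.1 hu).2⟩
  · intro u hu v hv huv
    have hu := Finset.mem_range.1 (Finset.mem_filter.1 hu).1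
    have hv := Finset.mem_range.1 (Finset.mem_filter.1 hv).1
    exact h.row_inj (by omega) (by omega) huv

end startPositions

/-- The positions up to `t` of starts of runs are in the array `J`, their runs are in `R`, and
the positions of the last rows of the runs, as far as they are at most `t`, are in `E`. -/
structure Recorded (r : ℕ) (psi lam : ℕ → ℕ) (t cnt : ℕ) (J R E : ℕ → ℕ) : Prop where
  J_eq : entries J cnt = startPositions r psi lam t
  R_eq : ∀ i < cnt, R i < r ∧ psi^[J i] 0 = lam (R i)
  E_eq : ∀ u < t, ∀ j < r, psi^[u + 1] 0 + 1 = lam (j + 1) → E j = u + 1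

/-- A block can be jumped over: if its first row is no break, it meets no run start, and if the row
below that is no break either, it meets no run end. -/
theorem Recorded.skip {n r : ℕ} {F psi lam sym ell : ℕ → ℕ}
    (h : RowSystem n r F psi lam sym ell) {t t' cnt s : ℕ} {J R E : ℕ → ℕ}
    (hR : Recorded r psi lam t cnt J R E) (ht : t ≤ t') (hts : t' ≤ t + s)
    (h1 : ¬ Break r psi lam s (psi^[t] 0)) (h2 : psi^[t] 0 + 1 < n)
    (h3 : ¬ Break r psi lam s (psi^[t] 0 + 1)) : Recorded r psi lam t' cnt J R E where
  J_eq := by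
    rw [hR.J_eq, startPositions_eq_of_not ht]
    intro u hu hu' hs
    refine h1 ⟨u - t, by omega, ?_⟩
    rwa [← Function.iterate_add_apply, show u - t + t = u by omega]
  R_eq := hR.R_eq
  E_eq := by
    intro u hu j hj he
    rcases lt_or_ge u t with hut | hut
    · exact hR.E_eq u hut j hj he
    · refine absurd (h.break_of_end (a := s) h2 (u := u - t) (by omega) hj ?_) h3
      rwa [← Function.iterate_add_apply, show u - t + t = u by omega,
        ← Function.iterate_succ_apply' psi]

/-- Follows `psi` for up to `reg 3` steps from the row in register `32` and the text position in
register `37`, and records the starts and ends of runs. -/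
def record : Cmd :=
  38 ≔ ct 0 ;;
  .loop (rg 37 <ₑ rg 0 &ₑ rg 38 <ₑ rg 3)
    (24 ≔ rg 32 ;; advance 6 7 18 1 ;;
    .load 35 6 (rg 20) ;; .load 36 6 (rg 20 +ₑ ct 1) ;; .load 40 4 (rg 20) ;;
    .cond (rg 32 =ₑ rg 35)
      (.store 15 (rg 33) (rg 37 +ₑ ct 1) ;; .store 16 (rg 33) (rg 40) ;; 33 ≔ rg 33 +ₑ ct 1) .skip ;;
    .cond (rg 32 +ₑ ct 1 =ₑ rg 36) (.store 17 (rg 40) (rg 37 +ₑ ct 1)) .skip ;;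
    32 ≔ rg 24 ;; 37 ≔ rg 37 +ₑ ct 1 ;; 38 ≔ rg 38 +ₑ ct 1)

theorem Recorded.step {n r : ℕ} {F psi lam sym ell : ℕ → ℕ}
    (h : RowSystem n r F psi lam sym ell) {B V N P : ℕ → ℕ} (T : BaseTable n r F psi lam B V N P)
    {t cnt : ℕ} {J R E : ℕ → ℕ} (hR : Recorded r psi lam t cnt J R E) (htn : t < n) {k : ℕ}
    (hk : k < r) (h1 : B k ≤ psi^[t] 0) (h2 : psi^[t] 0 < B (k + 1)) {cnt' : ℕ} {J' R' E' : ℕ → ℕ}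
    (hJ : psi^[t] 0 = B k ∧ cnt' = cnt + 1 ∧ J' = Function.update J cnt (t + 1) ∧
        R' = Function.update R cnt (P k) ∨ psi^[t] 0 ≠ B k ∧ cnt' = cnt ∧ J' = J ∧ R' = R)
    (hE : psi^[t] 0 + 1 = B (k + 1) ∧ E' = Function.update E (P k) (t + 1) ∨
        psi^[t] 0 + 1 ≠ B (k + 1) ∧ E' = E) :
    Recorded r psi lam (t + 1) cnt' J' R' E' where
  J_eq := by
    rcases hJ with ⟨h3, rfl, rfl, -⟩ | ⟨h3, rfl, rfl, -⟩
    · rw [entries_update, startPositions_succ_of ((T.start_iff h hk h1 h2).2 h3), hR.J_eq]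
    · rw [startPositions_succ_of_not fun hs => h3 ((T.start_iff h hk h1 h2).1 hs), hR.J_eq]
  R_eq := by
    rcases hJ with ⟨h3, rfl, rfl, rfl⟩ | ⟨h3, rfl, rfl, rfl⟩
    · intro i hi
      rcases (Nat.lt_succ_iff.1 hi).lt_or_eq with hi | rfl
      · rw [Function.update_of_ne hi.ne, Function.update_of_ne hi.ne]
        exact hR.R_eq i hi
      · rw [Function.update_self, Function.update_self, Function.iterate_succ_apply']
        have := (T.psi_eq h hk h1 h2).1
        exact ⟨T.lt k hk, by omega⟩
    · exact hR.R_eq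
  E_eq := by
    intro u hu j hj he
    rcases (Nat.lt_succ_iff.1 hu).lt_or_eq with hu | rfl
    · have h3 := hR.E_eq u hu j hj he
      rcases hE with ⟨h4, rfl⟩ | ⟨h4, rfl⟩
      -- An earlier record for the same run would concern the same row, hence the same time; so
      -- nothing valid is overwritten.
      · rcases eq_or_ne j (P k) with rfl | hne
        · have h5 := (T.end_iff h hk h1 h2 hj).2 ⟨h4, rfl⟩
          rw [Function.iterate_succ_apply'] at he
          have h6 := h.psi_inj _ (h.iter_lt u 0 h.n_pos) _ (h.iter_lt t 0 h.n_pos) (by omega)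
          have := h.row_inj (by omega) htn h6
          omega
        · rw [Function.update_of_ne hne, h3]
      · exact h3
    · rw [Function.iterate_succ_apply', T.end_iff h hk h1 h2 hj] at he
      rcases hE with ⟨h4, rfl⟩ | ⟨h4, rfl⟩
      · rw [he.2, Function.update_self]
      · exact absurd he.1 h4

theorem record_spec {w K n L : ℕ} (hf : Fits w K n L) {r : ℕ} {F psi lam sym ell : ℕ → ℕ}
    (h : RowSystem n r F psi lam sym ell) {s t : ℕ} {c : Cfg} {Q : Cfg → Prop}
    (h0 : c.reg 0 = n) (h1 : c.reg 1 = r) (h3 : c.reg 3 = s) (hsn : s ≤ n) (hrK : r < K)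
    (T : BaseTable n r F psi lam (c.arr 6) (c.arr 7) (c.arr 18) (c.arr 4))
    (h37 : c.reg 37 = t) (ht : t ≤ n) (h32 : c.reg 32 = psi^[t] 0)
    (hR : Recorded r psi lam t (c.reg 33) (c.arr 15) (c.arr 16) (c.arr 17))
    (hQ : ∀ c', (∀ x < 32, x < 20 ∨ 27 < x → c'.reg x = c.reg x) → c'.reg 34 = c.reg 34 →
      (∀ x, x < 15 ∨ 17 < x → c'.arr x = c.arr x) →
      Recorded r psi lam (min (t + s) n) (c'.reg 33) (c'.arr 15) (c'.arr 16) (c'.arr 17) →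
      c.t ≤ c'.t → c'.t ≤ c.t + s * (stepTime L + 70) + 20 → Q c') :
    vc w K record Q c := by
  have g3 := hf.two_le_w
  have g4 := hf.lt
  have hrn := h.r_le
  simp only [record, vc]
  simp
  generalize hA : stepTime L = A at hQ
  refine wp_loop hf.w_pos (fun c' => c'.reg 37 = t + c'.reg 38 ∧ c'.reg 38 ≤ s ∧
    c'.reg 37 ≤ n ∧ c'.reg 32 = psi^[c'.reg 37] 0 ∧
    Recorded r psi lam (c'.reg 37) (c'.reg 33) (c'.arr 15) (c'.arr 16) (c'.arr 17) ∧
    c.t ≤ c'.t ∧ c'.t ≤ c.t + c'.reg 38 * (A + 70) + 10) (fun c' => s - c'.reg 38) ?_ ?_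
  · simp [h37, ht, h32, hR]
  · rintro c' ⟨i1, i2, i3, i4, i5, i6, i7⟩ hF
    obtain ⟨hr, har⟩ := hF
    simp [advance, search] at hr har
    simp [hr, h0, h3]
    constructor
    · intro hlt hlt'
      generalize ht' : c'.reg 37 = t' at *
      have hxn : c'.reg 32 < n := by rw [i4]; exact h.iter_lt _ _ h.n_pos
      refine advance_spec hf h (by simp) (by simp) (by simp) (s := 1) (m := r) ?_ hrK.le ?_ ?_ ?_
      · simpa [hr] using h1
      · simpa [har] using T.table
      · simpa using hxn
      intro v tm e1 e2 e3 e4 e5 e6 e7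
      simp [har] at e1 e3 e4 e5 e6 e7 ⊢
      rw [i4] at e1 e4 e5 ⊢
      simp only [ht']
      have hPk := T.lt _ e2
      -- The index must be in range only when a start is stored, and then the lengthened list of
      -- starts still has at most `r` entries.
      have hcnt : c'.reg 33 < r ∨ psi^[t'] 0 ≠ c.arr 6 (v 20) := by
        by_cases hs : psi^[t'] 0 = c.arr 6 (v 20)
        · left
          have h5 := startPositions_length_le h (t := t' + 1) (by omega)
          have h6 := congrArg List.length i5.J_eq
          rw [startPositions_succ_of ((T.start_iff h e2 (by omega) (by omega)).2 hs),
            List.length_append, ← h6, entries_length] at h5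
          simpa using h5
        · exact .inr hs
      have hstep : ∀ {cnt' : ℕ} {J' R' E' : ℕ → ℕ}, _ → _ → _ :=
        fun {cnt' J' R' E'} => i5.step h T (by omega) e2 (by omega) (by omega)
          (cnt' := cnt') (J' := J') (R' := R') (E' := E')
      have hpsi : psi (psi^[t'] 0) = psi^[t'] (psi 0) :=
        (Function.iterate_succ_apply' ..).symm.trans (Function.iterate_succ_apply ..)
      have htime : (c'.reg 38 + 1) * (A + 70) = c'.reg 38 * (A + 70) + (A + 70) := by ring
      rw [i4] at hxn
      rw [hA] at e7
      rw [e1]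
      refine ⟨by omega, by omega, by omega, fun hs => ?_, fun hs => ?_⟩
      · have hcnt := hcnt.resolve_right (fun h' => h' hs)
        refine ⟨by omega, by omega, by omega, by omega, fun he => ?_, fun he => ?_⟩
        · exact ⟨by omega, by omega, by omega, ⟨by omega, by omega, by omega, hpsi,
            hstep (.inl ⟨hs, rfl, rfl, rfl⟩) (.inl ⟨he, rfl⟩), by omega, by omega⟩, by omega⟩
        · exact ⟨by omega, by omega, ⟨by omega, by omega, by omega, hpsi,
            hstep (.inl ⟨hs, rfl, rfl, rfl⟩) (.inr ⟨he, rfl⟩), by omega, by omega⟩, by omega⟩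
      · refine ⟨by omega, fun he => ?_, fun he => ?_⟩
        · exact ⟨by omega, by omega, by omega, ⟨by omega, by omega, by omega, hpsi,
            hstep (.inr ⟨hs, rfl, rfl, rfl⟩) (.inl ⟨he, rfl⟩), by omega, by omega⟩, by omega⟩
        · exact ⟨by omega, by omega, ⟨by omega, by omega, by omega, hpsi,
            hstep (.inr ⟨hs, rfl, rfl, rfl⟩) (.inr ⟨he, rfl⟩), by omega, by omega⟩, by omega⟩
    · intro hexit
      have he : c'.reg 37 = min (t + s) n := by
        by_cases h5 : c'.reg 37 < n
        · have := hexit h5; omega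
        · omega
      refine hQ _ ?_ ?_ ?_ ?_ (by simp; omega) ?_
      · intro x hx hx'
        simp (disch := omega) [hr, show x ≠ 38 by omega]
      · simp [hr]
      · intro x hx
        simp (disch := omega) [har]
      · simp only [Cfg.tick_reg, Cfg.tick_arr, ← he]; exact i5
      · have : c'.reg 38 * (A + 70) ≤ s * (A + 70) := Nat.mul_le_mul_right _ i2
        simp
        omega

/-- The first row of the block of `s` text positions after `t` is the first or the last row of its
piece. -/
def Hit (n r : ℕ) (psi lam : ℕ → ℕ) (s x : ℕ) : Prop :=
  Break r psi lam s x ∨ x + 1 = n ∨ Break r psi lam s (x + 1)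

open Classical in
noncomputable def hits (n r : ℕ) (psi lam : ℕ → ℕ) (s q : ℕ) : Finset ℕ :=
  (Finset.range q).filter fun q => Hit n r psi lam s (psi^[q * s] 0)

theorem hits_succ_of {n r : ℕ} {psi lam : ℕ → ℕ} {s q : ℕ}
    (h : Hit n r psi lam s (psi^[q * s] 0)) :
    (hits n r psi lam s (q + 1)).card = (hits n r psi lam s q).card + 1 := by
  classical
  rw [hits, Finset.range_add_one, Finset.filter_insert, if_pos h, Finset.card_insert_of_notMem]
  · rfl
  · simp

theorem hits_succ_of_not {n r : ℕ} {psi lam : ℕ → ℕ} {s q : ℕ}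
    (h : ¬ Hit n r psi lam s (psi^[q * s] 0)) :
    (hits n r psi lam s (q + 1)).card = (hits n r psi lam s q).card := by
  classical
  rw [hits, Finset.range_add_one, Finset.filter_insert, if_neg h]
  rfl

/-- Distinct blocks begin at distinct rows. At most `s * r` of these are breaks, at most `s * r` lie
just above a break, and one may be the last row. -/
theorem hits_card_le {n r : ℕ} {F psi lam sym ell : ℕ → ℕ} (h : RowSystem n r F psi lam sym ell)
    {s q : ℕ} (hs : 0 < s) (hq : ∀ p < q, p * s < n) :
    (hits n r psi lam s q).card ≤ 2 * (s * r) + 1 := by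
  classical
  have hinj : ∀ p < q, ∀ p' < q, psi^[p * s] 0 = psi^[p' * s] 0 → p = p' := by
    intro p hp p' hp' he
    exact Nat.eq_of_mul_eq_mul_right hs (h.row_inj (hq p hp) (hq p' hp') he)
  have h1 := h.card_le (a := s) (f := fun p => psi^[p * s] 0)
    (S := (Finset.range q).filter fun p => Break r psi lam s (psi^[p * s] 0))
    (fun p hp => ⟨h.iter_lt _ 0 h.n_pos, (Finset.mem_filter.1 hp).2⟩)
    (fun p hp p' hp' he => hinj p (by simpa using (Finset.mem_filter.1 hp).1) p'
      (by simpa using (Finset.mem_filter.1 hp').1) he)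
  have h2 := h.card_le (a := s) (f := fun p => psi^[p * s] 0 + 1)
    (S := (Finset.range q).filter fun p => psi^[p * s] 0 + 1 ≠ n ∧
      Break r psi lam s (psi^[p * s] 0 + 1))
    (fun p hp => ⟨by
      have := h.iter_lt (p * s) 0 h.n_pos
      have := (Finset.mem_filter.1 hp).2.1
      omega, (Finset.mem_filter.1 hp).2.2⟩)
    (fun p hp p' hp' he => hinj p (by simpa using (Finset.mem_filter.1 hp).1) p'
      (by simpa using (Finset.mem_filter.1 hp').1) (by simpa using he))
  have h3 : ((Finset.range q).filter fun p => psi^[p * s] 0 + 1 = n).card ≤ 1 := by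
    refine Finset.card_le_one.2 fun p hp p' hp' => ?_
    have hp := Finset.mem_filter.1 hp
    have hp' := Finset.mem_filter.1 hp'
    exact hinj p (by simpa using hp.1) p' (by simpa using hp'.1) (by omega)
  have h4 : hits n r psi lam s q ⊆
      ((Finset.range q).filter fun p => Break r psi lam s (psi^[p * s] 0)) ∪
      (((Finset.range q).filter fun p => psi^[p * s] 0 + 1 ≠ n ∧
        Break r psi lam s (psi^[p * s] 0 + 1)) ∪
      ((Finset.range q).filter fun p => psi^[p * s] 0 + 1 = n)) := by
    intro p hp
    rw [hits] at hp
    obtain ⟨hp1, hp2⟩ := Finset.mem_filter.1 hp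
    simp only [Finset.mem_filter, Finset.mem_union]
    by_cases hn : psi^[p * s] 0 + 1 = n
    · exact .inr (.inr ⟨hp1, hn⟩)
    · rcases hp2 with hp2 | hp2 | hp2
      · exact .inl ⟨hp1, hp2⟩
      · exact absurd hp2 hn
      · exact .inr (.inl ⟨hp1, hn, hp2⟩)
  have h5 := Finset.card_le_card h4
  have h6 := Finset.card_union_le
      ((Finset.range q).filter fun p => Break r psi lam s (psi^[p * s] 0))
      (((Finset.range q).filter fun p => psi^[p * s] 0 + 1 ≠ n ∧
        Break r psi lam s (psi^[p * s] 0 + 1)) ∪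
      ((Finset.range q).filter fun p => psi^[p * s] 0 + 1 = n))
  have h7 := Finset.card_union_le ((Finset.range q).filter fun p => psi^[p * s] 0 + 1 ≠ n ∧
        Break r psi lam s (psi^[p * s] 0 + 1))
      ((Finset.range q).filter fun p => psi^[p * s] 0 + 1 = n)
  omega

/-- Follows the `s`-th iterate of `psi` through the whole text. Samples the rows in the array `14`,
and records the starts and ends of runs. -/
def walk : Cmd :=
  30 ≔ (rg 0 -ₑ ct 1) /ₑ rg 3 +ₑ ct 1 ;; 31 ≔ ct 0 ;; 32 ≔ ct 0 ;; 33 ≔ ct 0 ;;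
  .loop (rg 31 <ₑ rg 30)
    (.store 14 (rg 31) (rg 32) ;; 24 ≔ rg 32 ;; advance 8 9 10 4 ;; 34 ≔ rg 24 ;;
    .load 35 8 (rg 20) ;; .load 36 8 (rg 20 +ₑ ct 1) ;;
    .cond (rg 32 =ₑ rg 35 |ₑ rg 32 +ₑ ct 1 =ₑ rg 36) (37 ≔ rg 31 *ₑ rg 3 ;; record) .skip ;;
    32 ≔ rg 34 ;; 31 ≔ rg 31 +ₑ ct 1)

-- The time splits into one binary search per block and `s` single steps for each block in `hits`.
set_option maxHeartbeats 1000000 in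
theorem walk_spec {w K n L : ℕ} (hf : Fits w K n L) {r : ℕ} {F psi lam sym ell : ℕ → ℕ}
    (h : RowSystem n r F psi lam sym ell) {s m : ℕ} {c : Cfg} {Q : Cfg → Prop}
    (h0 : c.reg 0 = n) (h1 : c.reg 1 = r) (h3 : c.reg 3 = s) (h4 : c.reg 4 = m) (hs : 0 < s)
    (hsn : s ≤ n) (hsK : s * r < K) (hnK : (n - 1) / s < K)
    (T : BaseTable n r F psi lam (c.arr 6) (c.arr 7) (c.arr 18) (c.arr 4))
    (Ts : Table n r F psi lam s m (c.arr 8) (c.arr 9) (c.arr 10))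
    (hQ : ∀ c', (∀ x < 20, c'.reg x = c.reg x) →
      (∀ x, x < 14 ∨ 17 < x → c'.arr x = c.arr x) → (∀ q, q * s < n → c'.arr 14 q = psi^[q * s] 0) →
      Recorded r psi lam n (c'.reg 33) (c'.arr 15) (c'.arr 16) (c'.arr 17) →
      c.t ≤ c'.t → c'.t ≤ c.t + ((n - 1) / s + 1) * (stepTime L + 70) +
        (2 * (s * r) + 1) * (s * (stepTime L + 70) + 30) + 40 → Q c') :
    vc w K walk Q c := by
  have g3 := hf.two_le_w
  have g4 := hf.lt
  have g5 := hf.two_le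
  have hrK : r < K := lt_of_le_of_lt (Nat.le_mul_of_pos_left r hs) hsK
  have hmK := (Ts.m_le h).trans_lt hsK
  have hq : ∀ q < (n - 1) / s + 1, q * s < n := by
    intro q hq
    have := Nat.mul_le_mul_right s (Nat.lt_succ_iff.1 hq)
    have := Nat.div_mul_le_self (n - 1) s
    omega
  have hq' : n ≤ ((n - 1) / s + 1) * s := by
    have := Nat.lt_div_mul_add (a := n - 1) hs
    rw [add_mul, one_mul]
    omega
  have hnq : (n - 1) / s ≤ n - 1 := Nat.div_le_self _ _
  simp only [walk, vc]
  simp [h0, h3]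
  refine ⟨by omega, ?_⟩
  generalize hA : stepTime L = A at hQ
  generalize hB : s * (A + 70) + 30 = B at hQ
  refine wp_loop hf.w_pos (fun c' => c'.reg 31 ≤ (n - 1) / s + 1 ∧
    c'.reg 32 = psi^[c'.reg 31 * s] 0 ∧ (∀ q < c'.reg 31, c'.arr 14 q = psi^[q * s] 0) ∧
    Recorded r psi lam (min (c'.reg 31 * s) n) (c'.reg 33) (c'.arr 15) (c'.arr 16) (c'.arr 17) ∧
    c.t ≤ c'.t ∧ c'.t ≤ c.t + c'.reg 31 * (A + 70) +
      (hits n r psi lam s (c'.reg 31)).card * B + 20) (fun c' => (n - 1) / s + 1 - c'.reg 31) ?_ ?_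
  · simp
    refine ⟨?_, by omega, by omega⟩
    constructor <;> simp [startPositions]
  · rintro c' ⟨i1, i2, i3, i4, i5, i6⟩ hF
    obtain ⟨hr, har⟩ := hF
    simp [advance, search, record] at hr har
    simp [hr]
    constructor
    · intro hlt
      generalize hqe : c'.reg 31 = q at *
      have hqn := hq q (by omega)
      rw [min_eq_left hqn.le] at i4
      have hxn : c'.reg 32 < n := by rw [i2]; exact h.iter_lt _ _ h.n_pos
      refine ⟨by omega, ?_⟩
      refine advance_spec hf h (by simp) (by simp) (by simp) (s := s) (m := m) ?_ hmK.le ?_ ?_ ?_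
      · simpa [hr] using h4
      · simpa [har] using Ts
      · simpa using hxn
      intro v tm e1 e2 e3 e4 e5 e6 e7
      simp [har] at e1 e3 e4 e5 e6 e7 ⊢
      simp [hr, h3, hqe]
      rw [hA] at e7
      have hxs : psi^[s] (psi^[q * s] 0) = psi^[(q + 1) * s] 0 := by
        rw [← Function.iterate_add_apply, add_mul, one_mul, add_comm]
      have htime : (q + 1) * (A + 70) = q * (A + 70) + (A + 70) := by ring
      have hm := Ts.m_le_n
      have hmn := Ts.B_le_n (show v 20 + 1 ≤ m from e2)
      -- `Hit` can be tested with the two ends of the piece already found; the closing entry `n`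
      -- accounts for the last row.
      have hhit : (c'.reg 32 = c.arr 8 (v 20) ∨ c'.reg 32 + 1 = c.arr 8 (v 20 + 1)) ↔
          Hit n r psi lam s (psi^[q * s] 0) := by
        rw [← i2]
        constructor
        · rintro (h' | h')
          · left; rw [h']; exact Ts.isBreak _ e2
          · right
            rcases (Nat.succ_le_of_lt e2).lt_or_eq with h5 | h5
            · right; rw [h']; exact Ts.isBreak _ h5
            · left; rw [h', ← Nat.succ_eq_add_one, h5, Ts.B_last]
        · rintro (h' | h' | h')
          · left
            by_contra hne
            exact Ts.not_break e2 (by omega) e5 h'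
          · right; omega
          · right
            by_contra hne
            exact Ts.not_break e2 (by omega) (by omega) h'
      refine ⟨by omega, by omega, by omega, fun hh => ?_, fun hh1 hh2 => ?_⟩
      · have hh' := hhit.1 (or_iff_not_imp_left.2 hh)
        refine ⟨by omega, ?_⟩
        refine record_spec hf h (s := s) (t := q * s) (by simp [hr, h0]) (by simp [hr, h1])
          (by simp [hr, h3]) hsn hrK (by simpa [har] using T) (by simp) hqn.le (by simpa using i2)
          (by simpa using i4) ?_
        intro c'' j1 j2 j3 j4 j5 j6
        simp [hA] at j1 j2 j3 j4 j5 j6 ⊢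
        simp [j1, j2, j3, hqe]
        rw [hits_succ_of hh', add_mul _ _ B, one_mul]
        refine ⟨by omega, ⟨by omega, ?_, ?_, ?_, by omega, by omega⟩, by omega⟩
        · rw [e1, i2, hxs]
        · intro p hp
          rcases hp.lt_or_eq with hp | rfl
          · rw [Function.update_of_ne hp.ne, i3 p hp]
          · rw [Function.update_self, i2]
        · rwa [add_mul, one_mul]
      · have hh' : ¬ Hit n r psi lam s (psi^[q * s] 0) := fun h' => by
          rcases hhit.2 h' with h' | h'
          · exact hh1 h'
          · exact hh2 h'
        rw [hits_succ_of_not hh']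
        refine ⟨by omega, ⟨by omega, ?_, ?_, ?_, by omega, by omega⟩, by omega⟩
        · rw [e1, i2, hxs]
        · intro p hp
          rcases hp.lt_or_eq with hp | rfl
          · rw [Function.update_of_ne hp.ne, i3 p hp]
          · rw [Function.update_self, i2]
        · rw [Hit, not_or, not_or] at hh'
          refine i4.skip h (s := s) (by rw [le_min_iff]; constructor <;> nlinarith)
            ((min_le_left _ _).trans (by rw [add_mul, one_mul])) hh'.1 ?_ hh'.2.2
          have := hh'.2.1
          rw [← i2] at this ⊢
          omega
    · intro hexit
      have he : c'.reg 31 = (n - 1) / s + 1 := by omega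
      rw [he] at i3 i4 i6
      rw [min_eq_right hq'] at i4
      refine hQ _ ?_ ?_ ?_ i4 (by simp; omega) ?_
      · intro x hx
        simp (disch := omega) [hr]
        simp (disch := omega) [show x ≠ 33 by omega, show x ≠ 32 by omega, show x ≠ 31 by omega,
          show x ≠ 30 by omega]
      · intro x hx
        simp (disch := omega) [har]
      · intro p hp
        refine i3 p ?_
        by_contra hp'
        have := Nat.mul_le_mul_right s (not_lt.1 hp')
        omega
      · have h5 := Nat.mul_le_mul_right B (hits_card_le h hs hq)
        simp
        omega

end RunLengthBWT

/-! ### The irreducible LCP values in text order. -/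

namespace RunLengthBWT
open WordRAM

/-- The sampled rows. -/
def Sampled (n s : ℕ) (psi X : ℕ → ℕ) : Prop := ∀ q, q * s < n → X q = psi^[q * s] 0

/-- Completes the lower bound in register `43` for the length of the common prefix of the row of
the text position in register `45`, which starts the run in register `46`, and the row before. -/
def lcpAt : Cmd :=
  .cond (rg 46)
    (.load 47 17 (rg 46 -ₑ ct 1) ;;
    19 ≔ rg 47 +ₑ rg 43 ;; rowAt ;; 48 ≔ rg 24 ;;
    19 ≔ rg 45 +ₑ rg 43 ;; rowAt ;; 49 ≔ rg 24 ;;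
    extend 8 9 10 4 3 ;; extend 6 7 18 1 5) .skip

/-- Two row lookups, one failing long comparison and at most `s` single-symbol comparisons.
Successful long comparisons are charged separately. -/
def lcpTime (s L : ℕ) : ℕ := 2 * (s * (stepTime L + 10)) + (s + 1) * (2 * stepTime L + 30) + 100

/-- The row above the start of run `j` is the last row of run `j - 1`, so the recorded end is the
text position of the predecessor in the suffix array. -/
theorem Recorded.phi {n r : ℕ} {F psi lam sym ell : ℕ → ℕ}
    (h : RowSystem n r F psi lam sym ell) {cnt : ℕ} {J R E : ℕ → ℕ}
    (hR : Recorded r psi lam n cnt J R E) {j : ℕ} (hj0 : 0 < j) (hj : j < r) :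
    1 ≤ E (j - 1) ∧ E (j - 1) ≤ n ∧ psi^[E (j - 1)] 0 = lam j - 1 := by
  have h1 := h.lam_strict hj0 hj.le
  have h2 := h.lam_strict hj le_rfl
  rw [h.lam_last] at h2
  obtain ⟨x, hx, hxe⟩ := h.psi_surj (y := lam j - 1) (by omega)
  obtain ⟨u, hu, rfl⟩ := h.orbit x hx
  rw [← Function.iterate_succ_apply' psi] at hxe
  have h3 := hR.E_eq u hu (j - 1) (by omega) (by
    rw [show j - 1 + 1 = j by omega]
    simp only [Nat.succ_eq_add_one] at hxe
    omega)
  rw [h3]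
  exact ⟨by omega, by omega, hxe⟩

theorem lcpAt_spec {w K n L : ℕ} (hf : Fits w K n L) {r : ℕ} {F psi lam sym ell : ℕ → ℕ}
    (h : RowSystem n r F psi lam sym ell) {s m j p l cnt : ℕ} {c : Cfg} {Q : Cfg → Prop}
    (h1 : c.reg 1 = r) (h3 : c.reg 3 = s) (h4 : c.reg 4 = m) (h5 : c.reg 5 = 1) (hs : 0 < s)
    (hsn : s ≤ n) (hsK : s * r < K) (hnK : (n - 1) / s < K)
    (T : Table n r F psi lam 1 r (c.arr 6) (c.arr 7) (c.arr 18))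
    (Ts : Table n r F psi lam s m (c.arr 8) (c.arr 9) (c.arr 10))
    (hS : Sampled n s psi (c.arr 14))
    (hR : Recorded r psi lam n cnt (c.arr 15) (c.arr 16) (c.arr 17))
    (h45 : c.reg 45 = j) (h46 : c.reg 46 = p) (h43 : c.reg 43 = l) (hj : 1 ≤ j) (hjn : j ≤ n)
    (hp : p < r) (hrow : psi^[j] 0 = lam p) (hl : l ≤ ell (psi^[j] 0))
    (hQ : ∀ c' k, (∀ x, x < 16 ∨ 28 < x → x < 43 ∨ 49 < x ∨ x = 44 ∨ x = 45 ∨ x = 46 →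
      c'.reg x = c.reg x) → c'.arr = c.arr → c'.reg 43 = ell (psi^[j] 0) →
      l + s * k ≤ ell (psi^[j] 0) →
      c.t ≤ c'.t → c'.t ≤ c.t + k * (2 * stepTime L + 30) + lcpTime s L + 100 → Q c') :
    vc w K lcpAt Q c := by
  have g3 := hf.two_le_w
  have g4 := hf.lt
  have hrK : r < K := lt_of_le_of_lt (Nat.le_mul_of_pos_left r hs) hsK
  have hmK := (Ts.m_le h).trans_lt hsK
  have hrn := h.r_le
  simp only [lcpAt, vc]
  simp [h46]
  constructor
  · intro hp0
    have hp0 : 0 < p := by omega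
    obtain ⟨e1, e2, e3⟩ := hR.phi h hp0 hp
    have hlam := h.lam_strict hp0 hp.le
    have hx0 : 0 < psi^[j] 0 := by omega
    have hxn := h.iter_lt j 0 h.n_pos
    have e4 := h.ell_le hjn
    have e5 := h.ell_le' e2 hx0 (by omega)
    generalize hA : stepTime L = A at hQ
    refine ⟨by omega, by omega, ?_⟩
    generalize hφ : c.arr 17 (p - 1) = φ at *
    generalize hx : psi^[j] 0 = x at *
    refine rowAt_spec hf h (r := r) (s := s) (by simp [h1]) hrK.le (by simp [h3]) hs hsn
      (by simpa using T) (by simpa [Sampled] using hS) hnK (by simp; omega) (by simp; omega) ?_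
    intro v t f1 f2 f3
    simp [hA] at f1 f2 f3 ⊢
    simp [h43, h45]
    refine ⟨by omega, ?_⟩
    refine rowAt_spec hf h (r := r) (s := s) (by simp [h1]) hrK.le (by simp [h3]) hs hsn
      (by simpa using T) (by simpa [Sampled] using hS) hnK (by simp; omega) (by simp; omega) ?_
    intro v' t' f1' f2' f3'
    simp [hA] at f1' f2' f3' ⊢
    have hv : v 24 = psi^[l] (x - 1) := by
      rw [f1, h43, show x - 1 = psi^[φ] 0 by omega, ← Function.iterate_add_apply, add_comm]
    have hv' : v' 24 = psi^[l] x := by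
      rw [f1', ← hx, ← Function.iterate_add_apply, add_comm]
    have hag : Agree F psi l (x - 1) x := fun u hu => h.ell_eq x hx0 hxn u (by omega)
    have hle : ∀ k, Agree F psi k (psi^[l] (x - 1)) (psi^[l] x) → l + k ≤ ell x := fun k hk =>
      h.le_ell hx0 hxn (agree_add.2 ⟨hag, hk⟩)
    have hn1 := h.iter_lt l (x - 1) (by omega)
    have hn2 := h.iter_lt l x hxn
    refine extend_spec hf h (s := s) (m := m) (by simp) (by simp) (by simp) (by simp [h4])
      (by simp) hmK.le (by simp [h3]) (by simp) hs (by simpa using Ts) (by simpa [hv] using hn1)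
      (by simpa [hv'] using hn2) ?_ ?_
    · simp [hv, hv', h43]
      intro k hk
      have := hle k hk
      omega
    intro c₁ k a1 a2 a3 a4 a5 a6 a7 a8 a9
    simp [hA, hv, hv', h43] at a1 a2 a3 a4 a5 a6 a7 a8 a9
    have hlk := hle _ a6
    have hag1 : Agree F psi (l + s * k) (x - 1) x := agree_add.2 ⟨hag, a6⟩
    have hb1 : c₁.reg 48 = psi^[l + s * k] (x - 1) := by
      rw [a4, ← Function.iterate_add_apply, add_comm]
    have hb2 : c₁.reg 49 = psi^[l + s * k] x := by
      rw [a5, ← Function.iterate_add_apply, add_comm]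
    have hle' : ∀ k', Agree F psi k' (c₁.reg 48) (c₁.reg 49) → l + s * k + k' ≤ ell x :=
      fun k' hk' => h.le_ell hx0 hxn (agree_add.2 ⟨hag1, by rwa [← hb1, ← hb2]⟩)
    refine extend_spec hf h (s := 1) (m := r) (by simp) (by simp) (by simp) (by simp [a1, h1])
      (by simp) hrK.le (by simp [a1, h5]) (by simp) (by omega) (by simpa [a2] using T)
      (by rw [hb1]; exact h.iter_lt _ _ (by omega)) (by rw [hb2]; exact h.iter_lt _ _ hxn) ?_ ?_
    · intro k' hk'
      have := hle' k' hk'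
      omega
    intro c₂ k' b1 b2 b3 b4 b5 b6 b7 b8 b9
    simp only [one_mul] at b3 b4 b5 b6
    rw [hA] at b9
    -- If `s` single comparisons succeeded, the last long comparison would not have failed.
    have hks : k' < s := by
      by_contra hks
      exact a7 fun u hu => b6 u (by omega)
    have hend : l + s * k + k' = ell x := by
      refine h.ell_unique hx0 hxn ?_ ?_
      · exact agree_add.2 ⟨hag1, by rwa [← hb1, ← hb2]⟩
      · intro he
        refine b7 fun u hu => ?_
        obtain rfl : u = 0 := by omega
        rw [Function.iterate_zero_apply, Function.iterate_zero_apply, b4, b5, hb1, hb2,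
          ← Function.iterate_add_apply, ← Function.iterate_add_apply, add_comm k']
        exact he
    refine hQ c₂ k ?_ (by rw [b2, a2]) (by omega) hlk (by omega) ?_
    · intro y hy hy'
      rw [b1 y hy (by omega) (by omega) (by omega), a1 y (by omega) (by omega) (by omega) (by omega)]
      simp (disch := omega) [show y ≠ 49 by omega, show y ≠ 48 by omega, show y ≠ 19 by omega,
        show y ≠ 47 by omega]
      rw [if_neg (by omega), if_neg (by omega)]
    · have e6 : (k' + 1) * (2 * A + 30) ≤ s * (2 * A + 30) := Nat.mul_le_mul_right _ hks
      rw [lcpTime, hA]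
      rw [add_mul, one_mul] at a9 ⊢
      omega
  -- The first run starts at row `0`, which has value `0`; the lower bound is then `0` already.
  · intro hp0
    subst hp0
    rw [h.lam_zero] at hrow
    rw [hrow, h.ell_zero] at hl hQ
    refine hQ _ 0 (fun x _ _ => rfl) rfl (by simp [h43]; omega) (by simpa using hl) (by simp; omega) ?_
    simp
    omega

theorem Recorded.cnt_le {n r : ℕ} {F psi lam sym ell : ℕ → ℕ}
    (h : RowSystem n r F psi lam sym ell) {cnt : ℕ} {J R E : ℕ → ℕ}
    (hR : Recorded r psi lam n cnt J R E) : cnt ≤ r := by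
  have := startPositions_length_le h le_rfl
  rwa [← hR.J_eq, entries_length] at this

theorem Recorded.J_lt {n r : ℕ} {psi lam : ℕ → ℕ} {cnt : ℕ} {J R E : ℕ → ℕ}
    (hR : Recorded r psi lam n cnt J R E) {i j : ℕ} (hij : i < j) (hj : j < cnt) : J i < J j := by
  have h1 : (entries J cnt).Pairwise (· < ·) := by
    rw [hR.J_eq, startPositions, List.pairwise_map]
    exact (List.pairwise_lt_range.filter _).imp (by simp)
  have := List.pairwise_iff_getElem.1 h1 i j (by simp; omega) (by simpa using hj) hij
  simpa [entries] using this

theorem Recorded.J_mem {n r : ℕ} {psi lam : ℕ → ℕ} {cnt : ℕ} {J R E : ℕ → ℕ}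
    (hR : Recorded r psi lam n cnt J R E) {i : ℕ} (hi : i < cnt) : 1 ≤ J i ∧ J i ≤ n := by
  have := entries_mem J hi
  rw [hR.J_eq, startPositions] at this
  obtain ⟨u, hu, hue⟩ := List.mem_map.1 this
  have := List.mem_range.1 (List.mem_filter.1 hu).1
  omega

/-- The lengths of the common prefixes at the recorded positions, in text order. -/
def lcpPhase : Cmd :=
  5 ≔ ct 1 ;; 42 ≔ ct 0 ;; 43 ≔ ct 0 ;; 44 ≔ ct 0 ;;
  .loop (rg 42 <ₑ rg 33)
    (.load 45 15 (rg 42) ;; .load 46 16 (rg 42) ;;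
    .cond (rg 43 <ₑ rg 45 -ₑ rg 44) (43 ≔ ct 0) (43 ≔ rg 43 -ₑ (rg 45 -ₑ rg 44)) ;;
    lcpAt ;; .store 3 (rg 42) (rg 43) ;; 44 ≔ rg 45 ;; 42 ≔ rg 42 +ₑ ct 1)

-- Amortized analysis with potential `(j + ell) / s`: each successful long comparison raises it by
-- at least one, moving on to the next position never lowers it, and it is at most `n / s`.
set_option maxHeartbeats 1000000 in
theorem lcpPhase_spec {w K n L : ℕ} (hf : Fits w K n L) {r : ℕ} {F psi lam sym ell : ℕ → ℕ}
    (h : RowSystem n r F psi lam sym ell) {s m : ℕ} {c : Cfg} {Q : Cfg → Prop}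
    (h1 : c.reg 1 = r) (h3 : c.reg 3 = s) (h4 : c.reg 4 = m) (hs : 0 < s)
    (hsn : s ≤ n) (hsK : s * r < K) (hnK : (n - 1) / s < K)
    (T : Table n r F psi lam 1 r (c.arr 6) (c.arr 7) (c.arr 18))
    (Ts : Table n r F psi lam s m (c.arr 8) (c.arr 9) (c.arr 10))
    (hS : Sampled n s psi (c.arr 14))
    (hR : Recorded r psi lam n (c.reg 33) (c.arr 15) (c.arr 16) (c.arr 17))
    (hQ : ∀ c', (∀ x < 5, c'.reg x = c.reg x) → c'.reg 33 = c.reg 33 →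
      (∀ x, x ≠ 3 → c'.arr x = c.arr x) →
      (∀ i < c.reg 33, c'.arr 3 i = ell (psi^[c.arr 15 i] 0)) →
      c.t ≤ c'.t → c'.t ≤ c.t + r * (lcpTime s L + 150) + n / s * (2 * stepTime L + 30) + 30 → Q c') :
    vc w K lcpPhase Q c := by
  have g3 := hf.two_le_w
  have g4 := hf.lt
  have hrK : r < K := lt_of_le_of_lt (Nat.le_mul_of_pos_left r hs) hsK
  have hrn := h.r_le
  have hcnt := hR.cnt_le h
  simp only [lcpPhase, vc]
  simp
  refine ⟨by omega, ?_⟩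
  generalize hD : lcpTime s L + 150 = D at hQ
  generalize hC : 2 * stepTime L + 30 = C at hQ
  refine wp_loop hf.w_pos (fun c' => c'.reg 42 ≤ c.reg 33 ∧
    (c'.reg 42 = 0 → c'.reg 43 = 0 ∧ c'.reg 44 = 0) ∧
    (0 < c'.reg 42 → c'.reg 44 = c.arr 15 (c'.reg 42 - 1) ∧
      c'.reg 43 = ell (psi^[c'.reg 44] 0)) ∧
    c'.reg 44 + c'.reg 43 ≤ n ∧
    (∀ i < c'.reg 42, c'.arr 3 i = ell (psi^[c.arr 15 i] 0)) ∧
    c.t ≤ c'.t ∧ c'.t ≤ c.t + c'.reg 42 * D + (c'.reg 44 + c'.reg 43) / s * C + 20)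
    (fun c' => c.reg 33 - c'.reg 42) ?_ ?_
  · simp; omega
  · rintro c' ⟨i1, i2, i3, i4, i5, i6, i7⟩ hF
    obtain ⟨hr, har⟩ := hF
    simp [lcpAt, rowAt, extend, advance, search] at hr har
    simp [hr, har]
    constructor
    · intro hlt
      have hj := hR.J_mem hlt
      have hrow := hR.R_eq _ hlt
      generalize hje : c.arr 15 (c'.reg 42) = j at *
      have hell := h.ell_le hj.2
      have hjp : c'.reg 44 ≤ j ∧ c'.reg 43 - (j - c'.reg 44) ≤ ell (psi^[j] 0) := by
        rcases Nat.eq_zero_or_pos (c'.reg 42) with h0 | h0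
        · have := i2 h0; omega
        · obtain ⟨b1, b2⟩ := i3 h0
          have b3 := hR.J_lt (i := c'.reg 42 - 1) (j := c'.reg 42) (by omega) hlt
          rw [hje, ← b1] at b3
          have b4 := h.ell_row_ge (c'.reg 44) (j - c'.reg 44)
          rw [show c'.reg 44 + (j - c'.reg 44) = j by omega] at b4
          omega
      have fin : ∀ c₂ : Cfg, c₂.reg 42 = c'.reg 42 → c₂.reg 45 = j →
          c₂.reg 43 = ell (psi^[j] 0) → c₂.arr 3 = c'.arr 3 → c.t ≤ c₂.t →
          c₂.t + 9 ≤ c.t + (c'.reg 42 + 1) * D + (j + ell (psi^[j] 0)) / s * C + 20 →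
          c₂.reg 42 < K ∧ (¬w = 0 ∧ c₂.reg 42 + 1 < 2 ^ w) ∧
            (c₂.reg 42 < c.reg 33 ∧ (c₂.reg 45 = c.arr 15 (c₂.reg 42) ∧
              c₂.reg 43 = ell (psi^[c₂.reg 45] 0)) ∧ c₂.reg 45 + c₂.reg 43 ≤ n ∧
              (∀ i ≤ c₂.reg 42, Function.update (c₂.arr 3) (c₂.reg 42) (c₂.reg 43) i =
                ell (psi^[c.arr 15 i] 0)) ∧ c.t ≤ c₂.t + 3 + 2 + 4 ∧
              c₂.t + 3 + 2 + 4 ≤ c.t + (c₂.reg 42 + 1) * D + (c₂.reg 45 + c₂.reg 43) / s * C + 20) ∧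
            c.reg 33 - (c₂.reg 42 + 1) < c.reg 33 - c'.reg 42 := by
        intro c₂ d1 d2 d3 d4 d5 d6
        rw [d1, d2, d3, d4, hje]
        refine ⟨by omega, by omega, ⟨hlt, ⟨rfl, rfl⟩, hell, ?_, by omega, by omega⟩, by omega⟩
        intro i hi
        rcases hi.lt_or_eq with hi | rfl
        · rw [Function.update_of_ne hi.ne, i5 i hi]
        · rw [Function.update_self, hje]
      -- Both branches produce the truncated difference `l`; the program branches because
      -- subtraction of words would wrap around.
      have main : ∀ (Q' : Cfg → Prop) (c₁ : Cfg) (l : ℕ), (∀ x, x ≠ 45 → x ≠ 46 → x ≠ 43 →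
          c₁.reg x = c'.reg x) → c₁.arr = c'.arr → c₁.reg 45 = j →
          c₁.reg 46 = c.arr 16 (c'.reg 42) → c₁.reg 43 = l →
          l = c'.reg 43 - (j - c'.reg 44) → c'.t ≤ c₁.t → c₁.t ≤ c'.t + 25 →
          (∀ c₂ : Cfg, c₂.reg 42 = c'.reg 42 → c₂.reg 45 = j →
          c₂.reg 43 = ell (psi^[j] 0) → c₂.arr 3 = c'.arr 3 → c.t ≤ c₂.t →
          c₂.t + 9 ≤ c.t + (c'.reg 42 + 1) * D + (j + ell (psi^[j] 0)) / s * C + 20 → Q' c₂) →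
          vc w K lcpAt Q' c₁ := by
        intro Q' c₁ l d1 d2 d3 d4 d5 d6 d7 d8 d9
        refine lcpAt_spec hf h (s := s) (m := m) (j := j) (p := c.arr 16 (c'.reg 42)) (l := l)
          (cnt := c.reg 33) (by simp [d1, hr, h1]) (by simp [d1, hr, h3]) (by simp [d1, hr, h4])
          (by simp [d1, hr]) hs hsn hsK hnK (by simpa [d2, har] using T) (by simpa [d2, har] using Ts)
          (by simpa [d2, har] using hS) (by simpa [d2, har] using hR) d3 d4 d5 hj.1 hj.2
          hrow.1 hrow.2 (by omega) ?_
        intro c₂ k f1 f2 f3 f4 f5 f6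
        have htime : (c'.reg 42 + 1) * D = c'.reg 42 * D + D := by ring
        have hpot : (c'.reg 44 + c'.reg 43) / s + k ≤ (j + ell (psi^[j] 0)) / s := by
          rw [← Nat.add_mul_div_left _ _ hs]
          exact Nat.div_le_div_right (by omega)
        have hpot' := Nat.mul_le_mul_right C hpot
        rw [add_mul] at hpot'
        rw [hC] at f6
        exact d9 c₂ (by rw [f1 42 (by omega) (by omega), d1 42 (by omega) (by omega) (by omega)])
          (by rw [f1 45 (by omega) (by omega), d3]) f3 (by rw [f2, d2]) (by omega) (by omega)
      refine ⟨by omega, hjp.1, fun hg => ?_, fun hg => ?_⟩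
      · refine main _ _ 0 ?_ rfl ?_ ?_ ?_ ?_ ?_ ?_ ?_
        · intro x a b d; simp [a, b, d]
        · simp
        · simp
        · simp
        · omega
        · simp; omega
        · simp
        · intro c₂ d1 d2 d3 d4 d5 d6
          obtain ⟨e1, e2, ⟨e3, e4, e5, e6, e7, e8⟩, e9⟩ := fin c₂ d1 d2 d3 d4 d5 d6
          exact ⟨e1, e2, ⟨e3, e4, e5, e6, e7, by omega⟩, e9⟩
      · refine ⟨⟨hjp.1, hg⟩, ?_⟩
        refine main _ _ _ ?_ rfl ?_ ?_ ?_ rfl ?_ ?_ ?_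
        · intro x a b d; simp [a, b, d]
        · simp
        · simp
        · simp
        · simp; omega
        · simp
        · intro c₂ d1 d2 d3 d4 d5 d6
          obtain ⟨e1, e2, ⟨e3, e4, e5, e6, e7, e8⟩, e9⟩ := fin c₂ d1 d2 d3 d4 d5 d6
          exact ⟨e1, e2, ⟨e3, e4, e5, e6, e7, by omega⟩, e9⟩
    · intro hexit
      have he : c'.reg 42 = c.reg 33 := by omega
      rw [he] at i5 i7
      refine hQ _ ?_ ?_ ?_ i5 (by simp; omega) ?_
      · intro x hx
        simp (disch := omega) [hr]
        simp (disch := omega) [show x ≠ 44 by omega, show x ≠ 43 by omega, show x ≠ 42 by omega,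
          show x ≠ 5 by omega]
      · simp [hr]
      · intro x hx; simp [har, hx]
      · have h5 := Nat.mul_le_mul_right D hcnt
        have h6 := Nat.mul_le_mul_right C (Nat.div_le_div_right (c := s) i4)
        simp
        omega

end RunLengthBWT

/-! ### Output: the list of positions and the packed bitvector. -/

namespace RunLengthBWT
open WordRAM

infixl:70 " ≪ₑ " => Expr.op Op.shl

/-- Copies the recorded positions to the array `2`. -/
def copyPositions : Cmd :=
  42 ≔ ct 0 ;;
  .loop (rg 42 <ₑ rg 33)
    (.load 45 15 (rg 42) ;; .store 2 (rg 42) (rg 45) ;; 42 ≔ rg 42 +ₑ ct 1)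

theorem copyPositions_spec {w K n L : ℕ} (hf : Fits w K n L) {c : Cfg} {Q : Cfg → Prop}
    (hn : c.reg 33 ≤ n) (hK : c.reg 33 ≤ K)
    (hQ : ∀ c', (∀ i < c.reg 33, c'.arr 2 i = c.arr 15 i) → (∀ a, a ≠ 2 → c'.arr a = c.arr a) →
      c.t ≤ c'.t → c'.t ≤ c.t + c.reg 33 * 20 + 20 → Q c') :
    vc w K copyPositions Q c := by
  have g3 := hf.two_le_w
  have g4 := hf.lt
  simp only [copyPositions, vc]
  simp
  refine wp_loop hf.w_pos (fun c' => c'.reg 42 ≤ c.reg 33 ∧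
    (∀ i < c'.reg 42, c'.arr 2 i = c.arr 15 i) ∧ c.t ≤ c'.t ∧ c'.t ≤ c.t + c'.reg 42 * 20 + 10)
    (fun c' => c.reg 33 - c'.reg 42) ?_ ?_
  · simp
  · rintro c' ⟨i1, i2, i3, i4⟩ hF
    obtain ⟨hr, har⟩ := hF
    simp at hr har
    simp [hr, har]
    refine ⟨fun hlt => ⟨by omega, by omega, ⟨hlt, ?_, by omega, by omega⟩, by omega⟩, fun hge => ?_⟩
    · intro i hi
      rcases hi.lt_or_eq with hi | rfl
      · rw [Function.update_of_ne hi.ne, i2 i hi]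
      · rw [Function.update_self]
    · obtain he : c'.reg 42 = c.reg 33 := by omega
      rw [he] at i2 i4
      exact hQ _ i2 (fun a ha => by simp [har, ha]) (by simp; omega) (by simp; omega)

/-- The words of `X` hold the characteristic vector of `B`, `w` bits to a word. -/
def Bits (w : ℕ) (X : ℕ → ℕ) (B : ℕ → Prop) : Prop :=
  ∀ q b, b < w → ((X q).testBit b ↔ B (q * w + b))

/-- Cutting `g` ones from the all-ones word avoids forming `2 ^ g`, which does not fit in a word
when `g = w`. -/
theorem testBit_mask {w b g i : ℕ} (hb : b + g ≤ w) :
    ((2 ^ w - 1) / 2 ^ (w - g) * 2 ^ b).testBit i = true ↔ b ≤ i ∧ i < b + g := by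
  have h : (2 ^ w - 1) / 2 ^ (w - g) = 2 ^ g - 1 := by
    have h1 : 2 ^ w = 2 ^ (w - g) * 2 ^ g := by rw [← pow_add]; congr 1; omega
    have h2 : 0 < 2 ^ (w - g) := by positivity
    have h3 : 0 < 2 ^ g := by positivity
    rw [Nat.div_eq_iff h2]
    obtain ⟨y, hy⟩ : ∃ y, 2 ^ g = y + 1 := ⟨2 ^ g - 1, by omega⟩
    rw [h1, hy, Nat.add_sub_cancel, mul_add, mul_comm y]
    omega
  rw [h, Nat.testBit_mul_two_pow]
  simp
  omega

theorem Bits.or {w : ℕ} {X : ℕ → ℕ} {B : ℕ → Prop} (h : Bits w X B) {q b g : ℕ}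
    (hb : b + g ≤ w) :
    Bits w (Function.update X q (X q ||| (2 ^ w - 1) / 2 ^ (w - g) * 2 ^ b))
      (fun x => B x ∨ q * w + b ≤ x ∧ x < q * w + b + g) := by
  intro q' i hi
  rcases eq_or_ne q' q with rfl | hq
  · rw [Function.update_self, Nat.testBit_or, Bool.or_eq_true, h q' i hi, testBit_mask hb]
    exact or_congr_right (by omega)
  · rw [Function.update_of_ne hq, h q' i hi]
    have : ¬ (q * w + b ≤ q' * w + i ∧ q' * w + i < q * w + b + g) := by
      rintro ⟨h1, h2⟩
      rcases lt_or_gt_of_ne hq with h3 | h3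
      · have := Nat.mul_le_mul_right w (show q' + 1 ≤ q from h3)
        rw [add_mul, one_mul] at this
        omega
      · have := Nat.mul_le_mul_right w (show q + 1 ≤ q' from h3)
        rw [add_mul, one_mul] at this
        omega
    simp [this]

/-- Sets as many bits as register `47` says, from bit number `reg 48` of word number `reg 49`. -/
def setBits : Cmd :=
  .loop (rg 47)
    (.cond (rg 47 <ₑ rg 52 -ₑ rg 48) (43 ≔ rg 47) (43 ≔ rg 52 -ₑ rg 48) ;;
    .load 44 2 (rg 49) ;;
    .store 2 (rg 49) (rg 44 |ₑ (rg 50 ≫ₑ (rg 52 -ₑ rg 43)) ≪ₑ rg 48) ;;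
    49 ≔ rg 49 +ₑ ct 1 ;; 48 ≔ ct 0 ;; 47 ≔ rg 47 -ₑ rg 43)

theorem mask_lt {w b g : ℕ} (hb : b + g ≤ w) :
    (2 ^ w - 1) / 2 ^ (w - g) * 2 ^ b < 2 ^ w := by
  refine Nat.lt_pow_two_of_testBit _ fun i hi => ?_
  rw [← Bool.not_eq_true, testBit_mask hb]
  omega

/-- Each round completes a word or ends the interval. The time bound carries the word index of the
beginning on its left side, so that the costs of successive intervals telescope. -/
theorem setBits_spec {w K n L : ℕ} (hf : Fits w K n L) {c : Cfg} {Q : Cfg → Prop} {B : ℕ → Prop}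
    {p g : ℕ} (h52 : c.reg 52 = w) (h50 : c.reg 50 = 2 ^ w - 1) (h47 : c.reg 47 = g)
    (h48 : c.reg 48 = p % w) (h49 : c.reg 49 = p / w) (hB : Bits w (c.arr 2) B) (hg : 0 < g)
    (hp : p + g ≤ 2 * n) (hK : 2 * n / w + 1 < K)
    (hQ : ∀ c', (∀ x, x < 43 ∨ 49 < x ∨ x = 45 ∨ x = 46 → c'.reg x = c.reg x) →
      (∀ a, a ≠ 2 → c'.arr a = c.arr a) → Bits w (c'.arr 2) (fun x => B x ∨ p ≤ x ∧ x < p + g) →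
      c.t ≤ c'.t → c'.t + p / w * 50 ≤ c.t + ((p + g) / w + 1) * 50 + 20 → Q c') :
    vc w K setBits Q c := by
  have g3 := hf.two_le_w
  have g4 := hf.lt
  have g5 := hf.w_pos
  simp only [setBits, vc]
  refine wp_loop hf.w_pos (fun c' => ∃ x, x + c'.reg 47 = p + g ∧
    Bits w (c'.arr 2) (fun y => B y ∨ p ≤ y ∧ y < x) ∧ p ≤ x ∧
    (0 < c'.reg 47 → x = c'.reg 49 * w + c'.reg 48) ∧ c'.reg 48 < w ∧
    p / w ≤ c'.reg 49 ∧ c'.reg 49 ≤ (p + g) / w + 1 ∧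
    c.t ≤ c'.t ∧ c'.t + p / w * 50 ≤ c.t + c'.reg 49 * 50)
    (fun c' => c'.reg 47) ?_ ?_
  · refine ⟨p, by omega, ?_, le_rfl, fun _ => ?_, ?_, ?_, ?_, ?_, ?_⟩
    · intro q b hb
      rw [hB q b hb]
      exact ⟨Or.inl, fun h => h.elim id (by omega)⟩
    · rw [h48, h49, Nat.div_add_mod']
    · rw [h48]; exact Nat.mod_lt _ g5
    · omega
    · rw [h49]
      have := Nat.div_le_div_right (c := w) (show p ≤ p + g by omega)
      omega
    · omega
    · omega
  · rintro c' ⟨x, i1, i2, i3, i4, i5, i6, i7, i8, i9⟩ hF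
    obtain ⟨hr, har⟩ := hF
    simp at hr har
    simp [hr, h50, h52]
    constructor
    · intro hpos
      have hx := i4 (by omega)
      have h1 : c'.reg 49 ≤ (p + g) / w := by
        rw [Nat.le_div_iff_mul_le g5]
        omega
      have h2 : (p + g) / w ≤ 2 * n / w := Nat.div_le_div_right hp
      have h3 : 2 * n / w ≤ n := Nat.div_le_of_le_mul (by nlinarith)
      have key : ∀ e, e ≤ w - c'.reg 48 → e ≤ c'.reg 47 → (e < w - c'.reg 48 → e = c'.reg 47) →
        0 < e → ∃ x, x + (c'.reg 47 - e) = p + g ∧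
          Bits w (Function.update (c'.arr 2) (c'.reg 49)
            (c'.arr 2 (c'.reg 49) ||| (2 ^ w - 1) / 2 ^ (w - e) * 2 ^ c'.reg 48))
            (fun y => B y ∨ p ≤ y ∧ y < x) ∧ p ≤ x ∧
          (0 < c'.reg 47 - e → x = (c'.reg 49 + 1) * w) := by
        intro e e1 e2 e3 e4
        refine ⟨x + e, by omega, ?_, by omega, fun h' => ?_⟩
        · have := i2.or (q := c'.reg 49) (b := c'.reg 48) (g := e) (by omega)
          intro q b hb
          rw [this q b hb]
          rw [← hx]
          simp only [or_assoc]
          refine or_congr_right ?_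
          omega
        · rw [add_mul, one_mul]
          omega
      have h4 : c'.reg 49 < n := by
        have := Nat.mul_le_mul_left (c'.reg 49) g3
        omega
      refine ⟨by omega, fun ha => ?_, fun ha => ?_⟩
      · obtain ⟨y, y1, y2, y3, y4⟩ := key (c'.reg 47) (by omega) le_rfl (by omega) (by omega)
        rw [Nat.sub_self, add_zero] at y1
        rw [y1] at y2
        exact ⟨by omega, ⟨⟨by omega, mask_lt (by omega)⟩, by omega⟩, by omega,
          ⟨y2, by omega, by omega, by omega, by omega, by omega⟩, by omega⟩
      · obtain ⟨y, y1, y2, y3, y4⟩ := key (w - c'.reg 48) le_rfl (by omega) (by omega) (by omega)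
        exact ⟨by omega, by omega, ⟨mask_lt (by omega), by omega⟩, by omega, ha,
          ⟨y, y1, y2, y3, fun h => y4 (by omega), by omega, by omega, by omega, by omega,
            by omega⟩, by omega, by omega⟩
    · intro h0
      refine hQ _ ?_ ?_ ?_ (by simp; omega) ?_
      · intro y hy
        simp (disch := omega) [hr]
      · intro a ha
        simp (disch := omega) [har]
      · rw [show p + g = x by omega]
        simpa using i2
      · have := Nat.mul_le_mul_right 50 i7
        simp
        omega

/-- Register `52` gets the word length. -/
def wordLength : Cmd :=
  51 ≔ rg 50 ;; 52 ≔ ct 0 ;;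
  .loop (rg 51) (51 ≔ rg 51 /ₑ ct 2 ;; 52 ≔ rg 52 +ₑ ct 1)

theorem wordLength_spec {w K n L : ℕ} (hf : Fits w K n L) {c : Cfg} {Q : Cfg → Prop}
    (h50 : c.reg 50 = 2 ^ w - 1)
    (hQ : ∀ c', (∀ x, x < 51 → c'.reg x = c.reg x) → c'.arr = c.arr → c'.reg 52 = w →
      c.t ≤ c'.t → c'.t ≤ c.t + w * 20 + 20 → Q c') :
    vc w K wordLength Q c := by
  have g3 := hf.two_le_w
  have g4 : w < 2 ^ w := Nat.lt_two_pow_self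
  simp only [wordLength, vc]
  simp
  refine wp_loop hf.w_pos (fun c' => c'.reg 52 ≤ w ∧ c'.reg 51 = 2 ^ (w - c'.reg 52) - 1 ∧
    c.t ≤ c'.t ∧ c'.t ≤ c.t + c'.reg 52 * 20 + 10) (fun c' => c'.reg 51) ?_ ?_
  · simp [h50]; omega
  · rintro c' ⟨i1, i2, i3, i4⟩ hF
    obtain ⟨hr, har⟩ := hF
    simp at hr har
    simp
    constructor
    · intro hpos
      obtain ⟨d, hd⟩ : ∃ d, w - c'.reg 52 = d + 1 := by
        refine ⟨w - c'.reg 52 - 1, ?_⟩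
        rcases Nat.eq_zero_or_pos (w - c'.reg 52) with h0 | h0
        · rw [h0] at i2; simp at i2; omega
        · omega
      rw [hd, pow_succ] at i2
      have : w - (c'.reg 52 + 1) = d := by omega
      rw [this]
      exact ⟨by omega, by omega, ⟨by omega, by omega, by omega, by omega⟩, by omega⟩
    · intro h0
      have he : c'.reg 52 = w := by
        rw [h0] at i2
        have h1 : 2 ^ (w - c'.reg 52) ≤ 2 ^ 0 := by simp; omega
        have := (Nat.pow_le_pow_iff_right (by omega)).1 h1
        omega
      refine hQ _ (fun x hx => ?_) (by ext a; simp [har]) (by simp [he]) (by simp; omega) ?_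
      · simp (disch := omega) [hr]
        simp (disch := omega) [show x ≠ 51 by omega, show x ≠ 52 by omega]
      · rw [he] at i4; simp; omega

/-- The bitvector, from the recorded positions and their values. -/
def bitPhase : Cmd :=
  wordLength ;; 42 ≔ ct 0 ;;
  .loop (rg 42 <ₑ rg 33)
    (.load 45 15 (rg 42) ;; .load 46 3 (rg 42) ;; 42 ≔ rg 42 +ₑ ct 1 ;;
    .cond (rg 42 <ₑ rg 33) (.load 47 15 (rg 42) ;; 47 ≔ rg 47 -ₑ rg 45)
      (47 ≔ (rg 0 -ₑ rg 45) +ₑ ct 1) ;;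
    46 ≔ rg 46 +ₑ (rg 45 -ₑ ct 1) ;;
    48 ≔ rg 45 %ₑ rg 52 +ₑ rg 46 %ₑ rg 52 ;;
    49 ≔ (rg 45 /ₑ rg 52 +ₑ rg 46 /ₑ rg 52) +ₑ rg 48 /ₑ rg 52 ;;
    48 ≔ rg 48 %ₑ rg 52 ;; setBits)

/-- The recorded position after the `i`-th one. -/
def nextPosition (n cnt : ℕ) (J : ℕ → ℕ) (i : ℕ) : ℕ := if i + 1 < cnt then J (i + 1) else n + 1

theorem Recorded.mem_iff {n r : ℕ} {psi lam : ℕ → ℕ} {cnt : ℕ} {J R E : ℕ → ℕ}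
    (hR : Recorded r psi lam n cnt J R E) {u : ℕ} (hu : u < n) :
    (∃ i < cnt, J i = u + 1) ↔ Start r psi lam (psi^[u] 0) := by
  have h1 : (∃ i < cnt, J i = u + 1) ↔ u + 1 ∈ entries J cnt := by
    simp [entries]
  rw [h1, hR.J_eq]
  simp [startPositions, hu]

theorem Recorded.lt_next {n r : ℕ} {psi lam : ℕ → ℕ} {cnt : ℕ} {J R E : ℕ → ℕ}
    (hR : Recorded r psi lam n cnt J R E) {i : ℕ} (hi : i < cnt) :
    J i < nextPosition n cnt J i ∧ nextPosition n cnt J i ≤ n + 1 := by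
  unfold nextPosition
  split_ifs with h
  · exact ⟨hR.J_lt (Nat.lt_succ_self i) h, by have := hR.J_mem h; omega⟩
  · have := hR.J_mem hi; omega

theorem Recorded.not_start {n r : ℕ} {psi lam : ℕ → ℕ} {cnt : ℕ} {J R E : ℕ → ℕ}
    (hR : Recorded r psi lam n cnt J R E) {i u : ℕ} (hi : i < cnt) (h1 : J i ≤ u)
    (h2 : u + 1 < nextPosition n cnt J i) : ¬ Start r psi lam (psi^[u] 0) := by
  have h3 := (hR.lt_next hi).2
  rw [← hR.mem_iff (by omega)]
  rintro ⟨k, hk, hke⟩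
  rcases lt_trichotomy k i with h | rfl | h
  · have := hR.J_lt h hi; omega
  · omega
  · unfold nextPosition at h2
    rw [if_pos (by omega)] at h2
    rcases (Nat.succ_le_of_lt h).lt_or_eq with h' | rfl
    · have := hR.J_lt h' hk; simp only [Nat.succ_eq_add_one] at this; omega
    · simp only [Nat.succ_eq_add_one] at hke; omega

/-- Position `1` is always recorded, because row `0` satisfies `Start`; hence there is a last
recorded position not beyond `j`. -/
theorem Recorded.exists_chain {n r : ℕ} {F psi lam sym ell : ℕ → ℕ}
    (h : RowSystem n r F psi lam sym ell) {cnt : ℕ} {J R E : ℕ → ℕ}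
    (hR : Recorded r psi lam n cnt J R E) {j : ℕ} (h1 : 1 ≤ j) (h2 : j ≤ n) :
    ∃ i < cnt, J i ≤ j ∧ j < nextPosition n cnt J i := by
  classical
  obtain ⟨i₀, hi₀, h0⟩ := (hR.mem_iff h.n_pos).2 h.start_zero
  set S := (Finset.range cnt).filter fun i => J i ≤ j
  have hS : S.Nonempty := ⟨i₀, by simp [S, hi₀]; omega⟩
  have hm := S.max'_mem hS
  obtain ⟨m1, m2⟩ := Finset.mem_filter.1 hm
  refine ⟨S.max' hS, Finset.mem_range.1 m1, m2, ?_⟩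
  unfold nextPosition
  split_ifs with hn
  · by_contra hlt
    have := S.le_max' (S.max' hS + 1) (Finset.mem_filter.2 ⟨Finset.mem_range.2 hn, by omega⟩)
    omega
  · omega

/-- The bits of the chain that begins at the `i`-th recorded position. -/
def chainBits (n cnt : ℕ) (J V : ℕ → ℕ) (i x : ℕ) : Prop :=
  2 * J i + V i - 1 ≤ x ∧ x < 2 * J i + V i - 1 + (nextPosition n cnt J i - J i)

/-- Between recorded positions PLCP drops by exactly one per position, so `2 * j + PLCP[j]` runs
through consecutive integers. Bits are counted from `0` here, hence `x + 1`. -/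
theorem Recorded.chainBits_iff {n r : ℕ} {F psi lam sym ell : ℕ → ℕ}
    (h : RowSystem n r F psi lam sym ell) {cnt : ℕ} {J R E V : ℕ → ℕ}
    (hR : Recorded r psi lam n cnt J R E) (hV : ∀ i < cnt, V i = ell (psi^[J i] 0)) (x : ℕ) :
    (∃ i < cnt, chainBits n cnt J V i x) ↔
      ∃ j, 1 ≤ j ∧ j ≤ n ∧ x + 1 = 2 * j + ell (psi^[j] 0) := by
  have chain : ∀ i < cnt, ∀ g, J i + g < nextPosition n cnt J i →
      V i = ell (psi^[J i + g] 0) + g := by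
    intro i hi g hg
    rw [hV i hi]
    exact h.ell_row_eq _ _ fun u hu hu' => hR.not_start hi hu (by omega)
  constructor
  · rintro ⟨i, hi, h1, h2⟩
    have h3 := hR.J_mem hi
    have h4 := hR.lt_next hi
    have h5 := chain i hi (x - (2 * J i + V i - 1)) (by omega)
    exact ⟨J i + (x - (2 * J i + V i - 1)), by omega, by omega, by omega⟩
  · rintro ⟨j, h1, h2, h3⟩
    obtain ⟨i, hi, h4, h5⟩ := hR.exists_chain h h1 h2
    have h6 := chain i hi (j - J i) (by omega)
    rw [Nat.add_sub_cancel' h4] at h6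
    have := hR.J_mem hi
    exact ⟨i, hi, by omega, by omega⟩

-- In text order the chains occupy disjoint intervals from left to right, because `j + PLCP[j]` does
-- not decrease. With `y` the end of the last interval, the word costs telescope to `2 * n / w`,
-- plus a constant per chain.
set_option maxHeartbeats 1000000 in
theorem bitPhase_spec {w K n L : ℕ} (hf : Fits w K n L) {r : ℕ} {F psi lam sym ell : ℕ → ℕ}
    (h : RowSystem n r F psi lam sym ell) {c : Cfg} {Q : Cfg → Prop}
    (h0 : c.reg 0 = n) (h50 : c.reg 50 = 2 ^ w - 1) (h2 : ∀ q, c.arr 2 q = 0)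
    (hR : Recorded r psi lam n (c.reg 33) (c.arr 15) (c.arr 16) (c.arr 17))
    (hV : ∀ i < c.reg 33, c.arr 3 i = ell (psi^[c.arr 15 i] 0))
    (hK : 2 * n / w + 1 < K) (hrK : r < K)
    (hQ : ∀ c', Bits w (c'.arr 2) (fun x => ∃ j, 1 ≤ j ∧ j ≤ n ∧ x + 1 = 2 * j + ell (psi^[j] 0)) →
      c'.t ≤ c.t + w * 20 + r * 200 + 2 * n / w * 50 + 40 → Q c') :
    vc w K bitPhase Q c := by
  have g3 := hf.two_le_w
  have g4 := hf.lt
  have g5 := hf.w_pos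
  have hcnt := hR.cnt_le h
  have hrn := h.r_le
  simp only [bitPhase, vc]
  refine wordLength_spec hf h50 ?_
  intro c₁ a1 a2 a3 a4 a5
  simp
  generalize hC : c.reg 33 = cnt at *
  generalize hJ : c.arr 15 = J at *
  generalize hVV : c.arr 3 = V at *
  refine wp_loop g5 (fun c' => c'.reg 42 ≤ cnt ∧
    Bits w (c'.arr 2) (fun x => ∃ i < c'.reg 42, chainBits n cnt J V i x) ∧
    ∃ y, y ≤ 2 * n ∧ (∀ i, c'.reg 42 ≤ i → i < cnt → y ≤ 2 * J i + V i - 1) ∧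
      c₁.t ≤ c'.t ∧ c'.t ≤ c₁.t + c'.reg 42 * 200 + y / w * 50 + 10)
    (fun c' => cnt - c'.reg 42) ?_ ?_
  · refine ⟨by simp, ?_, 0, by simp, by simp, by simp, by simp⟩
    intro q b hb
    simp [a2, h2]
  · rintro c' ⟨i1, i2, y, i3, i4, i5, i6⟩ hF
    obtain ⟨hr, har⟩ := hF
    simp [setBits] at hr har
    simp [hr, har, a1, a2, a3, h0, hC, hJ, hVV]
    constructor
    · intro hlt
      have hj := hR.J_mem hlt
      have hnx := hR.lt_next hlt
      have hVi := hV _ hlt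
      have hell := h.ell_le hj.2
      have hlater : ∀ i, c'.reg 42 + 1 ≤ i → i < cnt →
          2 * J (c'.reg 42) + V (c'.reg 42) - 1 +
            (nextPosition n cnt J (c'.reg 42) - J (c'.reg 42)) ≤ 2 * J i + V i - 1 := by
        intro i hi hic
        have b1 := hR.J_lt (show c'.reg 42 < i by omega) hic
        have b2 := h.ell_row_ge (J (c'.reg 42)) (J i - J (c'.reg 42))
        rw [Nat.add_sub_cancel' b1.le, ← hVi, ← hV i hic] at b2
        have b3 : nextPosition n cnt J (c'.reg 42) ≤ J i := by
          unfold nextPosition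
          rw [if_pos (by omega)]
          rcases hi.lt_or_eq with hi | rfl
          · exact (hR.J_lt hi hic).le
          · exact le_rfl
        omega
      have i4' := i4 _ le_rfl hlt
      rw [← hVi] at hell
      have hnext : (c'.reg 42 + 1 < cnt →
          nextPosition n cnt J (c'.reg 42) = J (c'.reg 42 + 1)) ∧ (cnt ≤ c'.reg 42 + 1 →
          nextPosition n cnt J (c'.reg 42) = n + 1) := by
        unfold nextPosition
        exact ⟨fun hc => if_pos hc, fun hc => if_neg (by omega)⟩
      generalize hj' : J (c'.reg 42) = j at *
      generalize hv : V (c'.reg 42) = v at *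
      generalize hN : nextPosition n cnt J (c'.reg 42) = N at *
      -- The bit number `2 * j + v - 1` may overflow a word, so its quotient is assembled from two
      -- summands that fit and the carry of their remainders.
      have hdiv : j / w + (v + (j - 1)) / w + (j % w + (v + (j - 1)) % w) / w =
          (2 * j + v - 1) / w := by
        have e1 := Nat.div_add_mod j w
        have e2 := Nat.div_add_mod (v + (j - 1)) w
        have e3 : 2 * j + v - 1 = (j % w + (v + (j - 1)) % w) +
            w * (j / w + (v + (j - 1)) / w) := by
          rw [mul_add]; omega
        rw [e3, Nat.add_mul_div_left _ _ g5]
        omega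
      have hmod : (j + (v + (j - 1))) % w = (2 * j + v - 1) % w := by congr 1; omega
      have hdn : (2 * j + v - 1) / w ≤ n := Nat.div_le_of_le_mul (by
        have := Nat.mul_le_mul_right n g3
        omega)
      have hd0 := Nat.zero_le ((j % w + (v + (j - 1)) % w) / w)
      have hww : 2 * w ≤ 2 ^ w := by
        obtain ⟨d, rfl⟩ : ∃ d, w = d + 1 := ⟨w - 1, by omega⟩
        have : d < 2 ^ d := Nat.lt_two_pow_self
        rw [pow_succ]
        omega
      have hm1 : j % w < w := Nat.mod_lt _ g5
      have hm2 : (v + (j - 1)) % w < w := Nat.mod_lt _ g5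
      have main : ∀ (Q' : Cfg → Prop) (c₂ : Cfg), c₂.reg 52 = w → c₂.reg 50 = 2 ^ w - 1 →
          c₂.reg 42 = c'.reg 42 + 1 →
          c₂.reg 47 = N - j → c₂.reg 48 = (j + (v + (j - 1))) % w → c₂.reg 49 = j / w +
          (v + (j - 1)) / w + (j % w + (v + (j - 1)) % w) / w → c₂.arr = c'.arr → c'.t ≤ c₂.t →
          c₂.t ≤ c'.t + 80 →
          (∀ c'', c''.reg 42 = c'.reg 42 + 1 →
            Bits w (c''.arr 2) (fun x => ∃ i < c'.reg 42 + 1, chainBits n cnt J V i x) →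
            c₁.t ≤ c''.t → c''.t ≤ c₁.t + (c'.reg 42 + 1) * 200 +
              (2 * j + v - 1 + (N - j)) / w * 50 + 10 → Q' c'') → vc w K setBits Q' c₂ := by
        intro Q' c₂ d1 d2 d3 d4 d5 d6 d7 d8 d9 d10
        refine setBits_spec hf (p := 2 * j + v - 1) (g := N - j) (B := fun x => ∃ i < c'.reg 42,
          chainBits n cnt J V i x) d1 d2 d4 (by rw [d5, hmod]) (by rw [d6, hdiv])
          (by rw [d7]; exact i2) (by omega) (by omega) hK ?_
        intro c'' f1 f2 f3 f4 f5
        refine d10 c'' (by rw [f1 42 (by omega), d3]) ?_ (by omega) ?_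
        · intro q b hb
          rw [f3 q b hb]
          simp only [Nat.lt_succ_iff_lt_or_eq, or_and_right, exists_or, exists_eq_left]
          refine or_congr_right ?_
          rw [chainBits, hj', hv, hN]
        · have e1 := Nat.mul_le_mul_right 50 (Nat.div_le_div_right (c := w) i4')
          rw [add_mul] at f5
          omega
      have fin : ∀ c'' : Cfg, c''.reg 42 = c'.reg 42 + 1 →
          Bits w (c''.arr 2) (fun x => ∃ i < c'.reg 42 + 1, chainBits n cnt J V i x) →
          c₁.t ≤ c''.t → c''.t ≤ c₁.t + (c'.reg 42 + 1) * 200 +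
              (2 * j + v - 1 + (N - j)) / w * 50 + 10 →
          (c''.reg 42 ≤ cnt ∧ (Bits w (c''.arr 2) fun x => ∃ i < c''.reg 42,
            chainBits n cnt J V i x) ∧ ∃ y ≤ 2 * n,
            (∀ (i : ℕ), c''.reg 42 ≤ i → i < cnt → y ≤ 2 * J i + V i - 1) ∧
            c₁.t ≤ c''.t ∧ c''.t ≤ c₁.t + c''.reg 42 * 200 + y / w * 50 + 10) ∧
            cnt - c''.reg 42 < cnt - c'.reg 42 := by
        intro c'' f1 f2 f3 f4
        rw [f1]
        exact ⟨⟨hlt, f2, _, by omega, hlater, f3, f4⟩, by omega⟩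
      refine ⟨by omega, by omega, fun hc => ?_, fun hc => ?_⟩
      · have hn1 := hnext.1 hc
        refine ⟨by omega, by omega, by omega, by omega, by omega, ?_⟩
        refine main _ _ ?_ ?_ ?_ ?_ ?_ ?_ rfl ?_ ?_ fin
        · simp [hr, a3]
        · simp [hr, a1, h50]
        · simp
        · simp [hn1]
        · simp
        · simp
        · simp; omega
        · simp
      · have hn1 := hnext.2 hc
        refine ⟨by omega, by omega, by omega, by omega, ?_⟩
        refine main _ _ ?_ ?_ ?_ ?_ ?_ ?_ rfl ?_ ?_ fin
        · simp [hr, a3]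
        · simp [hr, a1, h50]
        · simp
        · simp; omega
        · simp
        · simp
        · simp; omega
        · simp
    · intro hge
      have he : c'.reg 42 = cnt := by omega
      rw [he] at i2 i6
      refine hQ _ ?_ ?_
      · intro q b hb
        exact (i2 q b hb).trans (hR.chainBits_iff h hV _)
      · have e1 := Nat.mul_le_mul_right 50 (Nat.div_le_div_right (c := w) i3)
        simp
        omega

end RunLengthBWT

namespace RunLengthBWT
open WordRAM

/-! ## The row system of a text -/

section suffixArray
variable (T : List ℕ)

theorem saList_perm : (saList T).Perm (List.range' 1 T.length) := List.mergeSort_perm _ _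

theorem saList_length : (saList T).length = T.length := by
  rw [(saList_perm T).length_eq, List.length_range']

theorem saList_nodup : (saList T).Nodup :=
  (saList_perm T).nodup_iff.2 (List.nodup_range' (step := 1))

variable {T}

theorem mem_saList {j : ℕ} : j ∈ saList T ↔ 1 ≤ j ∧ j ≤ T.length := by
  rw [(saList_perm T).mem_iff, List.mem_range'_1]; omega

theorem SA_mem {x : ℕ} (hx : x < T.length) : 1 ≤ SA T (x + 1) ∧ SA T (x + 1) ≤ T.length := by
  have h : x < (saList T).length := by rwa [saList_length]
  rw [← mem_saList, SA, Nat.add_sub_cancel, List.getD_eq_getElem _ _ h]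
  exact List.getElem_mem h

theorem ISA_le {j : ℕ} (h1 : 1 ≤ j) (h2 : j ≤ T.length) : ISA T j - 1 < T.length := by
  have := List.idxOf_lt_length_of_mem (mem_saList.2 ⟨h1, h2⟩)
  rw [saList_length] at this
  simpa [ISA] using this

theorem SA_ISA {j : ℕ} (h1 : 1 ≤ j) (h2 : j ≤ T.length) : SA T (ISA T j) = j := by
  have h := List.idxOf_lt_length_of_mem (mem_saList.2 ⟨h1, h2⟩)
  rw [SA, ISA, Nat.add_sub_cancel, List.getD_eq_getElem _ _ h]
  exact List.getElem_idxOf h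

theorem ISA_SA {x : ℕ} (hx : x < T.length) : ISA T (SA T (x + 1)) = x + 1 := by
  have h : x < (saList T).length := by rwa [saList_length]
  rw [SA, ISA, Nat.add_sub_cancel, List.getD_eq_getElem _ _ h, (saList_nodup T).idxOf_getElem]

theorem suffix_getD {j : ℕ} (hj : 1 ≤ j) (u : ℕ) : (suffix T j).getD u 0 = symbol T (j + u) := by
  rw [suffix, symbol, List.getD_eq_getElem?_getD, List.getD_eq_getElem?_getD, List.getElem?_drop]
  congr 2; omega

theorem suffix_length (j : ℕ) : (suffix T j).length = T.length - (j - 1) := List.length_drop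

theorem suffix_eq_cons {j : ℕ} (h1 : 1 ≤ j) (h2 : j ≤ T.length) :
    suffix T j = symbol T j :: suffix T (j + 1) := by
  rw [suffix, List.drop_eq_getElem_cons (by omega), suffix, symbol,
    List.getD_eq_getElem _ _ (by omega), Nat.add_sub_cancel, Nat.sub_add_cancel h1]

theorem suffix_SA_lt {x y : ℕ} (hxy : x < y) (hy : y < T.length) :
    suffix T (SA T (x + 1)) < suffix T (SA T (y + 1)) := by
  have hl := saList_length T
  have h : (saList T).Pairwise fun i j => decide (suffix T i ≤ suffix T j) = true :=
    List.pairwise_mergeSort (fun a b c hab hbc => by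
      simp only [decide_eq_true_eq] at *; exact le_trans hab hbc)
      (fun a b => by simpa using le_total _ _) _
  have h1 := List.pairwise_iff_getElem.1 h x y (by omega) (by omega) hxy
  rw [decide_eq_true_eq] at h1
  rw [SA, SA, Nat.add_sub_cancel, Nat.add_sub_cancel, List.getD_eq_getElem _ _ (by omega),
    List.getD_eq_getElem _ _ (by omega)]
  refine lt_of_le_of_ne h1 fun he => ?_
  have h2 := congrArg List.length he
  rw [suffix_length, suffix_length] at h2
  have h3 := mem_saList.1 (List.getElem_mem (l := saList T) (n := x) (by omega))
  have h4 := mem_saList.1 (List.getElem_mem (l := saList T) (n := y) (by omega))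
  have h5 := (saList_nodup T).getElem_inj_iff.1
    (show (saList T)[x]'(by omega) = (saList T)[y]'(by omega) by omega)
  omega

end suffixArray

theorem lcp_spec (x y : List ℕ) :
    (∀ u < lcp x y, u < x.length ∧ u < y.length ∧ x.getD u 0 = y.getD u 0) ∧
    (lcp x y < x.length → lcp x y < y.length → x.getD (lcp x y) 0 ≠ y.getD (lcp x y) 0) := by
  induction x generalizing y with
  | nil => simp [lcp]
  | cons a x ih =>
    cases y with
    | nil => simp [lcp]
    | cons b y =>
      simp only [lcp]
      split_ifs with hab
      · obtain ⟨h1, h2⟩ := ih y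
        refine ⟨fun u hu => ?_, fun h3 h4 => ?_⟩
        · cases u with
          | zero => simp [hab]
          | succ u => simpa using h1 u (by omega)
        · simpa using h2 (by simpa using h3) (by simpa using h4)
      · simp [hab]

/-- The row of the next text position. -/
def nextRow (T : List ℕ) (x : ℕ) : ℕ := ISA T (SA T (x + 1) % T.length + 1) - 1

/-- The first symbol of a row. -/
def rowSymbol (T : List ℕ) (x : ℕ) : ℕ := symbol T (SA T (x + 1))

/-- The indices of the starts of the runs. -/
def runIndices (T : List ℕ) : List ℕ :=
  (List.range' 1 T.length).filter fun i => decide (IsRunStart T i)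

/-- The first row of a run. -/
def runRow (T : List ℕ) (k : ℕ) : ℕ := (runIndices T).getD k (T.length + 1) - 1

/-- The symbol of a run. -/
def runSymbol (T : List ℕ) (k : ℕ) : ℕ := BWT T ((runIndices T).getD k 0)

/-- The length of the common prefix of a row and the row before. -/
def rowLCP (T : List ℕ) (x : ℕ) : ℕ := LCP T (x + 1)

section text
variable {σ : ℕ} {T : List ℕ}

theorem IsText.length_pos (h : IsText σ T) : 0 < T.length := by
  obtain ⟨S, rfl, -⟩ := h; simp

theorem IsText.symbol_length (h : IsText σ T) : symbol T T.length = 0 := by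
  obtain ⟨S, rfl, -⟩ := h; simp [symbol]

theorem IsText.symbol_mem (h : IsText σ T) {j : ℕ} (h1 : 1 ≤ j) (h2 : j < T.length) :
    1 ≤ symbol T j ∧ symbol T j ≤ σ := by
  obtain ⟨S, rfl, hS⟩ := h
  simp only [List.length_append, List.length_singleton] at h2
  rw [symbol, List.getD_append _ _ _ _ (by omega), List.getD_eq_getElem _ _ (by omega)]
  exact hS _ (List.getElem_mem _)

/-- A suffix smaller than the sentinel alone would begin with a symbol below `0`, or continue with
something smaller than the empty string. -/
theorem IsText.SA_one (h : IsText σ T) : SA T 1 = T.length := by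
  have h0 := h.length_pos
  by_contra hne
  have h1 := ISA_le (T := T) h0 le_rfl
  have h2 := SA_ISA (T := T) h0 le_rfl
  have hi : ISA T T.length = ISA T T.length - 1 + 1 := by simp [ISA]
  have h3 : 0 < ISA T T.length - 1 := by
    rcases Nat.eq_zero_or_pos (ISA T T.length - 1) with h4 | h4
    · rw [hi, h4] at h2; exact absurd h2 hne
    · exact h4
  have h4 := suffix_SA_lt h3 h1
  rw [← hi, h2, suffix_eq_cons (SA_mem h0).1 (SA_mem h0).2, suffix_eq_cons h0 le_rfl,
    h.symbol_length, List.cons_lt_cons_iff] at h4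
  rcases h4 with h4 | ⟨-, h4⟩
  · omega
  · rw [show suffix T (T.length + 1) = [] by simp [suffix]] at h4
    exact absurd h4 (List.not_lt_nil _)

theorem IsText.ISA_length (h : IsText σ T) : ISA T T.length = 1 := by
  rw [← h.SA_one]; exact ISA_SA h.length_pos

theorem ISA_pos (j : ℕ) : ISA T j - 1 + 1 = ISA T j := by simp [ISA]

theorem SA_nextRow {x : ℕ} (hx : x < T.length) :
    SA T (nextRow T x + 1) = SA T (x + 1) % T.length + 1 := by
  rw [nextRow, ISA_pos]
  exact SA_ISA (by omega) (Nat.mod_lt _ (by omega))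

/-- Row `0` belongs to position `n`, so the first step wraps around to position `1`; this makes the
number of steps equal to the position. -/
theorem IsText.iterate_nextRow (h : IsText σ T) {t : ℕ} (h1 : 1 ≤ t) (h2 : t ≤ T.length) :
    (nextRow T)^[t] 0 = ISA T t - 1 := by
  induction t, h1 using Nat.le_induction with
  | base => rw [Function.iterate_one, nextRow, zero_add, h.SA_one, Nat.mod_self]
  | succ t ht ih =>
    rw [Function.iterate_succ_apply', ih (by omega), nextRow, ISA_pos, SA_ISA ht (by omega),
      Nat.mod_eq_of_lt (by omega)]

theorem iterate_nextRow_SA {x u : ℕ} (hx : x < T.length) (hu : SA T (x + 1) + u ≤ T.length) :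
    (nextRow T)^[u] x < T.length ∧ SA T ((nextRow T)^[u] x + 1) = SA T (x + 1) + u := by
  induction u with
  | zero => exact ⟨hx, rfl⟩
  | succ u ih =>
    obtain ⟨h1, h2⟩ := ih (by omega)
    rw [Function.iterate_succ_apply', SA_nextRow h1, h2, Nat.mod_eq_of_lt (by omega)]
    exact ⟨ISA_le (by omega) (Nat.mod_lt _ (by omega)), rfl⟩

theorem SA_inj {x y : ℕ} (hx : x < T.length) (hy : y < T.length) (h : SA T (x + 1) = SA T (y + 1)) :
    x = y := by
  have := ISA_SA hx
  rw [h, ISA_SA hy] at this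
  omega

theorem IsText.rowSymbol_zero_iff (h : IsText σ T) {x : ℕ} (hx : x < T.length) :
    rowSymbol T x = 0 ↔ x = 0 := by
  constructor
  · intro h0
    by_contra hne
    have h1 := SA_mem hx
    have h2 : SA T (x + 1) ≠ T.length := fun he => hne (SA_inj hx h.length_pos (by rw [he, h.SA_one]))
    have h3 := h.symbol_mem h1.1 (by omega)
    rw [rowSymbol] at h0
    omega
  · rintro rfl
    rw [rowSymbol, zero_add, h.SA_one, h.symbol_length]

/-- The symbol preceding the next text position is the symbol at the current one; at the wrap-around
both are the sentinel. -/
theorem BWT_nextRow {x : ℕ} (hx : x < T.length) : BWT T (nextRow T x + 1) = rowSymbol T x := by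
  have h1 := SA_mem hx
  rw [BWT, SA_nextRow hx, rowSymbol]
  rcases h1.2.lt_or_eq with h2 | h2
  · rw [Nat.mod_eq_of_lt h2, if_pos (by omega), Nat.add_sub_cancel]
  · rw [h2, Nat.mod_self, if_neg (by omega)]

theorem mem_runIndices {i : ℕ} : i ∈ runIndices T ↔ (1 ≤ i ∧ i ≤ T.length) ∧ IsRunStart T i := by
  rw [runIndices, List.mem_filter, List.mem_range'_1, decide_eq_true_eq]
  exact and_congr_left fun _ => by omega

theorem runIndices_pairwise : (runIndices T).Pairwise (· < ·) :=
  (List.pairwise_lt_range' (step := 1)).filter _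

theorem numRuns_eq : numRuns T = (runIndices T).length := by
  rw [numRuns, RLBWT, List.length_map, runIndices]

theorem runRow_of_lt {k : ℕ} (hk : k < numRuns T) :
    runRow T k + 1 ∈ runIndices T ∧ (runIndices T).getD k 0 = runRow T k + 1 := by
  rw [numRuns_eq] at hk
  have h1 := List.getElem_mem hk
  have h2 := mem_runIndices.1 h1
  rw [runRow, List.getD_eq_getElem _ _ hk, List.getD_eq_getElem _ _ hk, Nat.sub_add_cancel h2.1.1]
  exact ⟨h1, rfl⟩

/-- The default value in `runRow` is chosen so that the list of run starts is closed off by `n`. -/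
theorem runRow_numRuns : runRow T (numRuns T) = T.length := by
  rw [runRow, List.getD_eq_default _ _ (by rw [numRuns_eq])]; simp

theorem runRow_lt {k : ℕ} (hk : k < numRuns T) : runRow T k < runRow T (k + 1) := by
  rcases (Nat.succ_le_of_lt hk).lt_or_eq with h | h
  · have h1 := (runRow_of_lt hk).2
    have h2 := (runRow_of_lt h).2
    rw [numRuns_eq] at hk h
    rw [List.getD_eq_getElem _ _ hk] at h1
    rw [List.getD_eq_getElem _ _ h] at h2
    have := List.pairwise_iff_getElem.1 (runIndices_pairwise (T := T)) k (k + 1) hk h (by omega)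
    simp only [Nat.succ_eq_add_one] at h2
    omega
  · have := (mem_runIndices.1 (runRow_of_lt hk).1).1
    simp only [Nat.succ_eq_add_one] at h
    rw [h, runRow_numRuns]
    omega

theorem exists_runRow {x : ℕ} (hx : x < T.length) :
    (∃ k < numRuns T, x = runRow T k) ↔ IsRunStart T (x + 1) := by
  constructor
  · rintro ⟨k, hk, rfl⟩
    exact (mem_runIndices.1 (runRow_of_lt hk).1).2
  · intro h
    have : x + 1 ∈ runIndices T := mem_runIndices.2 ⟨by omega, h⟩
    obtain ⟨k, hk, hke⟩ := List.getElem_of_mem this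
    have hk' : k < numRuns T := by rwa [numRuns_eq]
    have := (runRow_of_lt hk').2
    rw [List.getD_eq_getElem _ _ hk] at this
    exact ⟨k, hk', by omega⟩

theorem runRow_mono {k l : ℕ} (hkl : k < l) (hl : l ≤ numRuns T) : runRow T k < runRow T l := by
  induction l, hkl using Nat.le_induction with
  | base => exact runRow_lt (by omega)
  | succ l h ih => exact (ih (by omega)).trans (runRow_lt (by omega))

theorem BWT_of_run {k y : ℕ} (hk : k < numRuns T) (h1 : runRow T k ≤ y) (h2 : y < runRow T (k + 1)) :
    BWT T (y + 1) = runSymbol T k := by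
  induction y, h1 using Nat.le_induction with
  | base => rw [runSymbol, (runRow_of_lt hk).2]
  | succ y hy ih =>
    rw [← ih (by omega)]
    have hlast : runRow T (k + 1) ≤ T.length := by
      rcases (Nat.succ_le_of_lt hk).lt_or_eq with h | h
      · rw [← runRow_numRuns]; exact (runRow_mono h le_rfl).le
      · simp only [Nat.succ_eq_add_one] at h; rw [h, runRow_numRuns]
    by_contra hne
    have h3 : IsRunStart T (y + 1 + 1) := Or.inr (by simpa using hne)
    obtain ⟨l, hl, hle⟩ := (exists_runRow (by omega)).2 h3
    rcases lt_trichotomy l k with h | rfl | h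
    · have := runRow_mono h hk.le; omega
    · omega
    · rcases (Nat.succ_le_of_lt h).lt_or_eq with h' | h'
      · have := runRow_mono h' hl.le; simp only [Nat.succ_eq_add_one] at this; omega
      · simp only [Nat.succ_eq_add_one] at h'; rw [h'] at h2; omega

/-- Iterating `nextRow` reads the text cyclically, whereas `lcp` compares suffixes. The two agree
because the unique sentinel produces a mismatch before either suffix is exhausted. -/
theorem IsText.rowLCP_spec (h : IsText σ T) {x : ℕ} (h0 : 0 < x) (hx : x < T.length) :
    (∀ u < rowLCP T x, rowSymbol T ((nextRow T)^[u] (x - 1)) = rowSymbol T ((nextRow T)^[u] x)) ∧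
    rowSymbol T ((nextRow T)^[rowLCP T x] (x - 1)) ≠ rowSymbol T ((nextRow T)^[rowLCP T x] x) := by
  have hx' : x - 1 < T.length := by omega
  have hell : rowLCP T x = lcp (suffix T (SA T (x + 1))) (suffix T (SA T (x - 1 + 1))) := by
    rw [rowLCP, LCP, if_neg (by omega), Nat.add_sub_cancel, Nat.sub_add_cancel h0]
  have hne : SA T (x + 1) ≠ SA T (x - 1 + 1) := fun he => by
    have := SA_inj hx hx' he; omega
  obtain ⟨l1, l2⟩ := lcp_spec (suffix T (SA T (x + 1))) (suffix T (SA T (x - 1 + 1)))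
  rw [← hell, suffix_length, suffix_length] at l1 l2
  have hi := SA_mem hx
  have hj := SA_mem hx'
  have hrow : ∀ y < T.length, ∀ u, SA T (y + 1) + u ≤ T.length →
      rowSymbol T ((nextRow T)^[u] y) = symbol T (SA T (y + 1) + u) := fun y hy u hu => by
    rw [rowSymbol, (iterate_nextRow_SA hy hu).2]
  rw [suffix_getD hi.1, suffix_getD hj.1] at l2
  have hrx := hrow x hx
  have hry := hrow _ hx'
  generalize SA T (x + 1) = i at *
  generalize hj' : SA T (x - 1 + 1) = j at *
  have key : ∀ u < rowLCP T x, symbol T (i + u) = symbol T (j + u) ∧ i + u < T.length ∧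
      j + u < T.length := by
    intro u hu
    obtain ⟨a1, a2, a3⟩ := l1 u hu
    rw [suffix_getD hi.1, suffix_getD hj.1] at a3
    have b1 : i + u ≠ T.length := fun he => by
      rw [he, h.symbol_length] at a3
      have := h.symbol_mem (j := j + u) (by omega) (by omega)
      omega
    have b2 : j + u ≠ T.length := fun he => by
      rw [he, h.symbol_length] at a3
      have := h.symbol_mem (j := i + u) (by omega) (by omega)
      omega
    exact ⟨a3, by omega, by omega⟩
  have hend : i + rowLCP T x ≤ T.length ∧ j + rowLCP T x ≤ T.length := by
    rcases Nat.eq_zero_or_pos (rowLCP T x) with hz | hz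
    · omega
    · have := key (rowLCP T x - 1) (by omega); omega
  refine ⟨fun u hu => ?_, ?_⟩
  · obtain ⟨a1, a2, a3⟩ := key u hu
    rw [hrx u a2.le, hry u a3.le, a1]
  · rw [hrx _ hend.1, hry _ hend.2]
    exact (l2 (by omega) (by omega)).symm

theorem IsText.rowSystem (h : IsText σ T) (hσ : σ ≤ T.length) :
    RowSystem T.length (numRuns T) (rowSymbol T) (nextRow T) (runRow T) (runSymbol T) (rowLCP T) where
  n_pos := h.length_pos
  psi_lt x hx := ISA_le (by omega) (Nat.mod_lt _ h.length_pos)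
  psi_inj x hx y hy he := by
    have h1 := SA_nextRow hx
    rw [he, SA_nextRow hy] at h1
    have h2 := SA_mem hx
    have h3 := SA_mem hy
    refine SA_inj hx hy ?_
    have h4 : ∀ a, 1 ≤ a → a ≤ T.length → a % T.length = if a = T.length then 0 else a := by
      intro a _ ha
      split_ifs with hh
      · rw [hh, Nat.mod_self]
      · exact Nat.mod_eq_of_lt (by omega)
    rw [h4 _ h2.1 h2.2, h4 _ h3.1 h3.2] at h1
    split_ifs at h1 <;> omega
  orbit x hx := by
    have h1 := SA_mem hx
    rcases h1.2.lt_or_eq with h2 | h2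
    · exact ⟨_, h2, by rw [h.iterate_nextRow h1.1 h1.2, ISA_SA hx, Nat.add_sub_cancel]⟩
    · refine ⟨0, h.length_pos, ?_⟩
      exact SA_inj h.length_pos hx (h.SA_one.trans h2.symm)
  cycle := by rw [h.iterate_nextRow h.length_pos le_rfl, h.ISA_length]
  sorted x y hxy hy := by
    have hx := hxy.trans hy
    have h1 := suffix_SA_lt hxy hy
    have h2 := SA_mem hx
    have h3 := SA_mem hy
    rw [suffix_eq_cons h2.1 h2.2, suffix_eq_cons h3.1 h3.2, List.cons_lt_cons_iff] at h1
    rcases h1 with h1 | ⟨h1, h4⟩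
    · exact Or.inl h1
    · refine Or.inr ⟨h1, ?_⟩
      -- Neither row is the sentinel's: equal first symbols would otherwise make both row `0`. So
      -- the next positions do not wrap around, and the tails compare as suffixes.
      have hne : ∀ z < T.length, SA T (z + 1) = T.length → z = 0 := fun z hz he =>
        SA_inj hz h.length_pos (by rw [he, zero_add, h.SA_one])
      have h5 : SA T (y + 1) ≠ T.length := fun he => by have := hne y hy he; omega
      have h6 : SA T (x + 1) ≠ T.length := fun he => by
        have h7 := (h.rowSymbol_zero_iff hx).2 (hne x hx he)
        have h8 := (h.rowSymbol_zero_iff hy).1 (h1.symm.trans h7)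
        omega
      by_contra hlt
      have h7 := SA_nextRow hx
      have h8 := SA_nextRow hy
      rw [Nat.mod_eq_of_lt (by omega)] at h7 h8
      rw [← h7, ← h8] at h4
      rcases (not_lt.1 hlt).lt_or_eq with h9 | h9
      · exact lt_asymm h4 (suffix_SA_lt h9 (ISA_le (by omega) (Nat.mod_lt _ h.length_pos)))
      · rw [h9] at h4; exact lt_irrefl _ h4
  F_zero := (h.rowSymbol_zero_iff h.length_pos).2 rfl
  F_pos x h0 hx := Nat.pos_of_ne_zero fun he => h0.ne' ((h.rowSymbol_zero_iff hx).1 he)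
  F_le x hx := by
    have h1 := SA_mem hx
    rcases h1.2.lt_or_eq with h2 | h2
    · exact (h.symbol_mem h1.1 h2).2.trans hσ
    · rw [rowSymbol, h2, h.symbol_length]; omega
  lam_zero := by
    obtain ⟨k, hk, hke⟩ := (exists_runRow h.length_pos).2 (Or.inl rfl)
    rcases Nat.eq_zero_or_pos k with rfl | h0
    · exact hke.symm
    · have := runRow_mono h0 hk.le; omega
  lam_last := runRow_numRuns
  lam_lt k hk := runRow_lt hk
  F_run k hk x hx h1 h2 := by rw [← BWT_nextRow hx]; exact BWT_of_run hk h1 h2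
  ell_zero := by simp [rowLCP, LCP]
  ell_eq x h0 hx := (h.rowLCP_spec h0 hx).1
  ell_ne x h0 hx := (h.rowLCP_spec h0 hx).2

/-- `Start` looks one step ahead, so time `u` corresponds to text position `u + 1`. -/
theorem IsText.start_iff (h : IsText σ T) {u : ℕ} (hu : u < T.length) :
    Start (numRuns T) (nextRow T) (runRow T) ((nextRow T)^[u] 0) ↔ IsRunStart T (ISA T (u + 1)) := by
  rw [Start, ← Function.iterate_succ_apply' (nextRow T), h.iterate_nextRow (by omega) (by omega),
    exists_runRow (ISA_le (by omega) (by omega)), ISA_pos]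

theorem IsText.PLCP_eq (h : IsText σ T) {j : ℕ} (h1 : 1 ≤ j) (h2 : j ≤ T.length) :
    PLCP T j = rowLCP T ((nextRow T)^[j] 0) := by
  rw [h.iterate_nextRow h1 h2, rowLCP, ISA_pos, PLCP]

theorem IsText.irreducibleList_eq (h : IsText σ T) :
    irreducibleList T = (startPositions (numRuns T) (nextRow T) (runRow T) T.length).map
      fun j => (j, rowLCP T ((nextRow T)^[j] 0)) := by
  classical
  rw [irreducibleList, startPositions, List.range'_eq_map_range, List.filter_map, List.map_map,
    List.map_map]
  have h1 : (List.range T.length).filter ((fun j => decide (IsRunStart T (ISA T j))) ∘ (1 + ·)) =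
      (List.range T.length).filter fun u =>
        decide (Start (numRuns T) (nextRow T) (runRow T) ((nextRow T)^[u] 0)) := by
    refine List.filter_congr fun u hu => ?_
    simp only [Function.comp_apply, h.start_iff (List.mem_range.1 hu), add_comm 1 u]
  rw [h1]
  refine List.map_congr_left fun u hu => ?_
  have := List.mem_range.1 (List.mem_filter.1 hu).1
  simp only [Function.comp_apply, add_comm 1 u, h.PLCP_eq (show 1 ≤ u + 1 by omega) this]

theorem RLBWT_fst {k : ℕ} (hk : k < numRuns T) :
    ((RLBWT T).map Prod.fst).getD k 0 = runRow T k + 1 := by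
  rw [← (runRow_of_lt hk).2, RLBWT, List.map_map, runIndices]
  simp [Function.comp_def]

theorem RLBWT_snd {k : ℕ} (hk : k < numRuns T) :
    ((RLBWT T).map Prod.snd).getD k 0 = runSymbol T k := by
  rw [runSymbol, RLBWT, List.map_map]
  rw [numRuns_eq] at hk
  rw [List.getD_eq_getElem _ _ (by simpa [runIndices] using hk), List.getD_eq_getElem _ _ hk]
  simp [runIndices]

end text

end RunLengthBWT

namespace RunLengthBWT
open WordRAM

/-! ## The programs -/

/-- The positions and the values of the irreducible entries, in the arrays `15` and `3`. -/
def irreduciblePhase : Cmd :=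
  bitLength ;; radixSort ;; buildTable ;; squareUp ;; walk ;; lcpPhase

theorem _root_.WordRAM.Fits.length_pos {w K n L : ℕ} (hf : Fits w K n L) : 1 ≤ L := by
  by_contra hL
  have h1 := hf.lt_two_pow
  have h2 := hf.two_le
  rw [show L = 0 by omega, pow_zero] at h1
  omega

/-- The dominant terms are one binary search per block, about `n / L ^ 2 * L`, and the step-by-step
traversal of `O(s * r)` blocks of length `s`, which gives `r * L ^ 5`. -/
theorem time_bound {n r s L : ℕ} (hr : 1 ≤ r) (hL : 1 ≤ L) (hs : s ≤ 2 * L ^ 2)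
    (hG : n / s ≤ n / L ^ 2 + 3) :
    (20 * L + 20) + (L + 1) * (120 * r + 100) + (100 * r + 30) +
      (s * (r * (30 * L + 400) + 120) + 20) +
      (((n - 1) / s + 1) * (stepTime L + 70) +
        (2 * (s * r) + 1) * (s * (stepTime L + 70) + 30) + 40) +
      (r * (lcpTime s L + 150) + n / s * (2 * stepTime L + 30) + 30) ≤
    1000 * (n / L ^ 2 * L) + 10000 * (r * L ^ 5) := by
  have h1 : (n - 1) / s ≤ n / L ^ 2 + 3 := (Nat.div_le_div_right (by omega)).trans hG
  generalize (n - 1) / s = D₁ at *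
  generalize n / s = D₂ at *
  generalize n / L ^ 2 = G at *
  simp only [stepTime, lcpTime]
  have hX : ∀ b ≤ 5, r * L ^ b ≤ r * L ^ 5 := fun b hb =>
    Nat.mul_le_mul_left r (Nat.pow_le_pow_right hL hb)
  have hY : ∀ b ≤ 5, L ^ b ≤ r * L ^ 5 := fun b hb =>
    (Nat.le_mul_of_pos_left _ hr).trans (hX b hb)
  have hGL : G ≤ G * L := Nat.le_mul_of_pos_right _ hL
  have x0 := hX 0 (by omega); have x1 := hX 1 (by omega); have x2 := hX 2 (by omega)
  have x3 := hX 3 (by omega); have x4 := hX 4 (by omega); have x5 := hX 5 (by omega)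
  have y0 := hY 0 (by omega); have y1 := hY 1 (by omega); have y2 := hY 2 (by omega)
  have y3 := hY 3 (by omega); have y4 := hY 4 (by omega); have y5 := hY 5 (by omega)
  calc _ ≤ (20 * L + 20) + (L + 1) * (120 * r + 100) + (100 * r + 30) +
      ((2 * L ^ 2) * (r * (30 * L + 400) + 120) + 20) +
      (((G + 3) + 1) * (30 * L + 60 + 70) +
        (2 * ((2 * L ^ 2) * r) + 1) * ((2 * L ^ 2) * (30 * L + 60 + 70) + 30) + 40) +
      (r * ((2 * ((2 * L ^ 2) * (30 * L + 60 + 10)) + ((2 * L ^ 2) + 1) * (2 * (30 * L + 60) + 30) + 100)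
        + 150) + (G + 3) * (2 * (30 * L + 60) + 30) + 30) := by gcongr
    _ ≤ _ := by nlinarith

theorem irreduciblePhase_spec {w K n L : ℕ} (hf : Fits w K n L) {r : ℕ}
    {F psi lam sym ell : ℕ → ℕ} (h : RowSystem n r F psi lam sym ell) {c : Cfg} {Q : Cfg → Prop}
    (h0 : c.reg 0 = n) (h1 : c.reg 1 = r) (hlam : ∀ k < r, c.arr 0 k = lam k + 1)
    (hsym : ∀ k < r, c.arr 1 k = sym k) (hK : 2 * L ^ 2 * r + n / L ^ 2 + 3 < K)
    (hQ : ∀ c', c'.reg 0 = n → c'.arr 2 = c.arr 2 →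
      Recorded r psi lam n (c'.reg 33) (c'.arr 15) (c'.arr 16) (c'.arr 17) →
      (∀ i < c'.reg 33, c'.arr 3 i = ell (psi^[c'.arr 15 i] 0)) →
      c'.t ≤ c.t + (1000 * (n / L ^ 2 * L) + 10000 * (r * L ^ 5)) → Q c') :
    vc w K irreduciblePhase Q c := by
  have hrn := h.r_le
  have hr := h.r_pos
  have hq := Nat.zero_le (n / L ^ 2)
  have hL := hf.length_pos
  have hL2 : r ≤ 2 * L ^ 2 * r := Nat.le_mul_of_pos_left r (by positivity)
  have hkey : ∀ k < r, sym k ≤ n := by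
    intro k hk
    have hl := h.lam_lt k hk
    have hl' := h.lam_mono (show k + 1 ≤ r from hk) le_rfl
    rw [h.lam_last] at hl'
    obtain ⟨x, hx, hxe⟩ := h.psi_surj (y := lam k) (by omega)
    rw [← h.F_run k hk x hx hxe.ge (by omega)]
    exact h.F_le x hx
  simp only [irreduciblePhase, vc]
  refine bitLength_spec hf h0 ?_
  intro c₁ a1 a2 a3 a4 a5
  refine radixSort_spec hf (r := r) (by rw [a1 1 (by omega) (by omega), h1]) a3 hrn (by omega) ?_ ?_
  · intro k hk
    rw [a2, hsym k hk]
    exact hkey k hk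
  intro c₂ b1 b2 b3 b4 b5 b6 b7
  have b8 : ∀ k < r, c₂.arr 1 k = sym k := fun k hk => by
    rw [b2 1 (by omega) (by omega), a2, hsym k hk]
  refine buildTable_spec hf h (by rw [b1 0 (by omega), a1 0 (by omega) (by omega), h0])
    (by rw [b1 1 (by omega), a1 1 (by omega) (by omega), h1])
    (fun k hk => by rw [b2 0 (by omega) (by omega), a2, hlam k hk]) b8 ⟨b3, b4, ?_⟩ (by omega) ?_
  · intro k l hkl hl
    have := b5 k l hkl hl
    rwa [a2, hsym _ (b3 k (by omega)), hsym _ (b3 l hl)] at this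
  intro c₃ d1 d2 d3 d4 d5 d6 d7 d8 d9 d10 d11
  refine squareUp_spec hf h d7
    (by rw [d1 0 (by omega), b1 0 (by omega), a1 0 (by omega) (by omega), h0]) d5 d4
    (by rw [d1 2 (by omega), b1 2 (by omega), a3]) (by omega) ?_
  intro c₄ s m e1 e2 e3 e4 e5 e6 e7 e8 e9 e10 e11
  -- If squaring stopped because `s` reached about half of `n`, then `n / s ≤ 3`.
  have hG : n / s ≤ n / L ^ 2 + 3 := by
    rcases e9 with e9 | e9
    · exact (Nat.div_le_div_left e9 (by positivity)).trans (by omega)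
    · have : n / s ≤ 3 := Nat.le_of_lt_succ (Nat.div_lt_of_lt_mul (by omega))
      omega
  have hG' : (n - 1) / s < K :=
    ((Nat.div_le_div_right (by omega)).trans hG).trans_lt (by omega)
  have hsr : s * r < K := (Nat.mul_le_mul_right r e8).trans_lt (by omega)
  have r0 : c₄.reg 0 = n := by
    rw [e1 0 (by omega) (by omega) (by omega), d1 0 (by omega), b1 0 (by omega),
      a1 0 (by omega) (by omega), h0]
  have r1 : c₄.reg 1 = r := by
    rw [e1 1 (by omega) (by omega) (by omega), d1 1 (by omega), b1 1 (by omega),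
      a1 1 (by omega) (by omega), h1]
  have T : Table n r F psi lam 1 r (c₄.arr 6) (c₄.arr 7) (c₄.arr 18) := by
    rw [e2 6 (by omega), e2 7 (by omega), e2 18 (by omega)]
    exact d6
  have hP : c₄.arr 4 = c₂.arr 4 := by rw [e2 4 (by omega), d2 4 (by omega)]
  refine walk_spec hf h r0 r1 e4 e3 e6 e7 hsr hG' ⟨T, ?_, ?_, ?_⟩ e5 ?_
  · rw [hP]; exact b3
  · rw [hP, e2 7 (by omega)]; exact d8
  · rw [hP, e2 6 (by omega)]; exact d9
  intro c₅ f1 f2 f3 f4 f5 f6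
  have g1 : ∀ a < 14, c₅.arr a = c₄.arr a := fun a ha => f2 a (by omega)
  refine lcpPhase_spec hf h (s := s) (m := m) (by rw [f1 1 (by omega), r1])
    (by rw [f1 3 (by omega), e4]) (by rw [f1 4 (by omega), e3]) e6 e7 hsr hG' ?_ ?_ f3 f4 ?_
  · rw [g1 6 (by omega), g1 7 (by omega), f2 18 (by omega)]; exact T
  · rw [g1 8 (by omega), g1 9 (by omega), g1 10 (by omega)]; exact e5
  intro c₆ i1 i2 i3 i4 i5 i6
  have hbound := time_bound hr hL e8 hG
  refine hQ c₆ (by rw [i1 0 (by omega), f1 0 (by omega), r0]) ?_ ?_ ?_ (by omega)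
  · rw [i3 2 (by omega), g1 2 (by omega), e2 2 (by omega), d2 2 (by omega), b2 2 (by omega) (by omega),
      a2]
  · rw [i2, i3 15 (by omega), i3 16 (by omega), i3 17 (by omega)]; exact f4
  · rw [i2, i3 15 (by omega)]; exact i4

end RunLengthBWT

/-! ### Composition of programs and the all-ones word. -/

namespace WordRAM

theorem wp_seq {w K : ℕ} {p q : Cmd} {Q : Cfg → Prop} {c : Cfg} (h : wp w K p (wp w K q Q) c) :
    wp w K (p ;; q) Q c := by
  intro s hs
  obtain ⟨t, s', h1, h2⟩ := h s hs
  obtain ⟨t', s'', h3, h4⟩ := h2 s' rfl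
  exact ⟨_, _, .seq h1 h3, by rw [← add_assoc]; exact h4⟩

/-- Subtraction wraps around. -/
theorem wp_ones {w K x : ℕ} (hw : 0 < w) {Q : Cfg → Prop} {c : Cfg}
    (h : Q ((c.set x (2 ^ w - 1)).tick 4)) : wp w K (x ≔ ct 0 -ₑ ct 1) Q c := by
  intro s hs
  refine ⟨_, _, .assign s x _, ?_⟩
  rw [State.cfg_setReg, hs]
  have : ((ct 0 -ₑ ct 1).eval s).toNat = 2 ^ w - 1 := by
    have : 1 < 2 ^ w := Nat.one_lt_two_pow hw.ne'
    simp [Expr.eval, Op.eval, Nat.mod_eq_of_lt this]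
  rw [this]
  exact h

end WordRAM

/-! ### The two programs on the input format, and the final bounds. -/

namespace RunLengthBWT
open WordRAM

/-- The list of the irreducible values. -/
def listProgram : Cmd := irreduciblePhase ;; copyPositions

/-- The bitvector. -/
def bitvectorProgram : Cmd := irreduciblePhase ;; (50 ≔ ct 0 -ₑ ct 1) ;; bitPhase

section text
variable {σ w : ℕ} {T : List ℕ}

theorem inputState_reg (hr : numRuns T ≤ T.length) (hw : T.length < 2 ^ w) :
    ((inputState w T).cfg 0).reg 0 = T.length ∧ ((inputState w T).cfg 0).reg 1 = numRuns T := by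
  simp [State.cfg, inputState, Nat.mod_eq_of_lt hw, Nat.mod_eq_of_lt (hr.trans_lt hw)]

theorem IsText.inputState_arr (h : IsText σ T) (hσ : σ ≤ T.length) (hw : T.length < 2 ^ w) :
    (∀ k < numRuns T, ((inputState w T).cfg 0).arr 0 k = runRow T k + 1) ∧
    (∀ k < numRuns T, ((inputState w T).cfg 0).arr 1 k = runSymbol T k) ∧
    (∀ q, ((inputState w T).cfg 0).arr 2 q = 0) := by
  have hS := h.rowSystem hσ
  refine ⟨fun k hk => ?_, fun k hk => ?_, fun q => ?_⟩
  · have h1 := (mem_runIndices.1 (runRow_of_lt hk).1).1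
    simp only [State.cfg, inputState, if_pos, RLBWT_fst hk, BitVec.toNat_ofNat]
    exact Nat.mod_eq_of_lt (by omega)
  · have h1 : runSymbol T k ≤ T.length := by
      have hl := hS.lam_lt k hk
      have hl' := hS.lam_mono (show k + 1 ≤ numRuns T from hk) le_rfl
      rw [hS.lam_last] at hl'
      obtain ⟨x, hx, hxe⟩ := hS.psi_surj (y := runRow T k) (by omega)
      rw [← hS.F_run k hk x hx hxe.ge (by omega)]
      exact hS.F_le x hx
    simp only [State.cfg, inputState, RLBWT_snd hk]
    simp
    exact Nat.mod_eq_of_lt (by omega)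
  · simp [State.cfg, inputState]

theorem listProgram_spec {K L : ℕ} (h : IsText σ T) (hσ : σ ≤ T.length)
    (hf : Fits w K T.length L)
    (hK : 2 * L ^ 2 * numRuns T + T.length / L ^ 2 + 3 < K) (hrK : numRuns T < K) :
    ∃ t s', Exec (capOf K) listProgram (inputState w T) t s' ∧ HoldsIrreducibleList T s' ∧
      t ≤ 1000 * (T.length / L ^ 2 * L) + 10000 * (numRuns T * L ^ 5) + 20 * numRuns T + 20 := by
  have hS := h.rowSystem hσ
  obtain ⟨r0, r1⟩ := inputState_reg (w := w) hS.r_le hf.lt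
  obtain ⟨r2, r3, r4⟩ := h.inputState_arr hσ hf.lt
  have key : vc w K listProgram (fun c => c.t ≤ 1000 * (T.length / L ^ 2 * L) +
      10000 * (numRuns T * L ^ 5) + 20 * numRuns T + 20 ∧
      ∃ J cnt R E, Recorded (numRuns T) (nextRow T) (runRow T) T.length cnt J R E ∧
      (∀ i < cnt, c.arr 2 i = J i ∧ c.arr 3 i = rowLCP T ((nextRow T)^[J i] 0)))
      ((inputState w T).cfg 0) := by
    simp only [listProgram, vc]
    refine irreduciblePhase_spec hf hS r0 r1 r2 r3 hK ?_
    intro c a1 a2 a3 a4 a5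
    have hcnt := a3.cnt_le hS
    have hrn := hS.r_le
    refine copyPositions_spec hf (hcnt.trans hS.r_le) (hcnt.trans hrK.le) ?_
    intro c' b1 b2 b3 b4
    refine ⟨?_, _, _, _, _, a3, fun i hi => ⟨b1 i hi, ?_⟩⟩
    · have e : ((inputState w T).cfg 0).t = 0 := rfl
      omega
    · rw [b2 3 (by omega)]
      exact a4 i hi
  obtain ⟨t, s', h1, h2, J, cnt, R, E, h3, h4⟩ := key.wp hf.w_pos _ rfl
  refine ⟨t, s', h1, ?_, by simpa [State.cfg] using h2⟩
  have hlist := h.irreducibleList_eq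
  rw [← h3.J_eq] at hlist
  intro k hk
  have hk' : k < cnt := by simpa [hlist] using hk
  obtain ⟨h5, h6⟩ := h4 k hk'
  simp only [hlist, List.getElem_map, entries, List.getElem_range]
  exact ⟨h5, h6⟩

theorem bitvectorProgram_spec {K L : ℕ} (h : IsText σ T) (hσ : σ ≤ T.length)
    (hf : Fits w K T.length L)
    (hK : 2 * L ^ 2 * numRuns T + T.length / L ^ 2 + 3 < K) (hrK : numRuns T < K)
    (hwK : 2 * T.length / w + 1 < K) :
    ∃ t s', Exec (capOf K) bitvectorProgram (inputState w T) t s' ∧ HoldsPLCPsucc T s' ∧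
      t ≤ 1000 * (T.length / L ^ 2 * L) + 10000 * (numRuns T * L ^ 5) + w * 20 +
        numRuns T * 200 + 2 * T.length / w * 50 + 50 := by
  have hS := h.rowSystem hσ
  obtain ⟨r0, r1⟩ := inputState_reg (w := w) hS.r_le hf.lt
  obtain ⟨r2, r3, r4⟩ := h.inputState_arr hσ hf.lt
  have key : wp w K bitvectorProgram (fun c => c.t ≤ 1000 * (T.length / L ^ 2 * L) +
      10000 * (numRuns T * L ^ 5) + w * 20 + numRuns T * 200 + 2 * T.length / w * 50 + 50 ∧
      Bits w (c.arr 2) (fun x => ∃ j, 1 ≤ j ∧ j ≤ T.length ∧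
        x + 1 = 2 * j + rowLCP T ((nextRow T)^[j] 0))) ((inputState w T).cfg 0) := by
    refine wp_seq (vc.wp hf.w_pos ?_)
    refine irreduciblePhase_spec hf hS r0 r1 r2 r3 hK ?_
    intro c a1 a2 a3 a4 a5
    refine wp_seq (wp_ones hf.w_pos (vc.wp hf.w_pos ?_))
    refine bitPhase_spec hf hS (by simp [a1]) (by simp) (by simp [a2, r4]) (by simpa using a3)
      (by simpa using a4) hwK hrK ?_
    intro c' b1 b2
    refine ⟨?_, b1⟩
    have e : ((inputState w T).cfg 0).t = 0 := rfl
    simp at b2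
    omega
  obtain ⟨t, s', h1, h2, h3⟩ := key _ rfl
  refine ⟨t, s', h1, ?_, by simpa [State.cfg] using h2⟩
  intro q b hb _
  refine (h3 q b hb).trans (exists_congr fun j => and_congr_right fun h4 => and_congr_right fun h5 => ?_)
  rw [h.PLCP_eq h4 h5]

end text

/-- The length of the arrays. -/
def arraySize (n r w L : ℕ) : ℕ := 2 * L ^ 2 * r + n / L ^ 2 + 2 * n / w + r + 5

theorem lt_arraySize (n r w L : ℕ) : 2 * L ^ 2 * r + n / L ^ 2 + 3 < arraySize n r w L ∧
    r < arraySize n r w L ∧ 2 * n / w + 1 < arraySize n r w L := by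
  unfold arraySize
  generalize n / L ^ 2 = x
  generalize 2 * n / w = y
  omega

theorem fits_log {w K n : ℕ} (h2 : 2 ≤ n) (hw : n < 2 ^ w) : Fits w K n (Nat.log 2 n + 1) where
  two_le := h2
  lt := hw
  lt_two_pow := Nat.lt_pow_succ_log_self (by omega) n
  two_pow_le := by
    have := Nat.pow_log_le_self 2 (show n ≠ 0 by omega)
    rw [pow_succ]
    omega

theorem lt_of_lt_two_pow {n k : ℕ} (h2 : 2 ≤ n) (h : n < 2 ^ k) : Real.logb 2 n < k := by
  rw [Real.logb_lt_iff_lt_rpow (by norm_num) (by positivity), Real.rpow_natCast]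
  exact_mod_cast h

section bounds
variable {n r w L K : ℕ} {κ : ℝ}

theorem _root_.WordRAM.Fits.log_bounds (hf : Fits w K n L) :
    1 ≤ Real.logb 2 n ∧ Real.logb 2 n ≤ L ∧ (L : ℝ) ≤ 2 * Real.logb 2 n ∧ Real.logb 2 n ≤ w := by
  have hn : (2 : ℝ) ≤ n := by exact_mod_cast hf.two_le
  have h1 : 1 ≤ Real.logb 2 n := by
    rw [Real.le_logb_iff_rpow_le (by norm_num) (by linarith)]
    simpa using hn
  refine ⟨h1, (lt_of_lt_two_pow hf.two_le hf.lt_two_pow).le, ?_,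
    (lt_of_lt_two_pow hf.two_le hf.lt).le⟩
  have h2 : (L : ℝ) ≤ Real.logb 2 (2 * n) := by
    rw [Real.le_logb_iff_rpow_le (by norm_num) (by linarith), Real.rpow_natCast]
    exact_mod_cast hf.two_pow_le
  rw [Real.logb_mul (by norm_num) (by linarith), Real.logb_self_eq_one (by norm_num)] at h2
  linarith

/-- `L` lies between `logb 2 n` and twice that, which turns `10000 * L ^ 5` into at most `320000`
times the fifth power of the logarithm. The summand `20 * |κ|` pays for determining the word length,
the only place where `w` must be bounded from above. -/
theorem time_le (hf : Fits w K n L) (hr : 1 ≤ r) (hκ : (w : ℝ) ≤ κ * Real.logb 2 n) :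
    ((1000 * (n / L ^ 2 * L) + 10000 * (r * L ^ 5) + w * 20 + r * 200 + 2 * n / w * 50 + 50 : ℕ) : ℝ) ≤
      (400000 + 20 * |κ|) * (n / Real.logb 2 n + r * Real.logb 2 n ^ 11) := by
  obtain ⟨h1, h2, h3, h4⟩ := hf.log_bounds
  generalize Real.logb 2 n = l at *
  have hl : 0 < l := by linarith
  have hL : (0 : ℝ) < L := by linarith
  have hr' : (1 : ℝ) ≤ r := by exact_mod_cast hr
  have hp : ∀ k ≤ 11, l ^ k ≤ l ^ 11 := fun k hk => pow_le_pow_right₀ h1 hk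
  have e1 : ((n / L ^ 2 : ℕ) : ℝ) * L ≤ n / l := by
    calc ((n / L ^ 2 : ℕ) : ℝ) * L ≤ (n / (L ^ 2 : ℕ) : ℝ) * L := by
          gcongr; exact Nat.cast_div_le
      _ = n / L := by push_cast; field_simp
      _ ≤ n / l := by gcongr
  have e2 : (r : ℝ) * (L : ℝ) ^ 5 ≤ 32 * (r * l ^ 11) := by
    calc (r : ℝ) * (L : ℝ) ^ 5 ≤ r * (2 * l) ^ 5 := by gcongr
      _ = 32 * (r * l ^ 5) := by ring
      _ ≤ _ := by gcongr; omega
  have e3 : (r : ℝ) ≤ r * l ^ 11 := le_mul_of_one_le_right (by linarith) (one_le_pow₀ h1)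
  have e4 : (w : ℝ) ≤ |κ| * (r * l ^ 11) := by
    calc (w : ℝ) ≤ |κ| * l := hκ.trans (by gcongr; exact le_abs_self κ)
      _ ≤ |κ| * (r * l ^ 11) := by
        gcongr
        calc l = l ^ 1 := (pow_one l).symm
          _ ≤ l ^ 11 := hp 1 (by omega)
          _ ≤ r * l ^ 11 := le_mul_of_one_le_left (by positivity) hr'
  have e5 : ((2 * n / w : ℕ) : ℝ) ≤ 2 * (n / l) := by
    calc ((2 * n / w : ℕ) : ℝ) ≤ ((2 * n : ℕ) : ℝ) / w := Nat.cast_div_le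
      _ ≤ ((2 * n : ℕ) : ℝ) / l := by gcongr
      _ = _ := by push_cast; ring
  have e6 : 0 ≤ |κ| * (n / l) := by positivity
  have e7 : (0 : ℝ) ≤ n / l := by positivity
  push_cast
  nlinarith

theorem space_le (hf : Fits w K n L) (hr : 1 ≤ r) :
    ((arrays * arraySize n r w L : ℕ) : ℝ) ≤
      (400000 + 20 * |κ|) * (n / Real.logb 2 n + r * Real.logb 2 n ^ 10) := by
  obtain ⟨h1, h2, h3, h4⟩ := hf.log_bounds
  generalize Real.logb 2 n = l at *
  have hl : 0 < l := by linarith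
  have hL : (0 : ℝ) < L := by linarith
  have hr' : (1 : ℝ) ≤ r := by exact_mod_cast hr
  have e1 : ((n / L ^ 2 : ℕ) : ℝ) ≤ n / l := by
    calc ((n / L ^ 2 : ℕ) : ℝ) ≤ (n / (L ^ 2 : ℕ) : ℝ) := Nat.cast_div_le
      _ ≤ n / l := by
        gcongr
        push_cast
        nlinarith
  have e2 : (L : ℝ) ^ 2 * r ≤ 4 * (r * l ^ 10) := by
    calc (L : ℝ) ^ 2 * r ≤ (2 * l) ^ 2 * r := by gcongr
      _ = 4 * (r * l ^ 2) := by ring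
      _ ≤ _ := by gcongr; omega
  have e3 : (r : ℝ) ≤ r * l ^ 10 := le_mul_of_one_le_right (by linarith) (one_le_pow₀ h1)
  have e5 : ((2 * n / w : ℕ) : ℝ) ≤ 2 * (n / l) := by
    calc ((2 * n / w : ℕ) : ℝ) ≤ ((2 * n : ℕ) : ℝ) / w := Nat.cast_div_le
      _ ≤ ((2 * n : ℕ) : ℝ) / l := by gcongr
      _ = _ := by push_cast; ring
  have e6 : 0 ≤ |κ| * (n / l + r * l ^ 10) := by positivity
  have e7 : (0 : ℝ) ≤ n / l := by positivity
  simp only [arraySize, arrays]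
  push_cast
  nlinarith

end bounds

theorem bitvectorProgram_computes : ComputesFromRLBWT bitvectorProgram
    (fun n r => n / Real.logb 2 n + r * Real.logb 2 n ^ 11)
    (fun n r => n / Real.logb 2 n + r * Real.logb 2 n ^ 10) HoldsPLCPsucc := by
  intro κ
  refine ⟨400000 + 20 * |κ|, ?_⟩
  rintro T n σ w rfl h2 hσ hT hw hκ
  have hr := (hT.rowSystem hσ).r_pos
  have hf := fits_log (K := arraySize T.length (numRuns T) w (Nat.log 2 T.length + 1)) h2 hw
  obtain ⟨t, s', h3, h4, h5⟩ := bitvectorProgram_spec hT hσ hf (lt_arraySize _ _ _ _).1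
    (lt_arraySize _ _ _ _).2.1 (lt_arraySize _ _ _ _).2.2
  refine ⟨_, t, s', h3, ?_, ?_, h4⟩
  · exact (Nat.cast_le.2 h5).trans (time_le hf hr hκ)
  · rw [capOf_sum]
    exact space_le hf hr

theorem listProgram_computes : ComputesFromRLBWT listProgram
    (fun n r => n / Real.logb 2 n + r * Real.logb 2 n ^ 11)
    (fun n r => n / Real.logb 2 n + r * Real.logb 2 n ^ 10) HoldsIrreducibleList := by
  intro κ
  refine ⟨400000 + 20 * |κ|, ?_⟩
  rintro T n σ w rfl h2 hσ hT hw hκ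
  have hr := (hT.rowSystem hσ).r_pos
  have hf := fits_log (K := arraySize T.length (numRuns T) w (Nat.log 2 T.length + 1)) h2 hw
  obtain ⟨t, s', h3, h4, h5⟩ := listProgram_spec hT hσ hf (lt_arraySize _ _ w _).1
    (lt_arraySize _ _ _ _).2.1
  refine ⟨_, t, s', h3, ?_, ?_, h4⟩
  · exact (Nat.cast_le.2 (h5.trans (by omega))).trans (time_le hf hr hκ)
  · rw [capOf_sum]
    exact space_le hf hr

end RunLengthBWT

theorem mainTheorem10 :
    (∃ p : WordRAM.Cmd, RunLengthBWT.ComputesFromRLBWT p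
      (fun n r => n / Real.logb 2 n + r * Real.logb 2 n ^ 11)
      (fun n r => n / Real.logb 2 n + r * Real.logb 2 n ^ 10)
      RunLengthBWT.HoldsPLCPsucc) ∧
    (∃ p : WordRAM.Cmd, RunLengthBWT.ComputesFromRLBWT p
      (fun n r => n / Real.logb 2 n + r * Real.logb 2 n ^ 11)
      (fun n r => n / Real.logb 2 n + r * Real.logb 2 n ^ 10)
      RunLengthBWT.HoldsIrreducibleList) :=
  ⟨⟨_, RunLengthBWT.bitvectorProgram_computes⟩, ⟨_, RunLengthBWT.listProgram_computes⟩⟩
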